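/- Let $d=2$. For $t>0$ let $A_tf(x)=\int_{S^1}f(x-ty)\,d\sigma(y)$, where $\sigma$ is the normalized arc length on the unit circle, and for $E\subset[1,2]$ let $M_Ef(x)=\sup_{t\in E}|A_tf(x)|$. Let $\mathcal T_E^{rad}$ be the set of $(1/p,1/q)\in[0,1]^2$ such that $M_E$ is bounded from $L^p_{rad}(\mathbb R^2)$ to $L^q(\mathbb R^2)$, i.e. there is a constant $C$ such that for every radial $f\in L^p$ the integrals $A_tf(x)$, $t\in E$, converge absolutely for almost every $x$, $M_Ef$ is measurable and $\|M_Ef\|_q\le C\|f\|_p$. Let $N(F,\delta)$ be the minimal number of intervals of length $\delta$ needed to cover $F$, and let $I$ run over bounded intervals of positive length $|I|$. Put $$\dim_ME=\inf\{a>0:\exists c>0\ \forall\delta\in(0,1)\ \ N(E,\delta)\le c\,\delta^{-a}\},$$ $$\dim_AE=\inf\{a>0:\exists c>0\ \forall I\ \forall\delta\in(0,|I|)\ \ N(E\cap I,\delta)\le c\,(\delta/|I|)^{-a}\},$$ $$\overline\dim_{A,\theta}E=\inf\{a>0:\exists c>0\ \forall\delta\in(0,1)\ \forall I\text{ with }|I|\ge\delta^\theta\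 \ N(E\cap I,\delta)\le c\,(\delta/|I|)^{-a}\},$$ and $\dim_{qA}E=\lim_{\theta\nearrow1}\overline\dim_{A,\theta}E$. Write $\beta=\dim_ME$, $\gamma=\dim_{qA}E$, $\gamma_*=\dim_AE$. Let $O=(0,0)$, $Q_1(\beta)=\left(\frac1{1+\beta},\frac1{1+\beta}\right)$, $Q_2(\beta)=\left(\frac2{3+\beta},\frac1{3+\beta}\right)$, and, for $\beta+1\le2\gamma\le2$, $$Q_3(\beta,\gamma)=\left(\frac{2-\beta(1-\theta)}{2(1+\gamma\theta)},\frac1{2(1+\gamma\theta)}\right),$$ where $\theta=\frac{1-\beta}{2(\gamma-\beta)}$ if $\beta<1$ and $\theta=1$ if $\beta=\gamma=1$. Let $\Delta(\beta)$ be the closed triangle with vertices $O,Q_1(\beta),Q_2(\beta)$, and $\mathcal Q(\beta,\gamma)$ the closed (possibly degenerate) quadrilateral with vertices $O,Q_1(\beta),Q_3(\beta,\gamma),Q_2(2\gamma-1)$. Below, $[P,Q)$ and $(P,Q)$ denote line segments in the plane. **Theorem 1.3.** Let $E\subset[1,2]$ with $\beta,\gamma,\gamma_*$ as above. (i) If $2\gamma<\beta+1$,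 then $$\operatorname{int}\Delta(\beta)\cup[O,Q_1(\beta))\cup(O,Q_2(\max\{\beta,2\gamma_*-1\}))\subset\mathcal T_E^{rad}.$$ (ii) If $2\gamma\ge\beta+1$, then $$\operatorname{int}\mathcal Q(\beta,\gamma)\cup[O,Q_1(\beta))\cup(O,Q_2(2\gamma_*-1))\subset\mathcal T_E^{rad}.$$ -/

import Mathlib

open MeasureTheory Set Filter Topology
open scoped ENNReal NNReal

noncomputable section

namespace CircularMaximal

/-! ## Fractal dimensions of a dilation set -/

/-- `coverNum F δ` is the minimal number of intervals of length `δ` needed to cover `F`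
(meant for bounded `F` and `δ > 0`, when such finite covers exist). -/
def coverNum (F : Set ℝ) (δ : ℝ) : ℕ :=
  sInf {n : ℕ | ∃ c : Fin n → ℝ, F ⊆ ⋃ i, Icc (c i) (c i + δ)}

/-- The (upper) Minkowski dimension. -/
def minkowskiDim (E : Set ℝ) : ℝ :=
  sInf {a : ℝ | 0 < a ∧ ∃ c : ℝ, 0 < c ∧ ∀ δ ∈ Ioo (0 : ℝ) 1,
    (coverNum E δ : ℝ) ≤ c * δ ^ (-a)}

/-- The Assouad dimension; the interval `I` is `[x, x + L]`, of length `L`. -/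
def assouadDim (E : Set ℝ) : ℝ :=
  sInf {a : ℝ | 0 < a ∧ ∃ c : ℝ, 0 < c ∧ ∀ x L δ : ℝ, 0 < δ → δ < L →
    (coverNum (E ∩ Icc x (x + L)) δ : ℝ) ≤ c * (δ / L) ^ (-a)}

/-- The upper Assouad spectrum at `θ`; the interval `I` is `[x, x + L]`, of length `L`. -/
def upperAssouadSpectrum (E : Set ℝ) (θ : ℝ) : ℝ :=
  sInf {a : ℝ | 0 < a ∧ ∃ c : ℝ, 0 < c ∧ ∀ x L δ : ℝ, δ ∈ Ioo (0 : ℝ) 1 → δ ^ θ ≤ L →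
    (coverNum (E ∩ Icc x (x + L)) δ : ℝ) ≤ c * (δ / L) ^ (-a)}

/-- The quasi-Assouad dimension: the limit of the upper Assouad spectrum as `θ ↗ 1`
(the limit always exists, see `tendsto_upperAssouadSpectrum`). -/
def quasiAssouadDim (E : Set ℝ) : ℝ :=
  limUnder (𝓝[<] (1 : ℝ)) (upperAssouadSpectrum E)

theorem coverNum_inter_Icc_le (E : Set ℝ) (x : ℝ) {L δ : ℝ} (hδ : 0 < δ) (hL : δ ≤ L) :
    (coverNum (E ∩ Icc x (x + L)) δ : ℝ) ≤ 2 * (δ / L) ^ (-1 : ℝ) := by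
  have hL0 : 0 < L := hδ.trans_le hL
  have h1 : 1 ≤ L / δ := (one_le_div hδ).2 hL
  have h : coverNum (E ∩ Icc x (x + L)) δ ≤ ⌊L / δ⌋₊ + 1 := by
    refine Nat.sInf_le ⟨fun i => x + (i : ℕ) * δ, ?_⟩
    rintro y ⟨-, hy1, hy2⟩
    have h0 : 0 ≤ (y - x) / δ := div_nonneg (by linarith) hδ.le
    have hle : (y - x) / δ ≤ L / δ := by gcongr; linarith
    refine mem_iUnion.2 ⟨⟨⌊(y - x) / δ⌋₊, Nat.lt_succ_of_le (Nat.floor_le_floor hle)⟩, ?_⟩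
    have ha := Nat.floor_le h0
    have hb := (Nat.lt_floor_add_one ((y - x) / δ)).le
    rw [le_div_iff₀ hδ] at ha
    rw [div_le_iff₀ hδ] at hb
    constructor
    · show x + _ ≤ y
      linarith
    · show y ≤ x + _ + δ
      linarith
  have h2 : ((⌊L / δ⌋₊ + 1 : ℕ) : ℝ) ≤ 2 * (L / δ) := by
    push_cast
    have := Nat.floor_le (zero_le_one.trans h1)
    linarith
  rw [Real.rpow_neg_one, inv_div]
  exact (Nat.cast_le.2 h).trans h2

theorem tendsto_upperAssouadSpectrum (E : Set ℝ) :
    Tendsto (upperAssouadSpectrum E) (𝓝[<] (1 : ℝ)) (𝓝 (quasiAssouadDim E)) := by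
  have key : ∀ θ : ℝ, θ ≤ 1 → (1 : ℝ) ∈ {a : ℝ | 0 < a ∧ ∃ c : ℝ, 0 < c ∧ ∀ x L δ : ℝ,
      δ ∈ Ioo (0 : ℝ) 1 → δ ^ θ ≤ L →
      (coverNum (E ∩ Icc x (x + L)) δ : ℝ) ≤ c * (δ / L) ^ (-a)} := by
    intro θ hθ
    refine ⟨one_pos, 2, two_pos, fun x L δ hδ hL => ?_⟩
    refine coverNum_inter_Icc_le E x hδ.1 (le_trans ?_ hL)
    simpa using Real.rpow_le_rpow_of_exponent_ge hδ.1 hδ.2.le hθ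
  have bdd : ∀ θ : ℝ, BddBelow {a : ℝ | 0 < a ∧ ∃ c : ℝ, 0 < c ∧ ∀ x L δ : ℝ,
      δ ∈ Ioo (0 : ℝ) 1 → δ ^ θ ≤ L →
      (coverNum (E ∩ Icc x (x + L)) δ : ℝ) ≤ c * (δ / L) ^ (-a)} :=
    fun θ => ⟨0, fun a ha => ha.1.le⟩
  have mono : MonotoneOn (upperAssouadSpectrum E) (Iio 1) := by
    intro θ _ θ' hθ' h
    refine csInf_le_csInf (bdd θ) ⟨1, key θ' (le_of_lt hθ')⟩ ?_
    rintro a ⟨ha, c, hc, H⟩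
    exact ⟨ha, c, hc, fun x L δ hδ hL => H x L δ hδ
      ((Real.rpow_le_rpow_of_exponent_ge hδ.1 hδ.2.le h).trans hL)⟩
  have bdd' : BddAbove (upperAssouadSpectrum E '' Iio 1) := by
    refine ⟨1, ?_⟩
    rintro _ ⟨θ, hθ, rfl⟩
    exact csInf_le (bdd θ) (key θ (le_of_lt hθ))
  exact tendsto_nhds_limUnder ⟨_, mono.tendsto_nhdsLT bdd'⟩

/-! ## The circular maximal operator on radial functions -/

/-- The Euclidean plane. -/
abbrev Plane : Type := EuclideanSpace ℝ (Fin 2)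

/-- The point `(cos φ, sin φ)` of the unit circle. -/
def circlePoint (φ : ℝ) : Plane := !₂[Real.cos φ, Real.sin φ]

/-- The average `∫_{S¹} f (x - t y) dσ(y)`, where `σ` is the normalized arc length of the
unit circle. -/
def circleMean (t : ℝ) (f : Plane → ℂ) (x : Plane) : ℂ :=
  (((2 * Real.pi)⁻¹ : ℝ) : ℂ) * ∫ φ in (0 : ℝ)..2 * Real.pi, f (x - t • circlePoint φ)

/-- The maximal function `sup_{t ∈ E} |A_t f (x)|`, with values in `[0, ∞]`. -/
def circularMaximal (E : Set ℝ) (f : Plane → ℂ) (x : Plane) : ℝ≥0∞ :=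
  ⨆ t ∈ E, ‖circleMean t f x‖ₑ

/-- `f x` depends on `‖x‖` only. -/
def IsRadial (f : Plane → ℂ) : Prop := ∀ x y : Plane, ‖x‖ = ‖y‖ → f x = f y

/-- The maximal operator over `E` is bounded from the radial functions in `L^p` to `L^q`.
This includes that, for every radial `f` in `L^p`, at almost every `x` all the integrals
that define the averages converge absolutely, and that the maximal function is measurable. -/
def IsRadiallyBounded (E : Set ℝ) (p q : ℝ≥0∞) : Prop :=
  ∃ C : ℝ≥0, ∀ f : Plane → ℂ, IsRadial f → MemLp f p volume →
    (∀ᵐ x : Plane, ∀ t ∈ E,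
      IntervalIntegrable (fun φ : ℝ => f (x - t • circlePoint φ)) volume 0 (2 * Real.pi)) ∧
    AEMeasurable (circularMaximal E f) volume ∧
    eLpNorm (circularMaximal E f) q volume ≤ C * eLpNorm f p volume

/-- The radial type set: all `(1/p, 1/q) ∈ [0,1]²` (with `1/∞ = 0`) such that the maximal
operator over `E` is bounded from radial `L^p` to `L^q`. -/
def radialTypeSet (E : Set ℝ) : Set (ℝ × ℝ) :=
  {u | u.1 ∈ Icc (0 : ℝ) 1 ∧ u.2 ∈ Icc (0 : ℝ) 1 ∧
    IsRadiallyBounded E (ENNReal.ofReal u.1)⁻¹ (ENNReal.ofReal u.2)⁻¹}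

/-! ## The regions of exponents -/

/-- The point `Q₁(β)`. -/
def Q1 (β : ℝ) : ℝ × ℝ := (1 / (1 + β), 1 / (1 + β))

/-- The point `Q₂(β)`. -/
def Q2 (β : ℝ) : ℝ × ℝ := (2 / (3 + β), 1 / (3 + β))

/-- The parameter `θ(β, γ)`. -/
def theta (β γ : ℝ) : ℝ := if β < 1 then (1 - β) / (2 * (γ - β)) else 1

/-- The point `Q₃(β, γ)`. -/
def Q3 (β γ : ℝ) : ℝ × ℝ :=
  ((2 - β * (1 - theta β γ)) / (2 * (1 + γ * theta β γ)), 1 / (2 * (1 + γ * theta β γ)))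

/-- The closed triangle `Δ(β)` with vertices `O`, `Q₁(β)`, `Q₂(β)`. -/
def triangle (β : ℝ) : Set (ℝ × ℝ) := convexHull ℝ {0, Q1 β, Q2 β}

/-- The closed quadrilateral `𝒬(β, γ)` with vertices `O`, `Q₁(β)`, `Q₃(β, γ)`, `Q₂(2γ - 1)`.
These points are in convex position (`Q₃(β, γ)` lies on `[Q₁(β), Q₂(β)]` and `Q₂(2γ - 1)`
on `[O, Q₂(β)]`) when `0 ≤ β` and `β + 1 ≤ 2γ ≤ 2`. -/
def quadrilateral (β γ : ℝ) : Set (ℝ × ℝ) :=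
  convexHull ℝ {0, Q1 β, Q3 β γ, Q2 (2 * γ - 1)}

end CircularMaximal

end

open MeasureTheory Set Filter Topology
open scoped ENNReal NNReal

noncomputable section

namespace CircularMaximal

/-! ## Sums over dyadic scales -/

/-! For radial `f` with profile `g`, the circular mean at radius `r` is, up to a constant, the
integral of `g` against `radKernel r t`, which lives on `|r - t| < s < r + t` and has inverse square
root singularities at both ends. Hence the means are dominated by truncated fractional integrals of
order 1/2 of a weighted profile, evaluated at `r + t` and `|r - t|` (`ofReal_mul_radMean_le`,
`radMean_le_of_small`).

Such a fractional integral is a sum over dyadic δ of δ^(-1/2) times integrals over windows of radius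
δ. A window integral hardly notices a change of `t` by δ, so the supremum over `t ∈ E` is controlled
by an integral over a δ-neighbourhood, and after Fubini `E` enters only through the volume of its
δ-neighbourhood (`exists_majorant`). If this volume is O(δ^b), Young's inequality gives the scale δ
the factor δ^(q/2 - q/p + b) (`exists_majorant_of_power`).

Radii above 1/4 see all of `E`; there `b` is any number below 1 - β, and the profile near the origin
imposes 2/p < 1 + (1 - β)/q. Radii of size ρ ≤ 1/4 see only a piece of `E` of length about ρ, while
the kernel costs ρ^(-1/2). The covering number of that piece is bounded both by δ^(-β-ε) and by ρ^γ
δ^(-γ-ε), up to constants, hence by every weighted geometric mean of the two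
(`nbhdBound_interpolated`). With a rescaled weight `l` as a free parameter, the resulting conditions
on (1/p, 1/q, l) are linear. The set of admissible (1/p, 1/q) is therefore convex, and it suffices
to check that its closed version `exponentRegion` contains the vertices.

On the edge q = 2p the powers of ρ cancel, so no ε may be lost in ρ. The Assouad dimension provides
decay in δ/ρ, and for a fixed ratio δ/ρ the sum over ρ is bounded by the scale invariant inequality
`exists_tsum_winInt_le`. The diagonal satisfies the strict conditions directly. At the origin the
bound is trivial, and measurability is inherited from a finite exponent. For finite exponents,
measurability of the maximal function follows by approximation with continuous radial functions
(`ProfileBound.isRadiallyBounded`). -/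

theorem summable_two_rpow {a : ℝ} (ha : 0 < a) : Summable fun j : ℕ => (2 : ℝ) ^ (-(j * a)) := by
  have h : (fun j : ℕ => (2 : ℝ) ^ (-(j * a))) = fun j : ℕ => ((2 : ℝ) ^ (-a)) ^ j := by
    ext j
    rw [← Real.rpow_natCast, ← Real.rpow_mul zero_le_two]
    congr 1; ring
  rw [h]
  exact summable_geometric_of_lt_one (by positivity)
    (Real.rpow_lt_one_of_one_lt_of_neg one_lt_two (by linarith))

theorem tsum_two_rpow_ne_top {a : ℝ} (ha : 0 < a) :
    ∑' j : ℕ, ENNReal.ofReal ((2 : ℝ) ^ (-(j * a))) ≠ ⊤ :=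
  (summable_two_rpow ha).tsum_ofReal_ne_top

/-- A weighted form of the power mean inequality: exponential weights make up for the lack of
convexity. -/
theorem exists_tsum_rpow_le {q κ : ℝ} (hq : 0 < q) (hκ : 0 < κ) :
    ∃ C : ℝ≥0∞, C ≠ ⊤ ∧ ∀ x : ℕ → ℝ≥0∞,
      (∑' j, x j) ^ q ≤ C * ∑' j : ℕ, ENNReal.ofReal ((2 : ℝ) ^ (j * κ)) * x j ^ q := by
  refine ⟨(∑' j : ℕ, ENNReal.ofReal ((2 : ℝ) ^ (-(j * (κ / q))))) ^ q,
    ENNReal.rpow_ne_top_of_nonneg hq.le (tsum_two_rpow_ne_top (by positivity)), fun x => ?_⟩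
  set S := ∑' j : ℕ, ENNReal.ofReal ((2 : ℝ) ^ (j * κ)) * x j ^ q with hS
  -- Each single term of `S` is at most `S`; this already bounds `x j` by a summable geometric
  -- weight times `S ^ (1 / q)`.
  have hx : ∀ j, x j ≤ ENNReal.ofReal ((2 : ℝ) ^ (-(j * (κ / q)))) * S ^ (1 / q) := by
    intro j
    have h1 : ENNReal.ofReal ((2 : ℝ) ^ (j * κ)) * x j ^ q ≤ S := ENNReal.le_tsum j
    have h2 : x j ^ q ≤ (ENNReal.ofReal ((2 : ℝ) ^ (-(j * (κ / q)))) * S ^ (1 / q)) ^ q := by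
      rw [ENNReal.mul_rpow_of_nonneg _ _ hq.le, ← ENNReal.rpow_mul, one_div,
        inv_mul_cancel₀ hq.ne', ENNReal.rpow_one, ENNReal.ofReal_rpow_of_pos (by positivity),
        ← Real.rpow_mul zero_le_two]
      calc x j ^ q = ENNReal.ofReal ((2 : ℝ) ^ (-(j * (κ / q)) * q)) *
            (ENNReal.ofReal ((2 : ℝ) ^ (j * κ)) * x j ^ q) := by
            rw [← mul_assoc, ← ENNReal.ofReal_mul (by positivity), ← Real.rpow_add two_pos]
            have : -(j * (κ / q)) * q + j * κ = 0 := by field_simp; ring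
            rw [this]; simp
        _ ≤ _ := by gcongr
    exact (ENNReal.rpow_le_rpow_iff hq).1 h2
  calc (∑' j, x j) ^ q ≤ (∑' j : ℕ, ENNReal.ofReal ((2 : ℝ) ^ (-(j * (κ / q)))) * S ^ (1 / q)) ^ q := by
        gcongr with j; exact hx j
    _ = _ := by
        rw [ENNReal.tsum_mul_right, ENNReal.mul_rpow_of_nonneg _ _ hq.le, ← ENNReal.rpow_mul,
          one_div, inv_mul_cancel₀ hq.ne', ENNReal.rpow_one]

theorem add_rpow_le' {q : ℝ} (hq : 0 < q) (a b : ℝ≥0∞) :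
    (a + b) ^ q ≤ ENNReal.ofReal (2 ^ q) * (a ^ q + b ^ q) := by
  have h2 : (2 : ℝ≥0∞) ^ q = ENNReal.ofReal (2 ^ q) := by
    rw [← ENNReal.ofReal_rpow_of_pos two_pos]; simp
  rw [← h2]
  rcases le_total a b with h | h
  · calc (a + b) ^ q ≤ (2 * b) ^ q := by gcongr; rw [two_mul]; gcongr
      _ = 2 ^ q * b ^ q := ENNReal.mul_rpow_of_nonneg _ _ hq.le
      _ ≤ _ := by gcongr; exact le_add_self
  · calc (a + b) ^ q ≤ (2 * a) ^ q := by gcongr; rw [two_mul]; gcongr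
      _ = 2 ^ q * a ^ q := ENNReal.mul_rpow_of_nonneg _ _ hq.le
      _ ≤ _ := by gcongr; exact le_self_add

/-! ## Integrals over windows and integrals of order one half -/

/-- The integral of `G` over the window of radius `δ` about `u`. -/
def winInt (G : ℝ → ℝ≥0∞) (δ u : ℝ) : ℝ≥0∞ := ∫⁻ s in Ioo (u - δ) (u + δ), G s

/-- The truncated fractional integral of order `1 / 2` of `G`. -/
def halfPot (G : ℝ → ℝ≥0∞) (σ x : ℝ) : ℝ≥0∞ :=
  ∫⁻ s in Ioo (x - σ) (x + σ), G s * ENNReal.ofReal (|s - x| ^ (-(1 / 2) : ℝ))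

theorem winInt_eq (G : ℝ → ℝ≥0∞) (δ u : ℝ) :
    winInt G δ u = ∫⁻ s, {z : ℝ × ℝ | |z.1 - z.2| < δ}.indicator (fun z => G z.2) (u, s) := by
  rw [winInt, ← lintegral_indicator measurableSet_Ioo]
  congr 1; ext s
  simp only [indicator, mem_Ioo, mem_ofPred_eq, abs_lt]
  congr 1
  apply propext; constructor <;> rintro ⟨h1, h2⟩ <;> constructor <;> linarith

theorem measurableSet_window (δ : ℝ) : MeasurableSet {z : ℝ × ℝ | |z.1 - z.2| < δ} :=
  measurableSet_lt (by fun_prop) measurable_const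

theorem measurable_winInt {G : ℝ → ℝ≥0∞} (hG : Measurable G) (δ : ℝ) :
    Measurable (winInt G δ) := by
  simp_rw [funext (winInt_eq G δ)]
  exact Measurable.lintegral_prod_right'
    (((hG.comp measurable_snd).indicator (measurableSet_window δ)))

theorem lintegral_winInt {G : ℝ → ℝ≥0∞} (hG : Measurable G) (δ : ℝ) :
    ∫⁻ u, winInt G δ u = ENNReal.ofReal (2 * δ) * ∫⁻ s, G s := by
  simp_rw [winInt_eq]
  rw [lintegral_lintegral_swap]
  · rw [← lintegral_const_mul _ hG]
    congr 1; ext s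
    have : ∀ u, {z : ℝ × ℝ | |z.1 - z.2| < δ}.indicator (fun z => G z.2) (u, s) =
        (Ioo (s - δ) (s + δ)).indicator (fun _ => G s) u := by
      intro u
      simp only [indicator, mem_Ioo, mem_ofPred_eq, abs_lt]
      congr 1
      apply propext; constructor <;> rintro ⟨h1, h2⟩ <;> constructor <;> linarith
    simp_rw [this]
    rw [lintegral_indicator measurableSet_Ioo, setLIntegral_const, Real.volume_Ioo, mul_comm]
    congr 2; ring
  · exact ((hG.comp measurable_snd).indicator (measurableSet_window δ)).aemeasurable

theorem winInt_mono_fun {G H : ℝ → ℝ≥0∞} (h : ∀ s, G s ≤ H s) (δ u : ℝ) :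
    winInt G δ u ≤ winInt H δ u := lintegral_mono h

theorem winInt_rpow_le_self {G : ℝ → ℝ≥0∞} {p δ : ℝ} (hp : 1 ≤ p) (hG : Measurable G) (u : ℝ) :
    winInt G δ u ^ p ≤ ENNReal.ofReal (2 * δ) ^ (p - 1) * winInt (fun s => G s ^ p) δ u := by
  rcases hp.eq_or_lt with rfl | hp
  · simp
  have hpq := Real.HolderConjugate.conjExponent hp
  have h := ENNReal.lintegral_mul_le_Lp_mul_Lq (volume.restrict (Ioo (u - δ) (u + δ))) hpq
    hG.aemeasurable (aemeasurable_const (b := (1 : ℝ≥0∞)))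
  simp only [Pi.mul_apply, mul_one, ENNReal.one_rpow, lintegral_const, one_mul,
    Measure.restrict_apply MeasurableSet.univ, univ_inter, Real.volume_Ioo] at h
  have h2 := ENNReal.rpow_le_rpow h (zero_le_one.trans hp.le)
  rw [ENNReal.mul_rpow_of_nonneg _ _ (by linarith), ← ENNReal.rpow_mul, ← ENNReal.rpow_mul,
    one_div_mul_cancel (by linarith), ENNReal.rpow_one, mul_comm] at h2
  have e : 1 / p.conjExponent * p = p - 1 := by
    rw [Real.conjExponent]; field_simp
  rw [e] at h2
  rw [winInt, winInt]
  convert h2 using 4; ring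

theorem winInt_le {G : ℝ → ℝ≥0∞} {p δ : ℝ} (hp : 1 ≤ p) (hG : Measurable G) (u : ℝ) :
    winInt G δ u ≤ ENNReal.ofReal (2 * δ) ^ (1 - 1 / p) * (∫⁻ s, G s ^ p) ^ (1 / p) := by
  have hp0 : 0 < p := by linarith
  have h := ENNReal.rpow_le_rpow (winInt_rpow_le_self (δ := δ) hp hG u) (by positivity : 0 ≤ 1 / p)
  rw [← ENNReal.rpow_mul, mul_one_div_cancel hp0.ne', ENNReal.rpow_one,
    ENNReal.mul_rpow_of_nonneg _ _ (by positivity), ← ENNReal.rpow_mul] at h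
  have e : (p - 1) * (1 / p) = 1 - 1 / p := by field_simp
  rw [e] at h
  refine h.trans ?_
  gcongr
  exact setLIntegral_le_lintegral _ _

theorem lintegral_winInt_rpow_self_le {G : ℝ → ℝ≥0∞} {p δ : ℝ} (hp : 1 ≤ p) (hδ : 0 < δ)
    (hG : Measurable G) :
    ∫⁻ u, winInt G δ u ^ p ≤ ENNReal.ofReal (2 * δ) ^ p * ∫⁻ s, G s ^ p := by
  calc ∫⁻ u, winInt G δ u ^ p
      ≤ ∫⁻ u, ENNReal.ofReal (2 * δ) ^ (p - 1) * winInt (fun s => G s ^ p) δ u :=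
        lintegral_mono fun u => winInt_rpow_le_self hp hG u
    _ = ENNReal.ofReal (2 * δ) ^ (p - 1) * (ENNReal.ofReal (2 * δ) * ∫⁻ s, G s ^ p) := by
        rw [lintegral_const_mul _ (measurable_winInt (hG.pow_const p) δ),
          lintegral_winInt (hG.pow_const p)]
    _ = _ := by
        rw [← mul_assoc]
        congr 1
        nth_rw 2 [← ENNReal.rpow_one (ENNReal.ofReal (2 * δ))]
        rw [← ENNReal.rpow_add _ _ (by simpa using hδ) ENNReal.ofReal_ne_top]
        congr 1; ring

/-- Young's inequality for convolution with the indicator of a window: of the exponent `q`, the part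
`q - p` is bounded pointwise by Hölder and the part `p` in the mean. -/
theorem lintegral_winInt_rpow_le {G : ℝ → ℝ≥0∞} {p q δ : ℝ} (hp : 1 ≤ p) (hpq : p ≤ q)
    (hδ : 0 < δ) (hG : Measurable G) :
    ∫⁻ u, winInt G δ u ^ q ≤
      ENNReal.ofReal ((2 * δ) ^ (q - q / p + 1)) * (∫⁻ s, G s ^ p) ^ (q / p) := by
  have hp0 : 0 < p := by linarith
  set S := ∫⁻ s, G s ^ p
  have hd0 : ENNReal.ofReal (2 * δ) ≠ 0 := by simpa using hδ
  calc ∫⁻ u, winInt G δ u ^ q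
      = ∫⁻ u, winInt G δ u ^ (q - p) * winInt G δ u ^ p := by
        congr 1; ext u
        rw [← ENNReal.rpow_add_of_nonneg _ _ (by linarith) hp0.le]; congr 1; ring
    _ ≤ ∫⁻ u, (ENNReal.ofReal (2 * δ) ^ (1 - 1 / p) * S ^ (1 / p)) ^ (q - p) *
          winInt G δ u ^ p := by
        gcongr with u
        exact winInt_le hp hG u
    _ = (ENNReal.ofReal (2 * δ) ^ (1 - 1 / p) * S ^ (1 / p)) ^ (q - p) *
          ∫⁻ u, winInt G δ u ^ p := lintegral_const_mul _ ((measurable_winInt hG δ).pow_const p)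
    _ ≤ (ENNReal.ofReal (2 * δ) ^ (1 - 1 / p) * S ^ (1 / p)) ^ (q - p) *
          (ENNReal.ofReal (2 * δ) ^ p * S) := by
        gcongr; exact lintegral_winInt_rpow_self_le hp hδ hG
    _ = _ := by
        rw [ENNReal.mul_rpow_of_nonneg _ _ (by linarith), ← ENNReal.rpow_mul, ← ENNReal.rpow_mul,
          mul_mul_mul_comm, ← ENNReal.rpow_add _ _ hd0 ENNReal.ofReal_ne_top,
          ← ENNReal.ofReal_rpow_of_pos (by positivity)]
        congr 1
        · congr 1; field_simp; ring
        · nth_rw 2 [← ENNReal.rpow_one S]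
          rw [← ENNReal.rpow_add_of_nonneg _ _ (mul_nonneg (by positivity) (by linarith)) zero_le_one]
          congr 1; field_simp; ring

/-- The window about `x` lies in the doubled window about every `u` within `δ` of `x`, so the value
at `x` is at most an average over these `u`. This turns a supremum over dilations into an integral.
-/
theorem winInt_rpow_le_setLIntegral (G : ℝ → ℝ≥0∞) {q δ : ℝ} (hq : 0 ≤ q) (hδ : 0 < δ) (x : ℝ) :
    winInt G δ x ^ q ≤ ENNReal.ofReal (2 * δ)⁻¹ *
      ∫⁻ u in Ioo (x - δ) (x + δ), winInt G (2 * δ) u ^ q := by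
  have h : winInt G δ x ^ q * volume (Ioo (x - δ) (x + δ)) ≤
      ∫⁻ u in Ioo (x - δ) (x + δ), winInt G (2 * δ) u ^ q := by
    rw [← setLIntegral_const]
    refine setLIntegral_mono' measurableSet_Ioo fun u hu => ?_
    gcongr
    refine lintegral_mono_set fun s hs => ?_
    constructor <;> linarith [hu.1, hu.2, hs.1, hs.2]
  rw [Real.volume_Ioo, (by ring : x + δ - (x - δ) = 2 * δ)] at h
  calc winInt G δ x ^ q = ENNReal.ofReal (2 * δ)⁻¹ * (winInt G δ x ^ q * ENNReal.ofReal (2 * δ)) := by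
        rw [mul_comm, mul_assoc, ← ENNReal.ofReal_mul (by positivity),
          mul_inv_cancel₀ (by positivity)]
        simp
    _ ≤ _ := by gcongr

theorem halfPot_le_tsum {G : ℝ → ℝ≥0∞} (hG : Measurable G) {σ : ℝ} (hσ : 0 < σ) (x : ℝ) :
    halfPot G σ x ≤ ∑' j : ℕ, ENNReal.ofReal (2 * (σ * 2 ^ (-j : ℝ)) ^ (-(1 / 2) : ℝ)) *
      winInt G (σ * 2 ^ (-j : ℝ)) x := by
  have hmeas : ∀ j : ℕ, Measurable fun s =>
      (Ioo (x - σ * 2 ^ (-j : ℝ)) (x + σ * 2 ^ (-j : ℝ))).indicator G s :=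
    fun j => hG.indicator measurableSet_Ioo
  have key : ∀ s ∈ Ioo (x - σ) (x + σ), s ≠ x → G s * ENNReal.ofReal (|s - x| ^ (-(1 / 2) : ℝ)) ≤
      ∑' j : ℕ, ENNReal.ofReal (2 * (σ * 2 ^ (-j : ℝ)) ^ (-(1 / 2) : ℝ)) *
        (Ioo (x - σ * 2 ^ (-j : ℝ)) (x + σ * 2 ^ (-j : ℝ))).indicator G s := by
    intro s hs hsx
    have hv0 : 0 < |s - x| := abs_pos.2 (sub_ne_zero.2 hsx)
    have hv1 : |s - x| < σ := abs_lt.2 ⟨by linarith [hs.1], by linarith [hs.2]⟩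
    obtain ⟨n, hn1, hn2⟩ := exists_nat_pow_near_of_lt_one (y := (1 / 2 : ℝ))
      (x := |s - x| / σ) (div_pos hv0 hσ) ((div_le_one hσ).2 hv1.le) (by norm_num) (by norm_num)
    -- The windows are open, so the upper inequality must be strict. Passing to the preceding dyadic
    -- scale ensures this and costs a factor 2, whence the 4 here and the factor 2 = 4^(1/2) in the
    -- statement.
    have hex : ∃ n : ℕ, σ * 2 ^ (-(n : ℝ)) / 4 ≤ |s - x| ∧ |s - x| < σ * 2 ^ (-(n : ℝ)) := by
      have e : ∀ k : ℕ, (2 : ℝ) ^ (-(k : ℝ)) = (1 / 2) ^ k := by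
        intro k
        rw [Real.rpow_neg zero_le_two, Real.rpow_natCast, one_div, inv_pow]
      rcases n with _ | n
      · refine ⟨0, ?_, by simpa using hv1⟩
        rw [lt_div_iff₀ hσ] at hn1
        rw [e]; norm_num at hn1 ⊢; linarith
      · refine ⟨n, ?_, ?_⟩
        · rw [lt_div_iff₀ hσ] at hn1
          rw [e]; rw [pow_succ, pow_succ] at hn1; nlinarith
        · rw [div_le_iff₀ hσ] at hn2
          rw [e]; rw [pow_succ] at hn2
          have : 0 < (1 / 2 : ℝ) ^ n := by positivity
          nlinarith
    obtain ⟨n, h1, h2⟩ := hex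
    refine le_trans ?_ (ENNReal.le_tsum n)
    have hmem : s ∈ Ioo (x - σ * 2 ^ (-n : ℝ)) (x + σ * 2 ^ (-n : ℝ)) := by
      rw [abs_lt] at h2
      constructor <;> linarith [h2.1, h2.2]
    rw [indicator_of_mem hmem, mul_comm]
    gcongr
    have hδ : 0 < σ * 2 ^ (-(n : ℝ)) := by positivity
    calc |s - x| ^ (-(1 / 2) : ℝ) ≤ (σ * 2 ^ (-(n : ℝ)) / 4) ^ (-(1 / 2) : ℝ) :=
          Real.rpow_le_rpow_of_nonpos (by positivity) h1 (by norm_num)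
      _ = 2 * (σ * 2 ^ (-(n : ℝ))) ^ (-(1 / 2) : ℝ) := by
          rw [Real.div_rpow hδ.le (by norm_num), (by norm_num : (4 : ℝ) = 2 ^ (2 : ℝ)),
            ← Real.rpow_mul zero_le_two, (by norm_num : (2 : ℝ) * -(1 / 2) = -1), Real.rpow_neg_one]
          field_simp
  calc halfPot G σ x
      ≤ ∫⁻ s in Ioo (x - σ) (x + σ), ∑' j : ℕ,
          ENNReal.ofReal (2 * (σ * 2 ^ (-j : ℝ)) ^ (-(1 / 2) : ℝ)) *
          (Ioo (x - σ * 2 ^ (-j : ℝ)) (x + σ * 2 ^ (-j : ℝ))).indicator G s := by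
        refine lintegral_mono_ae ?_
        have hne : ∀ᵐ s : ℝ, s ≠ x := by simp [ae_iff]
        filter_upwards [ae_restrict_mem measurableSet_Ioo, ae_restrict_of_ae hne] with s hs h
        exact key s hs h
    _ ≤ ∫⁻ s, ∑' j : ℕ, ENNReal.ofReal (2 * (σ * 2 ^ (-j : ℝ)) ^ (-(1 / 2) : ℝ)) *
          (Ioo (x - σ * 2 ^ (-j : ℝ)) (x + σ * 2 ^ (-j : ℝ))).indicator G s :=
        setLIntegral_le_lintegral _ _
    _ = _ := by
        rw [lintegral_tsum fun j => ((hmeas j).const_mul _).aemeasurable]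
        congr 1; ext j
        rw [lintegral_const_mul _ (hmeas j), lintegral_indicator measurableSet_Ioo]
        rfl

/-! ## Maximal functions of the fractional integrals -/

/-- `E` is arbitrary, so the union over `t` may be uncountable; measurability comes from openness.
-/
theorem measurableSet_near (E : Set ℝ) (e₁ e₂ δ : ℝ) :
    MeasurableSet {z : ℝ × ℝ | ∃ t ∈ E, |z.2 - (e₁ * z.1 + e₂ * t)| < δ} := by
  have : {z : ℝ × ℝ | ∃ t ∈ E, |z.2 - (e₁ * z.1 + e₂ * t)| < δ} =
      ⋃ t ∈ E, {z : ℝ × ℝ | |z.2 - (e₁ * z.1 + e₂ * t)| < δ} := by ext; simp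
  rw [this]
  exact (isOpen_biUnion fun t _ => isOpen_lt (by fun_prop) continuous_const).measurableSet

/-- A measurable majorant of the maximal function of `halfPot G σ`, with a bound for its integral
in terms of the measure of neighbourhoods of the dilation set. -/
theorem exists_majorant {q κ : ℝ} (hq : 0 < q) (hκ : 0 < κ) :
    ∃ C : ℝ≥0∞, C ≠ ⊤ ∧ ∀ (E : Set ℝ) (e₁ e₂ σ : ℝ), 0 < σ → ∀ J : Set ℝ, MeasurableSet J →
      ∀ (W : ℕ → ℝ≥0∞) (G : ℝ → ℝ≥0∞), Measurable G →
      (∀ (j : ℕ) (u : ℝ), volume (J ∩ {r | ∃ t ∈ E, |u - (e₁ * r + e₂ * t)| <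
        σ * 2 ^ (-j : ℝ)}) ≤ W j) →
      ∃ B : ℝ → ℝ≥0∞, Measurable B ∧
        (∀ r, ∀ t ∈ E, halfPot G σ (e₁ * r + e₂ * t) ^ q ≤ B r) ∧
        ∫⁻ r in J, B r ≤ C * ∑' j : ℕ, ENNReal.ofReal (2 ^ (j * κ) *
          (σ * 2 ^ (-j : ℝ)) ^ (-(q / 2) - 1)) * W j *
            ∫⁻ u, winInt G (2 * (σ * 2 ^ (-j : ℝ))) u ^ q := by
  obtain ⟨C, hC, hsum⟩ := exists_tsum_rpow_le hq hκ
  refine ⟨C * ENNReal.ofReal (2 ^ (q - 1)), ENNReal.mul_ne_top hC ENNReal.ofReal_ne_top, ?_⟩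
  intro E e₁ e₂ σ hσ J hJ W G hG hW
  obtain ⟨δ, hδ⟩ : ∃ δ : ℕ → ℝ, ∀ j : ℕ, δ j = σ * 2 ^ (-j : ℝ) := ⟨_, fun _ => rfl⟩
  have hδ0 : ∀ j, 0 < δ j := fun j => by rw [hδ]; positivity
  simp only [← hδ] at hW ⊢
  set c : ℕ → ℝ≥0∞ := fun j => ENNReal.ofReal (2 ^ (j * κ) * (δ j) ^ (-(q / 2) - 1)) with hc
  -- For fixed `r`, the integral of `A j (r, u)` in `u` runs over the `δ j`-neighbourhood of `e₁ * r
  -- + e₂ * E`. It dominates all `t ∈ E` at once and, unlike a supremum over `E`, is clearly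
  -- measurable in `r`.
  set A : ℕ → ℝ × ℝ → ℝ≥0∞ := fun j =>
    {z : ℝ × ℝ | ∃ t ∈ E, |z.2 - (e₁ * z.1 + e₂ * t)| < δ j}.indicator
      (fun z => winInt G (2 * δ j) z.2 ^ q) with hA
  have hAm : ∀ j, Measurable (A j) := fun j =>
    ((((measurable_winInt hG _).comp measurable_snd).pow_const q)).indicator
      (measurableSet_near E e₁ e₂ (δ j))
  have hAm' : ∀ j, Measurable fun r => ∫⁻ u, A j (r, u) := fun j => (hAm j).lintegral_prod_right'
  have hterm : ∀ r, ∀ t ∈ E, ∀ j : ℕ, ENNReal.ofReal ((2 : ℝ) ^ (j * κ)) *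
      (ENNReal.ofReal (2 * (δ j) ^ (-(1 / 2) : ℝ)) * winInt G (δ j) (e₁ * r + e₂ * t)) ^ q ≤
      ENNReal.ofReal (2 ^ (q - 1)) * (c j * ∫⁻ u, A j (r, u)) := by
    intro r t ht j
    have h1 := winInt_rpow_le_setLIntegral G hq.le (hδ0 j) (e₁ * r + e₂ * t)
    have h2 : ∫⁻ u in Ioo (e₁ * r + e₂ * t - δ j) (e₁ * r + e₂ * t + δ j),
        winInt G (2 * δ j) u ^ q ≤ ∫⁻ u, A j (r, u) := by
      rw [← lintegral_indicator measurableSet_Ioo]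
      refine lintegral_mono fun u => indicator_le' (g := fun u => A j (r, u)) (fun u hu => ?_) (fun _ _ => zero_le) u
      rw [hA]
      have : (r, u) ∈ {z : ℝ × ℝ | ∃ t ∈ E, |z.2 - (e₁ * z.1 + e₂ * t)| < δ j} :=
        ⟨t, ht, abs_lt.2 ⟨by linarith [hu.1], by linarith [hu.2]⟩⟩
      simp only [indicator_of_mem this, le_refl]
    calc ENNReal.ofReal ((2 : ℝ) ^ (j * κ)) *
          (ENNReal.ofReal (2 * (δ j) ^ (-(1 / 2) : ℝ)) * winInt G (δ j) (e₁ * r + e₂ * t)) ^ q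
        ≤ ENNReal.ofReal ((2 : ℝ) ^ (j * κ)) *
          (ENNReal.ofReal ((2 * (δ j) ^ (-(1 / 2) : ℝ)) ^ q) *
            (ENNReal.ofReal (2 * δ j)⁻¹ * ∫⁻ u, A j (r, u))) := by
          have := hδ0 j
          rw [ENNReal.mul_rpow_of_nonneg _ _ hq.le, ENNReal.ofReal_rpow_of_pos (by positivity)]
          gcongr
          exact h1.trans (by gcongr)
      _ = _ := by
          have := hδ0 j
          have e : (2 : ℝ) ^ (j * κ) * (2 * (δ j) ^ (-(1 / 2) : ℝ)) ^ q * (2 * δ j)⁻¹ =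
              2 ^ (q - 1) * (2 ^ (j * κ) * (δ j) ^ (-(q / 2) - 1)) := by
            rw [Real.mul_rpow zero_le_two (by positivity), ← Real.rpow_mul this.le,
              Real.rpow_sub two_pos, Real.rpow_one, Real.rpow_sub this, Real.rpow_one,
              (by ring : -(1 / 2) * q = -(q / 2))]
            field_simp
          rw [hc, ← mul_assoc (ENNReal.ofReal (2 ^ (q - 1))), ← ENNReal.ofReal_mul (by positivity),
            ← e, ENNReal.ofReal_mul (by positivity), ENNReal.ofReal_mul (by positivity)]
          ring
  refine ⟨fun r => C * ∑' j : ℕ, ENNReal.ofReal (2 ^ (q - 1)) * (c j * ∫⁻ u, A j (r, u)), ?_, ?_, ?_⟩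
  · exact (Measurable.tsum fun j => ((hAm' j).const_mul _).const_mul _).const_mul _
  · intro r t ht
    calc halfPot G σ (e₁ * r + e₂ * t) ^ q
        ≤ (∑' j : ℕ, ENNReal.ofReal (2 * (δ j) ^ (-(1 / 2) : ℝ)) *
          winInt G (δ j) (e₁ * r + e₂ * t)) ^ q := by
          gcongr; simpa only [← hδ] using halfPot_le_tsum hG hσ (e₁ * r + e₂ * t)
      _ ≤ _ := hsum _
      _ ≤ _ := mul_le_mul' le_rfl (ENNReal.tsum_le_tsum (hterm r t ht))
  · simp_rw [ENNReal.tsum_mul_left, ← mul_assoc]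
    rw [lintegral_const_mul _ (Measurable.tsum fun j => (hAm' j).const_mul _)]
    gcongr
    rw [lintegral_tsum fun j => ((hAm' j).const_mul _).aemeasurable]
    gcongr with j
    rw [lintegral_const_mul _ (hAm' j)]
    show c j * _ ≤ c j * _ * _
    rw [mul_assoc (c j)]
    gcongr
    -- With the order of integration exchanged, the inner integral is a factor independent of `r`
    -- times the measure of those `r ∈ J` whose neighbourhood contains `u`, and `W j` bounds that
    -- measure.
    rw [lintegral_lintegral_swap (f := fun r u => A j (r, u)) (hAm j).aemeasurable, ← lintegral_const_mul _
      ((measurable_winInt hG _).pow_const q)]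
    refine lintegral_mono fun u => ?_
    have hset : MeasurableSet {r | ∃ t ∈ E, |u - (e₁ * r + e₂ * t)| < δ j} :=
      (measurable_prodMk_right (y := u)) (measurableSet_near E e₁ e₂ (δ j))
    calc ∫⁻ r in J, A j (r, u)
        = ∫⁻ r in J, {r | ∃ t ∈ E, |u - (e₁ * r + e₂ * t)| < δ j}.indicator
            (fun _ => winInt G (2 * δ j) u ^ q) r := rfl
      _ = winInt G (2 * δ j) u ^ q * volume (J ∩ {r | ∃ t ∈ E, |u - (e₁ * r + e₂ * t)| < δ j}) := by
          rw [lintegral_indicator hset, setLIntegral_const, Measure.restrict_apply hset, inter_comm]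
      _ ≤ _ := by rw [mul_comm]; gcongr; exact hW j u

/-- The bound for the majorant in `exists_majorant` under a power law for the measure of
neighbourhoods. -/
theorem exists_majorant_of_power {p q b : ℝ} (hp : 1 ≤ p) (hpq : p ≤ q)
    (hb : 0 < q / 2 - q / p + b) :
    ∃ C : ℝ≥0∞, C ≠ ⊤ ∧ ∀ (E : Set ℝ) (e₁ e₂ σ : ℝ), 0 < σ → ∀ J : Set ℝ, MeasurableSet J →
      ∀ (K : ℝ≥0∞) (G : ℝ → ℝ≥0∞), Measurable G →
      (∀ δ u : ℝ, 0 < δ → δ ≤ σ → volume (J ∩ {r | ∃ t ∈ E, |u - (e₁ * r + e₂ * t)| < δ}) ≤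
        K * ENNReal.ofReal (δ ^ b)) →
      ∃ B : ℝ → ℝ≥0∞, Measurable B ∧
        (∀ r, ∀ t ∈ E, halfPot G σ (e₁ * r + e₂ * t) ^ q ≤ B r) ∧
        ∫⁻ r in J, B r ≤ C * K * ENNReal.ofReal (σ ^ (q / 2 - q / p + b)) *
          (∫⁻ s, G s ^ p) ^ (q / p) := by
  set e := q / 2 - q / p + b with he
  -- The scale `j` decays like `2 ^ (-(j * e))`; half of this pays for the weight `2 ^ (j * κ)`, the
  -- other half makes the sum converge.
  obtain ⟨C, hC, H⟩ := exists_majorant (q := q) (κ := e / 2) (by linarith) (by linarith)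
  refine ⟨C * (ENNReal.ofReal (4 ^ (q - q / p + 1)) *
    ∑' j : ℕ, ENNReal.ofReal ((2 : ℝ) ^ (-(j * (e / 2))))),
    ENNReal.mul_ne_top hC (ENNReal.mul_ne_top ENNReal.ofReal_ne_top
      (tsum_two_rpow_ne_top (by linarith))), ?_⟩
  intro E e₁ e₂ σ hσ J hJ K G hG hW
  obtain ⟨B, hB, hB1, hB2⟩ := H E e₁ e₂ σ hσ J hJ
    (fun j => K * ENNReal.ofReal ((σ * 2 ^ (-j : ℝ)) ^ b)) G hG fun j u => by
      refine hW _ u (by positivity) ?_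
      have : (2 : ℝ) ^ (-j : ℝ) ≤ 1 := Real.rpow_le_one_of_one_le_of_nonpos one_le_two (by simp)
      nlinarith
  refine ⟨B, hB, hB1, hB2.trans ?_⟩
  set S := (∫⁻ s, G s ^ p) ^ (q / p)
  rw [mul_assoc, mul_assoc, mul_assoc, mul_assoc]
  gcongr C * ?_
  rw [← ENNReal.tsum_mul_right, ← ENNReal.tsum_mul_left]
  refine ENNReal.tsum_le_tsum fun j => ?_
  have hδ : 0 < σ * 2 ^ (-j : ℝ) := by positivity
  set δ := σ * 2 ^ (-j : ℝ) with hδdef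
  calc ENNReal.ofReal (2 ^ (j * (e / 2)) * δ ^ (-(q / 2) - 1)) * (K * ENNReal.ofReal (δ ^ b)) *
        ∫⁻ u, winInt G (2 * δ) u ^ q
      ≤ ENNReal.ofReal (2 ^ (j * (e / 2)) * δ ^ (-(q / 2) - 1)) * (K * ENNReal.ofReal (δ ^ b)) *
        (ENNReal.ofReal ((2 * (2 * δ)) ^ (q - q / p + 1)) * S) := by
        gcongr
        exact lintegral_winInt_rpow_le hp hpq (by positivity) hG
    _ = ENNReal.ofReal (2 ^ (j * (e / 2)) * δ ^ (-(q / 2) - 1) * δ ^ b *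
          (2 * (2 * δ)) ^ (q - q / p + 1)) * (K * S) := by
        rw [ENNReal.ofReal_mul (p := 2 ^ (j * (e / 2)) * δ ^ (-(q / 2) - 1) * δ ^ b) (by positivity),
          ENNReal.ofReal_mul (p := 2 ^ (j * (e / 2)) * δ ^ (-(q / 2) - 1)) (by positivity)]
        ring
    _ = ENNReal.ofReal (4 ^ (q - q / p + 1) * (2 ^ (-(j * (e / 2))) * σ ^ e)) * (K * S) := by
        congr 2
        have h1 : δ ^ (-(q / 2) - 1) * δ ^ b * δ ^ (q - q / p + 1) = δ ^ e := by
          rw [← Real.rpow_add hδ, ← Real.rpow_add hδ]; congr 1; rw [he]; ring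
        have h2 : δ ^ e = σ ^ e * 2 ^ (-(j * e)) := by
          rw [hδdef, Real.mul_rpow hσ.le (by positivity), ← Real.rpow_mul zero_le_two]
          congr 2; ring
        have h3 : (2 : ℝ) ^ (j * (e / 2)) * 2 ^ (-(j * e)) = 2 ^ (-(j * (e / 2))) := by
          rw [← Real.rpow_add two_pos]; congr 1; ring
        rw [← mul_assoc 2 2 δ, Real.mul_rpow (by norm_num) hδ.le, ← h3]
        calc _ = 4 ^ (q - q / p + 1) * (2 ^ (j * (e / 2)) *
              (δ ^ (-(q / 2) - 1) * δ ^ b * δ ^ (q - q / p + 1))) := by norm_num; ring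
          _ = _ := by rw [h1, h2]; ring
    _ = _ := by
        rw [ENNReal.ofReal_mul (by positivity), ENNReal.ofReal_mul (by positivity)]
        ring

/-! ## A square function bound at the critical exponent -/

/-- The contributing indices form a tail, and this geometric tail is twice its first term. -/
theorem tsum_two_rpow_neg_le {y : ℝ} (hy : 0 < y) :
    ∑' n : ℕ, (if y ≤ 2 ^ (n : ℝ) then ENNReal.ofReal (2 ^ (-n : ℝ)) else 0) ≤
      ENNReal.ofReal (2 / y) := by
  have hex : ∃ n : ℕ, y ≤ 2 ^ (n : ℝ) := by
    obtain ⟨n, hn⟩ := pow_unbounded_of_one_lt y one_lt_two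
    exact ⟨n, by rw [Real.rpow_natCast]; exact hn.le⟩
  classical
  set n₀ := Nat.find hex
  have h1 : y ≤ 2 ^ (n₀ : ℝ) := Nat.find_spec hex
  rw [← ENNReal.summable.sum_add_tsum_nat_add' (k := n₀), Finset.sum_eq_zero, zero_add]
  · calc ∑' k : ℕ, (if y ≤ 2 ^ ((k + n₀ : ℕ) : ℝ) then
          ENNReal.ofReal (2 ^ (-((k + n₀ : ℕ) : ℝ))) else 0)
        ≤ ∑' k : ℕ, ENNReal.ofReal (2 ^ (-n₀ : ℝ) * (1 / 2) ^ k) := by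
          refine ENNReal.tsum_le_tsum fun k => ?_
          split_ifs
          · apply le_of_eq
            congr 1
            push_cast
            rw [neg_add, Real.rpow_add two_pos, Real.rpow_neg zero_le_two, Real.rpow_natCast]
            simp [mul_comm]
          · exact zero_le
      _ = ENNReal.ofReal (2 ^ (-n₀ : ℝ) * 2) := by
          rw [← ENNReal.ofReal_tsum_of_nonneg (fun k => by positivity)
            (summable_geometric_two.mul_left _), tsum_mul_left, tsum_geometric_two]
      _ ≤ _ := by
          apply ENNReal.ofReal_le_ofReal
          rw [Real.rpow_neg zero_le_two, le_div_iff₀ hy, mul_assoc, inv_mul_le_iff₀ (by positivity)]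
          nlinarith
  · intro n hn
    rw [if_neg (Nat.find_min hex (Finset.mem_range.1 hn))]

/-- The contributing indices form an initial segment. Read backwards from the last index, the terms
decay geometrically, so the sum is comparable to its last term. -/
theorem exists_tsum_two_rpow_le {a : ℝ} (ha : 0 < a) :
    ∃ C : ℝ≥0∞, C ≠ ⊤ ∧ ∀ y : ℝ, 0 < y →
      ∑' n : ℕ, (if (2 : ℝ) ^ (n : ℝ) < y then ENNReal.ofReal (2 ^ (n * a)) else 0) ≤
        C * ENNReal.ofReal (y ^ a) := by
  refine ⟨_, tsum_two_rpow_ne_top ha, fun y hy => ?_⟩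
  have hev : ∃ N : ℕ, ∀ n : ℕ, N ≤ n → ¬ (2 : ℝ) ^ (n : ℝ) < y := by
    obtain ⟨N, hN⟩ := pow_unbounded_of_one_lt y one_lt_two
    refine ⟨N, fun n hn => not_lt.2 (hN.le.trans ?_)⟩
    rw [Real.rpow_natCast]
    exact pow_le_pow_right₀ one_le_two hn
  classical
  set N := Nat.find hev
  have hN : ∀ n : ℕ, N ≤ n → ¬ (2 : ℝ) ^ (n : ℝ) < y := Nat.find_spec hev
  rw [tsum_eq_sum (s := Finset.range N) fun n hn => if_neg (hN n (by simpa using hn)),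
    ← Finset.sum_range_reflect, ← ENNReal.tsum_mul_right]
  refine le_trans ?_ (ENNReal.sum_le_tsum (Finset.range N))
  refine Finset.sum_le_sum fun k hk => ?_
  have hk : k < N := Finset.mem_range.1 hk
  have hlast : (2 : ℝ) ^ ((N - 1 : ℕ) : ℝ) < y := by
    have := Nat.find_min hev (m := N - 1) (by omega)
    push Not at this
    obtain ⟨n, hn, hny⟩ := this
    have : n < N := by
      by_contra h
      exact hN n (by omega) hny
    rwa [(by omega : N - 1 = n)]
  split_ifs
  · rw [← ENNReal.ofReal_mul (by positivity)]
    apply ENNReal.ofReal_le_ofReal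
    calc (2 : ℝ) ^ (((N - 1 - k : ℕ) : ℝ) * a)
        = 2 ^ (-(k * a)) * (2 ^ ((N - 1 : ℕ) : ℝ)) ^ a := by
          rw [← Real.rpow_mul zero_le_two, ← Real.rpow_add two_pos,
            Nat.cast_sub (by omega : k ≤ N - 1)]
          congr 1; ring
      _ ≤ _ := by gcongr
  · exact zero_le

/-- Scale invariant summation over all dyadic scales, at the critical exponent. -/
theorem exists_tsum_winInt_le {p : ℝ} (hp : 1 < p) :
    ∃ C : ℝ≥0∞, C ≠ ⊤ ∧ ∀ G : ℝ → ℝ≥0∞, Measurable G →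
      ∑' n : ℕ, ENNReal.ofReal (((2 : ℝ) ^ (-n : ℝ)) ^ (1 - 2 * p)) *
        ∫⁻ u, winInt G (2 * 2 ^ (-n : ℝ)) u ^ (2 * p) ≤ C * (∫⁻ s, G s ^ p) ^ (2 : ℝ) := by
  have hp0 : 0 < p := by linarith
  set a := 1 - 1 / p with ha
  have ha0 : 0 < a := by rw [ha, sub_pos, div_lt_one hp0]; exact hp
  obtain ⟨C, hC, hsum⟩ := exists_tsum_two_rpow_le ha0
  set k := 1 + a * (2 * p - 1) with hk
  set C₁ := ENNReal.ofReal (2 ^ (2 * p)) with hC₁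
  set C₂ := ENNReal.ofReal (4 ^ (2 * p)) with hC₂
  set C₃ := ENNReal.ofReal (4 ^ k) with hC₃
  refine ⟨C₁ * (C₂ * 2 + C₃ * C), by finiteness, fun G hG => ?_⟩
  set S := ∫⁻ s, G s ^ p with hS
  have hGp : Measurable fun s => G s ^ p := hG.pow_const p
  rcases eq_or_ne S 0 with hS0 | hS0
  · refine le_of_eq_of_le ?_ zero_le
    rw [ENNReal.tsum_eq_zero]
    intro n
    have := lintegral_winInt_rpow_le (p := p) (q := 2 * p) (δ := 2 * 2 ^ (-n : ℝ)) hp.le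
      (by linarith) (by positivity) hG
    rw [← hS, hS0, ENNReal.zero_rpow_of_pos (by positivity), mul_zero, nonpos_iff_eq_zero] at this
    rw [this, mul_zero]
  rcases eq_or_ne S ⊤ with hST | hST
  · have : C₁ * (C₂ * 2 + C₃ * C) ≠ 0 := by
      have h1 : C₁ ≠ 0 := by rw [hC₁]; simp; positivity
      have h2 : C₂ ≠ 0 := by rw [hC₂]; simp; positivity
      simp [h1, h2]
    rw [hST, ENNReal.top_rpow_of_pos two_pos, ENNReal.mul_top this]
    exact le_top
  obtain ⟨S', hS'0, hS'⟩ : ∃ S' : ℝ, 0 < S' ∧ S = ENNReal.ofReal S' :=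
    ⟨S.toReal, ENNReal.toReal_pos hS0 hST, (ENNReal.ofReal_toReal hST).symm⟩
  -- Real interpolation by hand: at the scale `2 ^ (-n)` the profile is cut at the height where `G ^
  -- p = S * 2 ^ n`, so that each half can be summed over `n` pointwise in `s`.
  set T : ℕ → Set ℝ := fun n => {s | G s ^ p ≤ S * ENNReal.ofReal (2 ^ (n : ℝ))} with hT
  have hTm : ∀ n, MeasurableSet (T n) := fun n => measurableSet_le hGp measurable_const
  have hL : ∀ n, Measurable ((T n).indicator G) := fun n => hG.indicator (hTm n)
  have hH : ∀ n, Measurable ((T n)ᶜ.indicator G) := fun n => hG.indicator (hTm n).compl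
  set δ : ℕ → ℝ := fun n => 2 ^ (-n : ℝ) with hδ
  have hδ0 : ∀ n, 0 < δ n := fun n => by rw [hδ]; positivity
  have hsplit : ∀ n u, winInt G (2 * δ n) u ^ (2 * p) ≤
      C₁ * (winInt ((T n).indicator G) (2 * δ n) u ^ (2 * p) +
        winInt ((T n)ᶜ.indicator G) (2 * δ n) u ^ (2 * p)) := by
    intro n u
    have : winInt G (2 * δ n) u = winInt ((T n).indicator G) (2 * δ n) u +
        winInt ((T n)ᶜ.indicator G) (2 * δ n) u := by
      rw [winInt, winInt, winInt, ← lintegral_add_left (hL n)]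
      congr 1; ext s
      rw [← Pi.add_apply, indicator_self_add_compl]
    rw [this]
    exact add_rpow_le' (by linarith) _ _
  -- Low part: the `L^(2p)` bound. Together with the weight it leaves the power `δ n`, whose sum
  -- over `2 ^ n ≥ G ^ p / S` is at most `2 * S / G ^ p`.
  have hlow : ∀ n, ∫⁻ u, winInt ((T n).indicator G) (2 * δ n) u ^ (2 * p) ≤
      ENNReal.ofReal ((4 * δ n) ^ (2 * p)) * ∫⁻ s, (T n).indicator (fun s => G s ^ (2 * p)) s := by
    intro n
    have := hδ0 n
    refine (lintegral_winInt_rpow_self_le (by linarith) (by positivity) (hL n)).trans ?_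
    rw [ENNReal.ofReal_rpow_of_pos (by positivity), ← mul_assoc, (by norm_num : (2 : ℝ) * 2 = 4)]
    gcongr with s
    by_cases hs : s ∈ T n
    · simp [hs]
    · simp [hs, hp0]
  -- High part: the power `2 * p - 1` is bounded pointwise by Hölder and one factor is kept in `L¹`.
  -- Together with the weight this leaves `(δ n) ^ (-a)`, summed over `2 ^ n < G ^ p / S`; here `p >
  -- 1` is essential, since it gives `a > 0`.
  have hhigh : ∀ n, ∫⁻ u, winInt ((T n)ᶜ.indicator G) (2 * δ n) u ^ (2 * p) ≤
      ENNReal.ofReal ((4 * δ n) ^ k) * S ^ ((2 * p - 1) / p) *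
        ∫⁻ s, (T n)ᶜ.indicator G s := by
    intro n
    have := hδ0 n
    calc ∫⁻ u, winInt ((T n)ᶜ.indicator G) (2 * δ n) u ^ (2 * p)
        ≤ ∫⁻ u, (ENNReal.ofReal (4 * δ n) ^ a * S ^ (1 / p)) ^ (2 * p - 1) *
            winInt ((T n)ᶜ.indicator G) (2 * δ n) u := by
          refine lintegral_mono fun u => ?_
          have h1 : winInt ((T n)ᶜ.indicator G) (2 * δ n) u ≤
              ENNReal.ofReal (4 * δ n) ^ a * S ^ (1 / p) := by
            refine (winInt_mono_fun (fun s => indicator_le_self _ _ s) _ u).trans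
              ((winInt_le hp.le hG u).trans ?_)
            rw [← mul_assoc, (by norm_num : (2 : ℝ) * 2 = 4)]
          have h2 : winInt ((T n)ᶜ.indicator G) (2 * δ n) u ^ (2 * p) =
              winInt ((T n)ᶜ.indicator G) (2 * δ n) u ^ (2 * p - 1) *
                winInt ((T n)ᶜ.indicator G) (2 * δ n) u := by
            nth_rw 3 [← ENNReal.rpow_one (winInt ((T n)ᶜ.indicator G) (2 * δ n) u)]
            rw [← ENNReal.rpow_add_of_nonneg _ _ (by linarith) zero_le_one]
            congr 1; ring
          simp only [h2]
          gcongr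
          linarith
      _ = (ENNReal.ofReal (4 * δ n) ^ a * S ^ (1 / p)) ^ (2 * p - 1) *
            (ENNReal.ofReal (4 * δ n) * ∫⁻ s, (T n)ᶜ.indicator G s) := by
          rw [lintegral_const_mul _ (measurable_winInt (hH n) _), lintegral_winInt (hH n),
            ← mul_assoc 2 2, (by norm_num : (2 : ℝ) * 2 = 4)]
      _ = _ := by
          rw [ENNReal.mul_rpow_of_nonneg _ _ (by linarith), ← ENNReal.rpow_mul, ← ENNReal.rpow_mul,
            ENNReal.ofReal_rpow_of_pos (by positivity), hk, Real.rpow_add (by positivity),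
            Real.rpow_one, ENNReal.ofReal_mul (p := 4 * δ n) (by positivity),
            (by ring : 1 / p * (2 * p - 1) = (2 * p - 1) / p)]
          ring
  have hpt_low : ∀ s, ∑' n : ℕ, ENNReal.ofReal (δ n) *
      (T n).indicator (fun s => G s ^ (2 * p)) s ≤ 2 * S * G s ^ p := by
    intro s
    rcases eq_or_ne (G s) 0 with h0 | h0
    · refine le_of_eq_of_le ?_ zero_le
      rw [ENNReal.tsum_eq_zero]
      intro n
      by_cases hs : s ∈ T n <;> simp [hs, h0, hp0]
    rcases eq_or_ne (G s) ⊤ with hT' | hT'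
    · refine le_of_eq_of_le ?_ zero_le
      rw [ENNReal.tsum_eq_zero]
      intro n
      have : s ∉ T n := by
        simp only [hT, mem_ofPred_eq, hT', ENNReal.top_rpow_of_pos hp0, not_le]
        exact (ENNReal.mul_ne_top hST ENNReal.ofReal_ne_top).lt_top
      simp [this]
    obtain ⟨x, hx0, hx⟩ : ∃ x : ℝ, 0 < x ∧ G s = ENNReal.ofReal x :=
      ⟨(G s).toReal, ENNReal.toReal_pos h0 hT', (ENNReal.ofReal_toReal hT').symm⟩
    have hterm : ∀ n : ℕ, ENNReal.ofReal (δ n) * (T n).indicator (fun s => G s ^ (2 * p)) s =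
        (if x ^ p / S' ≤ 2 ^ (n : ℝ) then ENNReal.ofReal (2 ^ (-n : ℝ)) else 0) *
          G s ^ (2 * p) := by
      intro n
      have hiff : s ∈ T n ↔ x ^ p / S' ≤ 2 ^ (n : ℝ) := by
        simp only [hT, mem_ofPred_eq, hx, hS']
        rw [ENNReal.ofReal_rpow_of_pos hx0, ← ENNReal.ofReal_mul hS'0.le,
          ENNReal.ofReal_le_ofReal_iff (by positivity), div_le_iff₀' hS'0]
      by_cases hs : s ∈ T n
      · rw [indicator_of_mem hs, if_pos (hiff.1 hs)]
      · rw [indicator_of_notMem hs, if_neg (fun h => hs (hiff.2 h))]; simp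
    simp_rw [hterm]
    rw [ENNReal.tsum_mul_right]
    refine (mul_le_mul_left (tsum_two_rpow_neg_le (y := x ^ p / S') (by positivity)) _).trans ?_
    rw [hx, hS', (by simp : (2 : ℝ≥0∞) = ENNReal.ofReal 2), ENNReal.ofReal_rpow_of_pos hx0,
      ENNReal.ofReal_rpow_of_pos hx0, ← ENNReal.ofReal_mul (by positivity),
      ← ENNReal.ofReal_mul (by positivity), ← ENNReal.ofReal_mul (by positivity)]
    apply le_of_eq
    congr 1
    rw [(by ring : 2 * p = p + p), Real.rpow_add hx0]
    field_simp
  have hpt_high : ∀ s, ∑' n : ℕ, ENNReal.ofReal ((δ n) ^ (-a)) * (T n)ᶜ.indicator G s ≤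
      C * ENNReal.ofReal (S' ^ (-a)) * G s ^ p := by
    intro s
    rcases eq_or_ne (G s) 0 with h0 | h0
    · refine le_of_eq_of_le ?_ zero_le
      rw [ENNReal.tsum_eq_zero]
      intro n
      by_cases hs : s ∈ T n <;> simp [hs, h0]
    rcases eq_or_ne (G s) ⊤ with hT' | hT'
    -- Because `0 * ⊤ = 0`, the case `C = 0` has to be excluded: the term `n = 0` in the bound for
    -- `y = 2` is positive.
    · rcases eq_or_ne C 0 with hC0 | hC0
      · have := hsum 2 two_pos
        rw [hC0, zero_mul, nonpos_iff_eq_zero, ENNReal.tsum_eq_zero] at this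
        simpa using this 0
      · rw [hT', ENNReal.top_rpow_of_pos hp0, ENNReal.mul_top (mul_ne_zero hC0 (by simp; positivity))]
        exact le_top
    obtain ⟨x, hx0, hx⟩ : ∃ x : ℝ, 0 < x ∧ G s = ENNReal.ofReal x :=
      ⟨(G s).toReal, ENNReal.toReal_pos h0 hT', (ENNReal.ofReal_toReal hT').symm⟩
    have hterm : ∀ n : ℕ, ENNReal.ofReal ((δ n) ^ (-a)) * (T n)ᶜ.indicator G s =
        (if (2 : ℝ) ^ (n : ℝ) < x ^ p / S' then ENNReal.ofReal (2 ^ (n * a)) else 0) * G s := by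
      intro n
      have hiff : s ∈ (T n)ᶜ ↔ (2 : ℝ) ^ (n : ℝ) < x ^ p / S' := by
        simp only [hT, mem_compl_iff, mem_ofPred_eq, hx, hS', not_le]
        rw [ENNReal.ofReal_rpow_of_pos hx0, ← ENNReal.ofReal_mul hS'0.le,
          ENNReal.ofReal_lt_ofReal_iff (by positivity), lt_div_iff₀' hS'0]
      by_cases hs : s ∈ (T n)ᶜ
      · rw [indicator_of_mem hs, if_pos (hiff.1 hs), hδ]
        congr 2
        rw [← Real.rpow_mul zero_le_two]
        congr 1; ring
      · rw [indicator_of_notMem hs, if_neg (fun h => hs (hiff.2 h))]; simp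
    simp_rw [hterm]
    rw [ENNReal.tsum_mul_right]
    refine (mul_le_mul_left (hsum (x ^ p / S') (by positivity)) _).trans ?_
    rw [hx, mul_assoc, mul_assoc, ENNReal.ofReal_rpow_of_pos hx0,
      ← ENNReal.ofReal_mul (by positivity), ← ENNReal.ofReal_mul (by positivity)]
    apply le_of_eq
    congr 2
    rw [Real.div_rpow (by positivity) hS'0.le, ← Real.rpow_mul hx0.le, Real.rpow_neg hS'0.le,
      (by rw [ha]; field_simp : p * a = p - 1), Real.rpow_sub hx0, Real.rpow_one]
    field_simp
  calc ∑' n : ℕ, ENNReal.ofReal ((δ n) ^ (1 - 2 * p)) * ∫⁻ u, winInt G (2 * δ n) u ^ (2 * p)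
      ≤ ∑' n : ℕ, C₁ * (C₂ * (ENNReal.ofReal (δ n) *
          (∫⁻ s, (T n).indicator (fun s => G s ^ (2 * p)) s)) +
          C₃ * S ^ ((2 * p - 1) / p) * (ENNReal.ofReal ((δ n) ^ (-a)) *
            ∫⁻ s, (T n)ᶜ.indicator G s)) := by
        refine ENNReal.tsum_le_tsum fun n => ?_
        have hd := hδ0 n
        have e1 : ENNReal.ofReal ((δ n) ^ (1 - 2 * p)) * ENNReal.ofReal ((4 * δ n) ^ (2 * p)) =
            C₂ * ENNReal.ofReal (δ n) := by
          rw [hC₂, ← ENNReal.ofReal_mul (by positivity), ← ENNReal.ofReal_mul (by positivity),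
            Real.mul_rpow (by norm_num) hd.le, Real.rpow_sub hd, Real.rpow_one]
          congr 1; field_simp
        have e2 : ENNReal.ofReal ((δ n) ^ (1 - 2 * p)) * ENNReal.ofReal ((4 * δ n) ^ k) =
            C₃ * ENNReal.ofReal ((δ n) ^ (-a)) := by
          rw [hC₃, ← ENNReal.ofReal_mul (by positivity), ← ENNReal.ofReal_mul (by positivity),
            Real.mul_rpow (by norm_num) hd.le, mul_left_comm, ← Real.rpow_add hd]
          congr 3
          rw [hk, ha]; field_simp; ring
        calc ENNReal.ofReal ((δ n) ^ (1 - 2 * p)) * ∫⁻ u, winInt G (2 * δ n) u ^ (2 * p)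
            ≤ ENNReal.ofReal ((δ n) ^ (1 - 2 * p)) * (C₁ *
              (ENNReal.ofReal ((4 * δ n) ^ (2 * p)) *
                (∫⁻ s, (T n).indicator (fun s => G s ^ (2 * p)) s) +
              ENNReal.ofReal ((4 * δ n) ^ k) * S ^ ((2 * p - 1) / p) *
                ∫⁻ s, (T n)ᶜ.indicator G s)) := by
              gcongr
              refine (lintegral_mono (hsplit n)).trans ?_
              rw [lintegral_const_mul _ (by
                exact ((measurable_winInt (hL n) _).pow_const _).add
                  ((measurable_winInt (hH n) _).pow_const _)),
                lintegral_add_left ((measurable_winInt (hL n) _).pow_const _)]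
              gcongr
              · exact hlow n
              · exact hhigh n
          _ = C₁ * ((ENNReal.ofReal ((δ n) ^ (1 - 2 * p)) * ENNReal.ofReal ((4 * δ n) ^ (2 * p))) *
                (∫⁻ s, (T n).indicator (fun s => G s ^ (2 * p)) s) +
              (ENNReal.ofReal ((δ n) ^ (1 - 2 * p)) * ENNReal.ofReal ((4 * δ n) ^ k)) *
                S ^ ((2 * p - 1) / p) * ∫⁻ s, (T n)ᶜ.indicator G s) := by ring
          _ ≤ _ := by rw [e1, e2]; apply le_of_eq; ring
    _ = C₁ * (C₂ * (∫⁻ s, ∑' n : ℕ, ENNReal.ofReal (δ n) *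
          (T n).indicator (fun s => G s ^ (2 * p)) s) +
          C₃ * S ^ ((2 * p - 1) / p) * ∫⁻ s, ∑' n : ℕ, ENNReal.ofReal ((δ n) ^ (-a)) *
            (T n)ᶜ.indicator G s) := by
        have m1 : ∀ n, Measurable fun s => (T n).indicator (fun s => G s ^ (2 * p)) s :=
          fun n => (hG.pow_const _).indicator (hTm n)
        rw [ENNReal.tsum_mul_left, ENNReal.tsum_add, ENNReal.tsum_mul_left, ENNReal.tsum_mul_left,
          lintegral_tsum fun n => ((m1 n).const_mul _).aemeasurable,
          lintegral_tsum fun n => ((hH n).const_mul _).aemeasurable]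
        congr 4
        · ext n; rw [lintegral_const_mul _ (m1 n)]
        · ext n; rw [lintegral_const_mul _ (hH n)]
    _ ≤ C₁ * (C₂ * (2 * S * S) +
          C₃ * S ^ ((2 * p - 1) / p) * (C * ENNReal.ofReal (S' ^ (-a)) * S)) := by
        gcongr
        · rw [hS, ← lintegral_const_mul _ hGp]; exact lintegral_mono hpt_low
        · rw [hS, ← lintegral_const_mul _ hGp]; exact lintegral_mono hpt_high
    _ = _ := by
        have e3 : S ^ ((2 * p - 1) / p) * ENNReal.ofReal (S' ^ (-a)) = S := by
          rw [hS', ENNReal.ofReal_rpow_of_pos hS'0, ← ENNReal.ofReal_mul (by positivity),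
            ← Real.rpow_add hS'0, (by rw [ha]; field_simp; ring : (2 * p - 1) / p + -a = 1),
            Real.rpow_one]
        have e4 : S ^ (2 : ℝ) = S * S := by
          rw [ENNReal.rpow_two, sq]
        rw [e4]
        calc _ = C₁ * (C₂ * (2 * S * S) +
          C₃ * (S ^ ((2 * p - 1) / p) * ENNReal.ofReal (S' ^ (-a))) * (C * S)) := by ring
          _ = _ := by rw [e3]; ring

/-! ## Small radii -/

theorem measurePreserving_const_sub_mul {e : ℝ} (he : e = 1 ∨ e = -1) (c : ℝ) :
    MeasurePreserving (fun r : ℝ => c - e * r) volume volume := by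
  rcases he with rfl | rfl
  · simpa using Measure.measurePreserving_sub_left volume c
  · simpa using measurePreserving_add_left volume c

/-- Since both signs are `±1`, the set of relevant `r` is the preimage of a neighbourhood of `E`
under an isometry of the line. -/
theorem setOf_near_eq {E : Set ℝ} {e₁ e₂ : ℝ} (h₂ : e₂ = 1 ∨ e₂ = -1) (u δ : ℝ) :
    {r | ∃ t ∈ E, |u - (e₁ * r + e₂ * t)| < δ} =
      (fun r : ℝ => e₂ * u - e₂ * e₁ * r) ⁻¹' Metric.thickening δ E := by
  ext r
  simp only [mem_ofPred_eq, mem_preimage, Metric.mem_thickening_iff, Real.dist_eq]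
  refine exists_congr fun t => and_congr_right fun _ => ?_
  rcases h₂ with rfl | rfl
  · rw [(by ring : u - (e₁ * r + 1 * t) = 1 * u - 1 * e₁ * r - t)]
  · rw [(by ring : u - (e₁ * r + -1 * t) = -(-1 * u - -1 * e₁ * r - t)), abs_neg]

theorem mul_eq_one_or {e₁ e₂ : ℝ} (h₁ : e₁ = 1 ∨ e₁ = -1) (h₂ : e₂ = 1 ∨ e₂ = -1) :
    e₂ * e₁ = 1 ∨ e₂ * e₁ = -1 := by
  rcases h₁ with rfl | rfl <;> rcases h₂ with rfl | rfl <;> norm_num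

theorem volume_near_le (J E : Set ℝ) {e₁ e₂ : ℝ} (h₁ : e₁ = 1 ∨ e₁ = -1)
    (h₂ : e₂ = 1 ∨ e₂ = -1) (u δ : ℝ) :
    volume (J ∩ {r | ∃ t ∈ E, |u - (e₁ * r + e₂ * t)| < δ}) ≤ volume (Metric.thickening δ E) := by
  refine (measure_mono inter_subset_right).trans ?_
  rw [setOf_near_eq h₂, (measurePreserving_const_sub_mul (mul_eq_one_or h₁ h₂)
    _).measure_preimage Metric.isOpen_thickening.measurableSet.nullMeasurableSet]

/-- If `r` is confined to an interval of length `ρ`, only a piece of length `ρ` of the neighbourhood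
of `E` is seen. This is how local covering numbers, and with them Assouad-type dimensions, enter. -/
theorem volume_inter_near_le {J E : Set ℝ} {e₁ e₂ ρ : ℝ} (hJ : J ⊆ Icc 0 ρ)
    (h₁ : e₁ = 1 ∨ e₁ = -1) (h₂ : e₂ = 1 ∨ e₂ = -1) (u δ : ℝ) {V : ℝ≥0∞}
    (hV : ∀ x, volume (Metric.thickening δ E ∩ Icc x (x + ρ)) ≤ V) :
    volume (J ∩ {r | ∃ t ∈ E, |u - (e₁ * r + e₂ * t)| < δ}) ≤ V := by
  have h := mul_eq_one_or h₁ h₂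
  rw [setOf_near_eq h₂]
  generalize e₂ * e₁ = e at h
  generalize e₂ * u = c
  obtain ⟨x, hx⟩ : ∃ x, ∀ r ∈ J, c - e * r ∈ Icc x (x + ρ) := by
    rcases h with rfl | rfl
    · exact ⟨c - ρ, fun r hr => by constructor <;> linarith [(hJ hr).1, (hJ hr).2]⟩
    · exact ⟨c, fun r hr => by constructor <;> linarith [(hJ hr).1, (hJ hr).2]⟩
  calc volume (J ∩ (fun r : ℝ => c - e * r) ⁻¹' Metric.thickening δ E)
      ≤ volume ((fun r : ℝ => c - e * r) ⁻¹' (Metric.thickening δ E ∩ Icc x (x + ρ))) :=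
        measure_mono fun r hr => ⟨hr.2, hx r hr.1⟩
    _ = _ := (measurePreserving_const_sub_mul h _).measure_preimage
        (Metric.isOpen_thickening.measurableSet.inter measurableSet_Icc).nullMeasurableSet
    _ ≤ V := hV x

theorem exists_tsum_majorant {E : Set ℝ} {F : ℕ → ℝ → ℝ → ℝ≥0∞} {J : ℕ → Set ℝ} {X : ℕ → ℝ≥0∞}
    (c : ℕ → ℝ≥0∞) (hJ : ∀ m, MeasurableSet (J m))
    (h : ∀ m, ∃ B : ℝ → ℝ≥0∞, Measurable B ∧ (∀ r, ∀ t ∈ E, F m r t ≤ B r) ∧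
      ∫⁻ r in J m, B r ≤ X m) :
    ∃ D : ℝ → ℝ≥0∞, Measurable D ∧
      (∀ r, ∀ t ∈ E, ∑' m, (J m).indicator (fun r => c m * F m r t) r ≤ D r) ∧
      ∫⁻ r, D r ≤ ∑' m, c m * X m := by
  choose B hB hB1 hB2 using h
  have hm : ∀ m, Measurable ((J m).indicator fun r => c m * B m r) :=
    fun m => ((hB m).const_mul _).indicator (hJ m)
  refine ⟨fun r => ∑' m, (J m).indicator (fun r => c m * B m r) r, Measurable.tsum hm, ?_, ?_⟩
  · intro r t ht
    refine ENNReal.tsum_le_tsum fun m => indicator_le_indicator ?_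
    gcongr
    exact hB1 m r t ht
  · rw [lintegral_tsum fun m => (hm m).aemeasurable]
    refine ENNReal.tsum_le_tsum fun m => ?_
    rw [lintegral_indicator (hJ m), lintegral_const_mul _ (hB m)]
    gcongr
    exact hB2 m

/-- The dyadic radii below `1 / 4`. -/
def smallRadius (m : ℕ) : ℝ := 2 ^ (-(m : ℝ) - 2)

theorem smallRadius_pos (m : ℕ) : 0 < smallRadius m := by unfold smallRadius; positivity

theorem smallRadius_le (m : ℕ) : smallRadius m ≤ 1 / 4 := by
  unfold smallRadius
  calc (2 : ℝ) ^ (-(m : ℝ) - 2) ≤ 2 ^ (-2 : ℝ) :=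
        Real.rpow_le_rpow_of_exponent_le one_le_two (by linarith [m.cast_nonneg (α := ℝ)])
    _ = 1 / 4 := by rw [Real.rpow_neg zero_le_two]; norm_num

/-- A power law for the measure of neighbourhoods of `E` within short intervals. -/
def NbhdBound (E : Set ℝ) (s b : ℝ) : Prop :=
  ∃ K : ℝ≥0∞, K ≠ ⊤ ∧ ∀ ρ δ x : ℝ, 0 < ρ → ρ ≤ 1 / 4 → 0 < δ → δ ≤ 2 * ρ →
    volume (Metric.thickening δ E ∩ Icc x (x + ρ)) ≤ K * ENNReal.ofReal (ρ ^ s * δ ^ b)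

/-- The contribution of the radii `r ≤ 1 / 4` to the maximal function is bounded. -/
def SmallRadiusBound (E : Set ℝ) (p q : ℝ) : Prop :=
  ∃ C : ℝ≥0∞, C ≠ ⊤ ∧ ∀ G : ℝ → ℝ≥0∞, Measurable G → ∀ e : ℝ, e = 1 ∨ e = -1 →
    ∃ D : ℝ → ℝ≥0∞, Measurable D ∧
      (∀ m : ℕ, ∀ r ∈ Ioc (smallRadius m / 2) (smallRadius m), ∀ t ∈ E,
        ENNReal.ofReal ((smallRadius m) ^ (1 - q / 2)) *
          halfPot G (2 * smallRadius m) (e * r + 1 * t) ^ q ≤ D r) ∧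
      ∫⁻ r, D r ≤ C * (∫⁻ s, G s ^ p) ^ (q / p)

/-- The net power of the radius is `(1 - q / 2) + s + (q / 2 - q / p + b)`: weight, volume and
fractional integral. It is positive by `h₂`, so the sum over dyadic radii is geometric. -/
theorem NbhdBound.smallRadiusBound {E : Set ℝ} {s b p q : ℝ} (h : NbhdBound E s b) (hp : 1 ≤ p)
    (hpq : p ≤ q) (h₁ : 0 < q / 2 - q / p + b) (h₂ : 0 < 1 - q / p + b + s) :
    SmallRadiusBound E p q := by
  obtain ⟨K, hK, hV⟩ := h
  obtain ⟨C, hC, H⟩ := exists_majorant_of_power hp hpq h₁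
  set e₀ := q / 2 - q / p + b with he₀
  set x := 1 - q / p + b + s with hx
  refine ⟨C * K * (ENNReal.ofReal (2 ^ e₀ * 2 ^ (-2 * x)) *
    ∑' m : ℕ, ENNReal.ofReal ((2 : ℝ) ^ (-(m * x)))), ?_, ?_⟩
  · exact ENNReal.mul_ne_top (ENNReal.mul_ne_top hC hK)
      (ENNReal.mul_ne_top ENNReal.ofReal_ne_top (tsum_two_rpow_ne_top h₂))
  intro G hG e he
  have hB := fun m : ℕ => H E e 1 (2 * smallRadius m) (by have := smallRadius_pos m; positivity)
    (Ioc (smallRadius m / 2) (smallRadius m)) measurableSet_Ioc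
    (K * ENNReal.ofReal (smallRadius m ^ s)) G hG (fun δ u hδ hδ' => by
      have h0 := smallRadius_pos m
      refine volume_inter_near_le (ρ := smallRadius m) (fun r hr => ⟨by linarith [hr.1], hr.2⟩)
        he (Or.inl rfl) u δ fun y => ?_
      refine (hV _ δ y h0 (smallRadius_le m) hδ hδ').trans_eq ?_
      rw [ENNReal.ofReal_mul (by positivity), mul_assoc])
  obtain ⟨D, hD, hD1, hD2⟩ := exists_tsum_majorant
    (fun m => ENNReal.ofReal ((smallRadius m) ^ (1 - q / 2))) (fun m => measurableSet_Ioc) hB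
  refine ⟨D, hD, fun m r hr t ht => ?_, hD2.trans ?_⟩
  · refine le_trans ?_ (hD1 r t ht)
    refine le_trans ?_ (ENNReal.le_tsum m)
    rw [indicator_of_mem hr]
  · rw [mul_assoc, mul_assoc, mul_assoc, ← ENNReal.tsum_mul_right, ← ENNReal.tsum_mul_left,
      ← ENNReal.tsum_mul_left, ← ENNReal.tsum_mul_left]
    refine ENNReal.tsum_le_tsum fun m => le_of_eq ?_
    have h0 := smallRadius_pos m
    have e1 : ENNReal.ofReal (smallRadius m ^ (1 - q / 2)) * (ENNReal.ofReal (smallRadius m ^ s) *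
        ENNReal.ofReal ((2 * smallRadius m) ^ e₀)) =
        ENNReal.ofReal (2 ^ e₀ * 2 ^ (-2 * x)) * ENNReal.ofReal ((2 : ℝ) ^ (-(m * x))) := by
      rw [← ENNReal.ofReal_mul (by positivity), ← ENNReal.ofReal_mul (by positivity),
        ← ENNReal.ofReal_mul (by positivity), Real.mul_rpow zero_le_two h0.le]
      congr 1
      calc _ = 2 ^ e₀ * (smallRadius m ^ (1 - q / 2) * smallRadius m ^ s * smallRadius m ^ e₀) := by
            ring
        _ = 2 ^ e₀ * smallRadius m ^ x := by
            rw [← Real.rpow_add h0, ← Real.rpow_add h0]; congr 2; rw [hx, he₀]; ring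
        _ = _ := by
            rw [smallRadius, ← Real.rpow_mul zero_le_two, mul_assoc (2 ^ e₀),
              ← Real.rpow_add two_pos (-2 * x)]
            congr 2; ring
    calc _ = C * K * (ENNReal.ofReal (smallRadius m ^ (1 - q / 2)) *
          (ENNReal.ofReal (smallRadius m ^ s) * ENNReal.ofReal ((2 * smallRadius m) ^ e₀))) *
          (∫⁻ s, G s ^ p) ^ (q / p) := by ring
      _ = _ := by rw [e1]; ring

/-- Here the net power of the radius is zero and the sum over radii is not geometric. The double sum
over radii and scales is instead arranged by their ratio `2 ^ j`: the hypothesis on `p` gives decay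
in `j`, and for fixed `j` the sum over scales is handled by `exists_tsum_winInt_le`. -/
theorem NbhdBound.smallRadiusBound_endpoint {E : Set ℝ} {a p : ℝ} (h : NbhdBound E a (1 - a))
    (ha : 0 ≤ a) (hp : 1 + a < p) : SmallRadiusBound E p (2 * p) := by
  obtain ⟨K, hK, hV⟩ := h
  -- The ratio `2 ^ j` of radius to scale appears with the power `1 - p + a = -2 * κ`; half of it is
  -- spent on the weights in `exists_majorant`.
  set κ := (p - 1 - a) / 2 with hκ
  obtain ⟨C, hC, H⟩ := exists_majorant (q := 2 * p) (κ := κ) (by linarith) (by linarith)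
  obtain ⟨C', hC', H'⟩ := exists_tsum_winInt_le (p := p) (by linarith)
  refine ⟨C * K * ENNReal.ofReal (2 ^ (2 * κ)) * C' *
    ∑' j : ℕ, ENNReal.ofReal ((2 : ℝ) ^ (-(j * κ))), ?_, ?_⟩
  · have := tsum_two_rpow_ne_top (a := κ) (by linarith)
    finiteness
  intro G hG e he
  have hB := fun m : ℕ => H E e 1 (2 * smallRadius m) (by have := smallRadius_pos m; positivity)
    (Ioc (smallRadius m / 2) (smallRadius m)) measurableSet_Ioc
    (fun j => K * ENNReal.ofReal (smallRadius m ^ a * (2 * smallRadius m * 2 ^ (-j : ℝ)) ^ (1 - a)))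
    G hG (fun j u => by
      have h0 := smallRadius_pos m
      refine volume_inter_near_le (ρ := smallRadius m) (fun r hr => ⟨by linarith [hr.1], hr.2⟩)
        he (Or.inl rfl) u _ fun y => ?_
      refine hV _ _ y h0 (smallRadius_le m) (by positivity) ?_
      have : (2 : ℝ) ^ (-j : ℝ) ≤ 1 := Real.rpow_le_one_of_one_le_of_nonpos one_le_two (by simp)
      nlinarith)
  obtain ⟨D, hD, hD1, hD2⟩ := exists_tsum_majorant
    (fun m => ENNReal.ofReal ((smallRadius m) ^ (1 - 2 * p / 2))) (fun m => measurableSet_Ioc) hB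
  refine ⟨D, hD, fun m r hr t ht => ?_, hD2.trans ?_⟩
  · refine le_trans ?_ (hD1 r t ht)
    refine le_trans ?_ (ENNReal.le_tsum m)
    rw [indicator_of_mem hr]
  set S := (∫⁻ s, G s ^ p) ^ (2 * p / p) with hS
  have hS2 : S = (∫⁻ s, G s ^ p) ^ (2 : ℝ) := by rw [hS, mul_div_assoc, div_self (by linarith), mul_one]
  set f : ℕ → ℝ≥0∞ := fun n => ENNReal.ofReal (((2 : ℝ) ^ (-n : ℝ)) ^ (1 - 2 * p)) *
    ∫⁻ u, winInt G (2 * 2 ^ (-n : ℝ)) u ^ (2 * p) with hf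
  calc ∑' m : ℕ, ENNReal.ofReal ((smallRadius m) ^ (1 - 2 * p / 2)) * (C *
        ∑' j : ℕ, ENNReal.ofReal (2 ^ (j * κ) *
          (2 * smallRadius m * 2 ^ (-j : ℝ)) ^ (-(2 * p / 2) - 1)) *
          (K * ENNReal.ofReal (smallRadius m ^ a * (2 * smallRadius m * 2 ^ (-j : ℝ)) ^ (1 - a))) *
          ∫⁻ u, winInt G (2 * (2 * smallRadius m * 2 ^ (-j : ℝ))) u ^ (2 * p))
      = ∑' m : ℕ, ∑' j : ℕ, C * K * ENNReal.ofReal (2 ^ (2 * κ)) *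
          ENNReal.ofReal (2 ^ (-(j * κ))) * f (m + (j + 1)) := by
        congr 1; ext m
        rw [← ENNReal.tsum_mul_left, ← ENNReal.tsum_mul_left]
        congr 1; ext j
        have h0 := smallRadius_pos m
        -- The scale depends only on the sum of the indices; the shift by one comes from `2 *
        -- smallRadius m = 2 ^ (-m - 1)`.
        have hδ : 2 * smallRadius m * 2 ^ (-j : ℝ) = 2 ^ (-((m + (j + 1) : ℕ) : ℝ)) := by
          rw [smallRadius]
          nth_rw 1 [← Real.rpow_one 2]
          rw [← Real.rpow_add two_pos, ← Real.rpow_add two_pos]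
          congr 1; push_cast; ring
        have hρ : smallRadius m = 2 ^ ((j : ℝ) - 1) * 2 ^ (-((m + (j + 1) : ℕ) : ℝ)) := by
          rw [smallRadius, ← Real.rpow_add two_pos]
          congr 1; push_cast; ring
        have hreal : smallRadius m ^ (1 - 2 * p / 2) * (2 ^ (j * κ) *
            (2 * smallRadius m * 2 ^ (-j : ℝ)) ^ (-(2 * p / 2) - 1)) *
            (smallRadius m ^ a * (2 * smallRadius m * 2 ^ (-j : ℝ)) ^ (1 - a)) =
            2 ^ (2 * κ) * 2 ^ (-(j * κ)) *
              ((2 : ℝ) ^ (-((m + (j + 1) : ℕ) : ℝ))) ^ (1 - 2 * p) := by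
          rw [hδ, hρ]
          set d : ℝ := 2 ^ (-((m + (j + 1) : ℕ) : ℝ)) with hd
          have hd0 : 0 < d := by positivity
          clear_value d
          rw [Real.mul_rpow (by positivity) hd0.le, Real.mul_rpow (by positivity) hd0.le,
            ← Real.rpow_mul zero_le_two, ← Real.rpow_mul zero_le_two]
          calc _ = (2 ^ (((j : ℝ) - 1) * (1 - 2 * p / 2)) * 2 ^ (((j : ℝ) - 1) * a) *
                2 ^ (j * κ)) * (d ^ (1 - 2 * p / 2) * d ^ (-(2 * p / 2) - 1) * d ^ a *
                  d ^ (1 - a)) := by ring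
            _ = _ := by
                rw [← Real.rpow_add hd0, ← Real.rpow_add hd0, ← Real.rpow_add hd0,
                  ← Real.rpow_add two_pos, ← Real.rpow_add two_pos, ← Real.rpow_add two_pos]
                congr 2
                · rw [hκ]; ring
                · ring
        rw [hf]
        simp only
        rw [← hδ]
        calc _ = C * K * (ENNReal.ofReal (smallRadius m ^ (1 - 2 * p / 2)) *
              ENNReal.ofReal (2 ^ (j * κ) *
                (2 * smallRadius m * 2 ^ (-j : ℝ)) ^ (-(2 * p / 2) - 1)) *
              ENNReal.ofReal (smallRadius m ^ a *
                (2 * smallRadius m * 2 ^ (-j : ℝ)) ^ (1 - a))) *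
              ∫⁻ u, winInt G (2 * (2 * smallRadius m * 2 ^ (-j : ℝ))) u ^ (2 * p) := by ring
          _ = _ := by
              rw [← ENNReal.ofReal_mul (by positivity), ← ENNReal.ofReal_mul (by positivity),
                hreal, ENNReal.ofReal_mul (by positivity), ENNReal.ofReal_mul (by positivity), hδ]
              ring
    _ = ∑' j : ℕ, C * K * ENNReal.ofReal (2 ^ (2 * κ)) *
          ENNReal.ofReal (2 ^ (-(j * κ))) * ∑' m : ℕ, f (m + (j + 1)) := by
        rw [ENNReal.tsum_comm]
        simp_rw [ENNReal.tsum_mul_left]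
    _ ≤ ∑' j : ℕ, C * K * ENNReal.ofReal (2 ^ (2 * κ)) *
          ENNReal.ofReal (2 ^ (-(j * κ))) * (C' * S) := by
        gcongr with j
        refine le_trans ?_ ((H' G hG).trans_eq (by rw [hS2]))
        exact ENNReal.tsum_comp_le_tsum_of_injective (add_left_injective (j + 1)) f
    _ = _ := by
        rw [ENNReal.tsum_mul_right, ENNReal.tsum_mul_left]
        ring

/-! ## Circular means of radial functions -/

/-- Up to a constant, the density of `‖x - t • y‖`, for `‖x‖ = r` and `y` uniformly distributed
on the unit circle. -/
def radKernel (r t s : ℝ) : ℝ := s / √(((r + t) ^ 2 - s ^ 2) * (s ^ 2 - (r - t) ^ 2))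

/-- Up to a constant, the circular mean at radius `r` of the radial function with profile `g`. -/
def radMean (t : ℝ) (g : ℝ → ℝ≥0∞) (r : ℝ) : ℝ≥0∞ :=
  ∫⁻ s in Ioo |r - t| (r + t), g s * ENNReal.ofReal (radKernel r t s)

/-- With `v` the singular factor of the product `P`, squaring reduces each kernel bound to a
polynomial inequality. -/
theorem div_sqrt_le {s v P A : ℝ} (hs : 0 < s) (hv : 0 < v) (hA : 0 < A)
    (h : s ^ 2 * v ≤ A ^ 2 * P) : s / √P ≤ A * v ^ (-(1 / 2) : ℝ) := by
  have hP : 0 < P := by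
    by_contra hP
    have : 0 < s ^ 2 * v := by positivity
    nlinarith [sq_nonneg A]
  have h1 : s * √v ≤ A * √P := by
    have := Real.sqrt_le_sqrt h
    rwa [Real.sqrt_mul (sq_nonneg s), Real.sqrt_mul (sq_nonneg A), Real.sqrt_sq hs.le,
      Real.sqrt_sq hA.le] at this
  have hsv : 0 < √v := Real.sqrt_pos.2 hv
  rw [Real.rpow_neg hv.le, ← Real.sqrt_eq_rpow, div_le_iff₀ (Real.sqrt_pos.2 hP),
    ← div_eq_mul_inv, div_mul_eq_mul_div, le_div_iff₀ hsv]
  exact h1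

theorem rpow_neg_half_sq {a : ℝ} (ha : 0 < a) : (a ^ (-(1 / 2) : ℝ)) ^ 2 = a⁻¹ := by
  rw [← Real.rpow_natCast, ← Real.rpow_mul ha.le, ← Real.rpow_neg_one]
  norm_num

/-- Above `max r t` the only singularity is at `r + t`: of the factors `s - (r - t)` and `s + (r -
t)` one is at least `s` and the other at least `a`. -/
theorem radKernel_le_of_ge {r t s a : ℝ} (hr : 0 < r) (ht : 0 < t) (ha : 0 < a) (har : a ≤ r)
    (hat : a ≤ t) (hs1 : |r - t| < s) (hs2 : s < r + t) (h : max r t ≤ s) :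
    radKernel r t s ≤ a ^ (-(1 / 2) : ℝ) * |s - (r + t)| ^ (-(1 / 2) : ℝ) := by
  have hs0 : 0 < s := (abs_nonneg _).trans_lt hs1
  rw [abs_lt] at hs1
  have h1 := (max_le_iff.1 h).1
  have h2 := (max_le_iff.1 h).2
  rw [abs_of_neg (by linarith), radKernel]
  refine div_sqrt_le hs0 (by linarith) (by positivity) ?_
  rw [rpow_neg_half_sq ha, ← div_eq_inv_mul, le_div_iff₀ ha]
  have e : ((r + t) ^ 2 - s ^ 2) * (s ^ 2 - (r - t) ^ 2) =
      (r + t - s) * (((r + t + s)) * ((s - (r - t)) * (s + (r - t)))) := by ring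
  rw [e]
  have k1 : 0 < r + t - s := by linarith
  have k2 : a * s ≤ (s - (r - t)) * (s + (r - t)) := by
    rcases le_total r t with hrt | hrt
    · nlinarith
    · nlinarith
  have k3 : a * s ^ 2 ≤ (r + t + s) * ((s - (r - t)) * (s + (r - t))) := by
    have : 0 ≤ a * s := by positivity
    nlinarith
  nlinarith

/-- Below `max r t` the only singularity is at `|r - t|`, because `r + t - s ≥ min r t ≥ a`. -/
theorem radKernel_le_of_le {r t s a : ℝ} (hr : 0 < r) (ht : 0 < t) (ha : 0 < a) (har : a ≤ r)
    (hat : a ≤ t) (hs1 : |r - t| < s) (h : s ≤ max r t) :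
    radKernel r t s ≤ a ^ (-(1 / 2) : ℝ) * |(s - |r - t|)| ^ (-(1 / 2) : ℝ) := by
  have hd := abs_nonneg (r - t)
  have hs0 : 0 < s := hd.trans_lt hs1
  rw [abs_of_pos (by linarith : 0 < s - |r - t|), radKernel, ← sq_abs (r - t)]
  have k : a ≤ r + t - s := by
    rcases le_max_iff.1 h with h | h <;> linarith
  generalize |r - t| = d at *
  refine div_sqrt_le hs0 (by linarith) (by positivity) ?_
  rw [rpow_neg_half_sq ha, ← div_eq_inv_mul, le_div_iff₀ ha]
  have e : ((r + t) ^ 2 - s ^ 2) * (s ^ 2 - d ^ 2) =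
      (s - d) * ((r + t - s) * ((r + t + s) * (s + d))) := by ring
  rw [e]
  have k1 : 0 < s - d := by linarith
  have k2 : s ^ 2 ≤ (r + t + s) * (s + d) := by nlinarith
  have k3 : a * s ^ 2 ≤ (r + t - s) * ((r + t + s) * (s + d)) :=
    mul_le_mul k k2 (by positivity) (by linarith)
  nlinarith

/-- Near the origin only one factor `s` of the numerator `s ^ 2` is needed to cancel `s + |r - t|`;
the other gives the gain `σ ^ (1 / 2)`. -/
theorem radKernel_le_of_le_one {r t s σ : ℝ} (hr : 1 / 4 ≤ r) (ht : 1 ≤ t)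
    (hs1 : |r - t| < s) (h : s ≤ max r t) (hsσ : s ≤ σ) :
    radKernel r t s ≤ 2 * σ ^ (1 / 2 : ℝ) * |(s - |r - t|)| ^ (-(1 / 2) : ℝ) := by
  have hd := abs_nonneg (r - t)
  have hs0 : 0 < s := hd.trans_lt hs1
  have hσ : 0 < σ := hs0.trans_le hsσ
  rw [abs_of_pos (by linarith : 0 < s - |r - t|), radKernel, ← sq_abs (r - t)]
  have k : 1 / 4 ≤ r + t - s := by
    rcases le_max_iff.1 h with h | h <;> linarith
  generalize |r - t| = d at *
  refine div_sqrt_le hs0 (by linarith) (by positivity) ?_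
  rw [mul_pow, ← Real.sqrt_eq_rpow, Real.sq_sqrt hσ.le]
  have e : ((r + t) ^ 2 - s ^ 2) * (s ^ 2 - d ^ 2) =
      (s - d) * ((r + t - s) * ((r + t + s) * (s + d))) := by ring
  rw [e]
  have k1 : 0 < s - d := by linarith
  have k3 : 1 / 4 * (1 * s) ≤ (r + t - s) * ((r + t + s) * (s + d)) := by
    gcongr <;> linarith
  have k4 : s * s ≤ σ * (4 * ((r + t - s) * ((r + t + s) * (s + d)))) := by
    gcongr; linarith
  nlinarith

/-! ### Splitting the profile and dominating the means by half-order integrals -/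

/-- The weighted profile away from the origin. -/
def farPart (p : ℝ) (g : ℝ → ℝ≥0∞) : ℝ → ℝ≥0∞ :=
  (Ici (1 / 2 : ℝ)).indicator fun s => ENNReal.ofReal (s ^ (1 / p)) * g s

/-- The dyadic scales up to `1`. -/
def dyad (m : ℕ) : ℝ := 2 ^ (-(m : ℝ))

theorem dyad_pos (m : ℕ) : 0 < dyad m := by unfold dyad; positivity

theorem dyad_le_one (m : ℕ) : dyad m ≤ 1 :=
  Real.rpow_le_one_of_one_le_of_nonpos one_le_two (by simp)

/-- The profile at the dyadic distance `dyad m` from the origin. -/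
def dyadPart (g : ℝ → ℝ≥0∞) (m : ℕ) : ℝ → ℝ≥0∞ := (Ioc (dyad m / 2) (dyad m)).indicator g

theorem exists_mem_dyad {s : ℝ} (h0 : 0 < s) (h1 : s ≤ 1) :
    ∃ m, s ∈ Ioc (dyad m / 2) (dyad m) := by
  obtain ⟨n, hn1, hn2⟩ := exists_nat_pow_near_of_lt_one (y := (1 / 2 : ℝ)) h0 h1
    (by norm_num) (by norm_num)
  have e : dyad n = (1 / 2) ^ n := by
    rw [dyad, Real.rpow_neg zero_le_two, Real.rpow_natCast, one_div, inv_pow]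
  refine ⟨n, ?_, by rw [e]; exact hn2⟩
  rw [e]; rw [pow_succ] at hn1; linarith

theorem measurable_farPart {p : ℝ} {g : ℝ → ℝ≥0∞} (hg : Measurable g) :
    Measurable (farPart p g) :=
  Measurable.indicator (by fun_prop) measurableSet_Ici

theorem measurable_dyadPart {g : ℝ → ℝ≥0∞} (hg : Measurable g) (m : ℕ) :
    Measurable (dyadPart g m) := hg.indicator measurableSet_Ioc

theorem lintegral_farPart_le {p : ℝ} (hp : 0 < p) (g : ℝ → ℝ≥0∞) :
    ∫⁻ s, farPart p g s ^ p ≤ ∫⁻ s in Ioi 0, ENNReal.ofReal s * g s ^ p := by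
  rw [← lintegral_indicator measurableSet_Ioi]
  refine lintegral_mono fun s => ?_
  by_cases hs : s ∈ Ici (1 / 2 : ℝ)
  · have hs0 : (0 : ℝ) < s := by linarith [mem_Ici.1 hs]
    rw [farPart, indicator_of_mem hs, indicator_of_mem (mem_Ioi.2 hs0),
      ENNReal.mul_rpow_of_nonneg _ _ hp.le, ENNReal.ofReal_rpow_of_pos (by positivity),
      ← Real.rpow_mul hs0.le, one_div_mul_cancel hp.ne', Real.rpow_one]
  · rw [farPart, indicator_of_notMem hs, ENNReal.zero_rpow_of_pos hp]
    exact zero_le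

/-- Removing the weight `s` of polar coordinates costs the inverse of the distance from the origin.
-/
theorem lintegral_dyadPart_le {p : ℝ} (hp : 0 < p) {g : ℝ → ℝ≥0∞} (hg : Measurable g) (m : ℕ) :
    ∫⁻ s, dyadPart g m s ^ p ≤
      ENNReal.ofReal (2 / dyad m) * ∫⁻ s in Ioi 0, ENNReal.ofReal s * g s ^ p := by
  have h0 := dyad_pos m
  rw [← lintegral_const_mul _ (by fun_prop), ← lintegral_indicator measurableSet_Ioi]
  refine lintegral_mono fun s => ?_
  by_cases hs : s ∈ Ioc (dyad m / 2) (dyad m)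
  · have hs0 : 0 < s := by linarith [hs.1]
    rw [dyadPart, indicator_of_mem hs, indicator_of_mem (mem_Ioi.2 hs0), ← mul_assoc,
      ← ENNReal.ofReal_mul (by positivity)]
    calc g s ^ p = ENNReal.ofReal 1 * g s ^ p := by simp
      _ ≤ _ := by
        gcongr
        rw [div_mul_eq_mul_div, one_le_div h0]; linarith [hs.1]
  · rw [dyadPart, indicator_of_notMem hs, ENNReal.zero_rpow_of_pos hp]
    exact zero_le

/-- The integrand of `halfPot`. -/
def potFun (G : ℝ → ℝ≥0∞) (σ x s : ℝ) : ℝ≥0∞ :=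
  (Ioo (x - σ) (x + σ)).indicator (fun s => G s * ENNReal.ofReal (|s - x| ^ (-(1 / 2) : ℝ))) s

theorem lintegral_potFun (G : ℝ → ℝ≥0∞) (σ x : ℝ) : ∫⁻ s, potFun G σ x s = halfPot G σ x :=
  lintegral_indicator measurableSet_Ioo _

theorem measurable_potFun {G : ℝ → ℝ≥0∞} (hG : Measurable G) (σ x : ℝ) :
    Measurable (potFun G σ x) :=
  Measurable.indicator (by fun_prop) measurableSet_Ioo

theorem potFun_of_lt {G : ℝ → ℝ≥0∞} {σ x s : ℝ} (h : |s - x| < σ) :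
    potFun G σ x s = G s * ENNReal.ofReal (|s - x| ^ (-(1 / 2) : ℝ)) := by
  rw [abs_lt] at h
  exact indicator_of_mem (by constructor <;> linarith [h.1, h.2]) _

/-- The majorants are built for linear expressions `e₁ * r + e₂ * t`, so the absolute value is
resolved into both signs. -/
theorem halfPot_abs_le (G : ℝ → ℝ≥0∞) (σ r t : ℝ) :
    halfPot G σ |r - t| ≤ halfPot G σ (1 * r + -1 * t) + halfPot G σ (-1 * r + 1 * t) := by
  rcases abs_choice (r - t) with h | h
  · rw [h, (by ring : r - t = 1 * r + -1 * t)]; exact le_self_add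
  · rw [h, (by ring : -(r - t) = -1 * r + 1 * t)]; exact le_add_self

/-- The range of `s` has three parts: above `max r t`, where `r + t` is singular; between 1 and `max
r t`, where `|r - t|` is; and below 1, cut into dyadic pieces. In the first two, `r` is at most a
multiple of `s`, so `p ≤ q` lets `s ^ (1 / p)` absorb `r ^ (1 / q)`. -/
theorem ofReal_mul_radMean_le {p q r t : ℝ} (hp : 1 ≤ p) (hpq : p ≤ q) (hr : 1 / 4 < r)
    (ht : t ∈ Icc (1 : ℝ) 2) {g : ℝ → ℝ≥0∞} (hg : Measurable g) :
    ENNReal.ofReal (r ^ (1 / q)) * radMean t g r ≤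
      6 * (halfPot (farPart p g) 4 (r + t) + halfPot (farPart p g) 4 |r - t| +
        ∑' m, ENNReal.ofReal (dyad m ^ (1 / 2 : ℝ)) *
          halfPot (dyadPart g m) (2 * dyad m) |r - t|) := by
  have hp0 : 0 < p := by linarith
  have hq0 : 0 < q := by linarith
  have hqp : 1 / q ≤ 1 / p := one_div_le_one_div_of_le hp0 hpq
  have hq1 : 1 / q ≤ 1 := (div_le_one hq0).2 (by linarith)
  have hG := measurable_farPart (p := p) hg
  have hGm := measurable_dyadPart hg
  simp_rw [← lintegral_potFun, ← fun m => lintegral_const_mul (μ := volume)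
    (ENNReal.ofReal (dyad m ^ (1 / 2 : ℝ))) (measurable_potFun (hGm m) (2 * dyad m) |r - t|)]
  rw [← lintegral_tsum fun m => ((measurable_potFun (hGm m) _ _).const_mul _).aemeasurable,
    ← lintegral_add_left (measurable_potFun hG _ _), ← lintegral_add_left
      (f := fun s => potFun (farPart p g) 4 (r + t) s + potFun (farPart p g) 4 |r - t| s)
      ((measurable_potFun hG _ _).add (measurable_potFun hG _ _)),
    ← lintegral_const_mul' _ _ (by finiteness), radMean,
    ← lintegral_const_mul' _ _ ENNReal.ofReal_ne_top, ← lintegral_indicator measurableSet_Ioo]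
  refine lintegral_mono fun s => indicator_le' (g := fun s => 6 * (potFun (farPart p g) 4 (r + t) s +
    potFun (farPart p g) 4 |r - t| s + ∑' m, ENNReal.ofReal (dyad m ^ (1 / 2 : ℝ)) *
      potFun (dyadPart g m) (2 * dyad m) |r - t| s)) (fun s hs => ?_) (fun _ _ => zero_le) s
  obtain ⟨hs1, hs2⟩ := hs
  have hd := abs_nonneg (r - t)
  have hs0 : 0 < s := hd.trans_lt hs1
  have hr2 : r < s + 2 := by linarith [le_abs_self (r - t), ht.2]
  have hmin : s - |r - t| < 2 ∨ max r t ≤ s := by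
    by_cases h : max r t ≤ s
    · exact Or.inr h
    · left
      rw [not_le, lt_max_iff] at h
      rcases h with h | h
      · linarith [le_abs_self (r - t), ht.2]
      · linarith [neg_abs_le (r - t), ht.2]
  have hquarter : (1 / 4 : ℝ) ^ (-(1 / 2) : ℝ) = 2 := by
    rw [(by norm_num : (1 / 4 : ℝ) = 2 ^ (-2 : ℝ)), ← Real.rpow_mul zero_le_two]; norm_num
  have six : (6 : ℝ≥0∞) = ENNReal.ofReal 6 := by simp
  have key : ∀ (c : ℝ) (x : ℝ), 0 ≤ c → r ^ (1 / q) * radKernel r t s ≤ 6 * (c * x) →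
      ENNReal.ofReal (r ^ (1 / q)) * (g s * ENNReal.ofReal (radKernel r t s)) ≤
        6 * (ENNReal.ofReal c * g s * ENNReal.ofReal x) := by
    intro c x hc h
    calc ENNReal.ofReal (r ^ (1 / q)) * (g s * ENNReal.ofReal (radKernel r t s))
        = ENNReal.ofReal (r ^ (1 / q) * radKernel r t s) * g s := by
          rw [ENNReal.ofReal_mul (by positivity)]; ring
      _ ≤ ENNReal.ofReal (6 * (c * x)) * g s := by gcongr
      _ = _ := by rw [ENNReal.ofReal_mul (by norm_num), ENNReal.ofReal_mul hc, six]; ring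
  rcases le_or_gt (max r t) s with h | h
  · have h1 := (max_le_iff.1 h).1
    have h2 := (max_le_iff.1 h).2
    have hs1' : 1 ≤ s := ht.1.trans h2
    refine (key (s ^ (1 / p)) (|s - (r + t)| ^ (-(1 / 2) : ℝ)) (by positivity) ?_).trans ?_
    · have hk := radKernel_le_of_ge (a := 1 / 4) (by linarith) (by linarith [ht.1]) (by norm_num)
        hr.le (by linarith [ht.1]) hs1 hs2 h
      rw [hquarter] at hk
      have hrs : r ^ (1 / q) ≤ s ^ (1 / p) :=
        (Real.rpow_le_rpow (by linarith) h1 (by positivity)).trans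
          (Real.rpow_le_rpow_of_exponent_le hs1' hqp)
      have := mul_le_mul hrs hk (by unfold radKernel; positivity) (by positivity)
      refine this.trans ?_
      have : 0 ≤ s ^ (1 / p) * |s - (r + t)| ^ (-(1 / 2) : ℝ) := by positivity
      linarith
    · gcongr
      refine le_trans (le_of_eq ?_) (le_self_add.trans le_self_add)
      rw [potFun_of_lt, farPart, indicator_of_mem (by rw [mem_Ici]; linarith)]
      rw [abs_lt]; constructor <;> linarith [ht.2]
  have hlt2 : s - |r - t| < 2 := hmin.resolve_right (not_le.2 h)
  rcases lt_or_ge 1 s with hs1' | hs1'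
  · refine (key (s ^ (1 / p)) (|(s - |r - t|)| ^ (-(1 / 2) : ℝ)) (by positivity) ?_).trans ?_
    · have hk := radKernel_le_of_le (a := 1 / 4) (by linarith) (by linarith [ht.1]) (by norm_num)
        hr.le (by linarith [ht.1]) hs1 h.le
      rw [hquarter] at hk
      have hrs : r ^ (1 / q) ≤ 3 * s ^ (1 / p) := by
        calc r ^ (1 / q) ≤ (3 * s) ^ (1 / q) :=
              Real.rpow_le_rpow (by linarith) (by linarith) (by positivity)
          _ = 3 ^ (1 / q) * s ^ (1 / q) := Real.mul_rpow (by norm_num) hs0.le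
          _ ≤ 3 ^ (1 : ℝ) * s ^ (1 / p) := by
              gcongr
              · norm_num
              · exact hs1'.le
          _ = _ := by rw [Real.rpow_one]
      have := mul_le_mul hrs hk (by unfold radKernel; positivity) (by positivity)
      refine this.trans (le_of_eq (by ring))
    · gcongr
      refine le_trans (le_of_eq ?_) (le_add_self.trans le_self_add)
      rw [potFun_of_lt, farPart, indicator_of_mem (by rw [mem_Ici]; linarith)]
      rw [abs_lt]; constructor <;> linarith [ht.2]
  · obtain ⟨m, hm⟩ := exists_mem_dyad hs0 hs1'
    refine (key (dyad m ^ (1 / 2 : ℝ)) (|(s - |r - t|)| ^ (-(1 / 2) : ℝ))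
      (by have := dyad_pos m; positivity) ?_).trans ?_
    · have hk := radKernel_le_of_le_one hr.le ht.1 hs1 h.le hm.2
      have hrs : r ^ (1 / q) ≤ 3 := by
        calc r ^ (1 / q) ≤ 3 ^ (1 / q) :=
              Real.rpow_le_rpow (by linarith) (by linarith) (by positivity)
          _ ≤ 3 ^ (1 : ℝ) := Real.rpow_le_rpow_of_exponent_le (by norm_num) hq1
          _ = 3 := Real.rpow_one 3
      have := mul_le_mul hrs hk (by unfold radKernel; positivity) (by positivity)
      refine this.trans (le_of_eq (by ring))
    · gcongr
      refine le_trans (le_of_eq ?_) (le_add_self.trans' (ENNReal.le_tsum m))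
      rw [potFun_of_lt, dyadPart, indicator_of_mem hm, mul_assoc]
      rw [abs_lt]; constructor <;> linarith [hm.2, dyad_pos m]

/-- Since `t ≥ 1`, a small radius keeps `s` away from the origin, so only `farPart` occurs. Both
singularities are present, at the cost `r ^ (-1 / 2)`, and `s` lies within `r` of the relevant one.
-/
theorem radMean_le_of_small {p ρ r t : ℝ} (hp : 1 ≤ p) (hρ : ρ ≤ 1 / 4)
    (hr : r ∈ Ioc (ρ / 2) ρ) (hρ0 : 0 < ρ) (ht : t ∈ Icc (1 : ℝ) 2) {g : ℝ → ℝ≥0∞}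
    (hg : Measurable g) :
    radMean t g r ≤ ENNReal.ofReal (4 * ρ ^ (-(1 / 2) : ℝ)) *
      (halfPot (farPart p g) (2 * ρ) (1 * r + 1 * t) +
        halfPot (farPart p g) (2 * ρ) (-1 * r + 1 * t)) := by
  have hr0 : 0 < r := by linarith [hr.1]
  have hG := measurable_farPart (p := p) hg
  have habs : |r - t| = -1 * r + 1 * t := by
    rw [abs_of_nonpos (by linarith [hr.2, ht.1])]; ring
  rw [← habs, one_mul, one_mul, ← lintegral_potFun, ← lintegral_potFun,
    ← lintegral_add_left (measurable_potFun hG _ _),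
    ← lintegral_const_mul' _ _ ENNReal.ofReal_ne_top, radMean,
    ← lintegral_indicator measurableSet_Ioo]
  refine lintegral_mono fun s => indicator_le' (g := fun s =>
    ENNReal.ofReal (4 * ρ ^ (-(1 / 2) : ℝ)) * (potFun (farPart p g) (2 * ρ) (r + t) s +
    potFun (farPart p g) (2 * ρ) |r - t| s)) (fun s hs => ?_) (fun _ _ => zero_le) s
  obtain ⟨hs1, hs2⟩ := hs
  have hsge : 1 / 2 ≤ s := by
    rw [habs] at hs1; linarith [hr.2, ht.1]
  have hs0 : 0 < s := by linarith
  have hhalf : 1 / 2 ≤ s ^ (1 / p) := by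
    have h1p : 1 / p ≤ 1 := (div_le_one (by linarith)).2 hp
    rcases le_total 1 s with h | h
    · linarith [Real.one_le_rpow h (by positivity : 0 ≤ 1 / p)]
    · have := Real.rpow_le_rpow_of_exponent_ge hs0 h h1p
      rw [Real.rpow_one] at this; linarith
  have hrρ : r ^ (-(1 / 2) : ℝ) ≤ 2 * ρ ^ (-(1 / 2) : ℝ) := by
    calc r ^ (-(1 / 2) : ℝ) ≤ (ρ * 2 ^ (-2 : ℝ)) ^ (-(1 / 2) : ℝ) := by
          refine Real.rpow_le_rpow_of_nonpos (by positivity) ?_ (by norm_num)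
          rw [Real.rpow_neg zero_le_two]; norm_num; linarith [hr.1]
      _ = _ := by
          rw [Real.mul_rpow hρ0.le (by positivity), ← Real.rpow_mul zero_le_two]
          norm_num [mul_comm]
  have key : ∀ x : ℝ, 0 ≤ x → radKernel r t s ≤ r ^ (-(1 / 2) : ℝ) * x →
      g s * ENNReal.ofReal (radKernel r t s) ≤ ENNReal.ofReal (4 * ρ ^ (-(1 / 2) : ℝ)) *
        (ENNReal.ofReal (s ^ (1 / p)) * g s * ENNReal.ofReal x) := by
    intro x hx h
    calc g s * ENNReal.ofReal (radKernel r t s)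
        ≤ g s * ENNReal.ofReal (4 * ρ ^ (-(1 / 2) : ℝ) * s ^ (1 / p) * x) := by
          gcongr
          refine h.trans ?_
          gcongr
          refine hrρ.trans ?_
          have : 0 ≤ ρ ^ (-(1 / 2) : ℝ) := by positivity
          nlinarith
      _ = _ := by
          rw [ENNReal.ofReal_mul (by positivity), ENNReal.ofReal_mul (by positivity)]; ring
  rcases le_or_gt (max r t) s with h | h
  · refine (key (|s - (r + t)| ^ (-(1 / 2) : ℝ)) (by positivity)
      (radKernel_le_of_ge hr0 (by linarith [ht.1]) hr0 le_rfl (by linarith [ht.1, hr.2]) hs1 hs2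
        h)).trans ?_
    gcongr
    refine le_trans (le_of_eq ?_) le_self_add
    rw [potFun_of_lt, farPart, indicator_of_mem (mem_Ici.2 hsge)]
    rw [abs_lt]; constructor <;> linarith [(max_le_iff.1 h).2, hr.2]
  · refine (key (|(s - |r - t|)| ^ (-(1 / 2) : ℝ)) (by positivity)
      (radKernel_le_of_le hr0 (by linarith [ht.1]) hr0 le_rfl (by linarith [ht.1, hr.2]) hs1
        h.le)).trans ?_
    gcongr
    refine le_trans (le_of_eq ?_) le_add_self
    have hst : s < t := (lt_max_iff.1 h).resolve_left (by linarith [hr.2])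
    rw [potFun_of_lt, farPart, indicator_of_mem (mem_Ici.2 hsge)]
    rw [abs_lt]; constructor <;> linarith [hr.2]

/-! ### Summing the pieces over all radii -/

/-- A power law for the measure of neighbourhoods of `E`. -/
def ThickeningBound (E : Set ℝ) (b : ℝ) : Prop :=
  ∃ K : ℝ≥0∞, K ≠ ⊤ ∧ ∀ δ : ℝ, 0 < δ → δ ≤ 4 →
    volume (Metric.thickening δ E) ≤ K * ENNReal.ofReal (δ ^ b)

theorem ThickeningBound.exists_far_majorant {E : Set ℝ} {p q b e₁ e₂ : ℝ}
    (hT : ThickeningBound E b) (hp : 1 ≤ p) (hpq : p ≤ q) (h₁ : 0 < q / 2 - q / p + b)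
    (he₁ : e₁ = 1 ∨ e₁ = -1) (he₂ : e₂ = 1 ∨ e₂ = -1) :
    ∃ C : ℝ≥0∞, C ≠ ⊤ ∧ ∀ g : ℝ → ℝ≥0∞, Measurable g → ∃ B : ℝ → ℝ≥0∞, Measurable B ∧
      (∀ r, ∀ t ∈ E, halfPot (farPart p g) 4 (e₁ * r + e₂ * t) ^ q ≤ B r) ∧
      ∫⁻ r, B r ≤ C * (∫⁻ s in Ioi 0, ENNReal.ofReal s * g s ^ p) ^ (q / p) := by
  obtain ⟨K, hK, hV⟩ := hT
  obtain ⟨C, hC, H⟩ := exists_majorant_of_power hp hpq h₁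
  refine ⟨C * K * ENNReal.ofReal (4 ^ (q / 2 - q / p + b)), by finiteness, fun g hg => ?_⟩
  obtain ⟨B, hB, hB1, hB2⟩ := H E e₁ e₂ 4 (by norm_num) univ MeasurableSet.univ K (farPart p g)
    (measurable_farPart hg) fun δ u hδ hδ' => (volume_near_le _ _ he₁ he₂ _ _).trans (hV δ hδ hδ')
  refine ⟨B, hB, hB1, ?_⟩
  rw [setLIntegral_univ] at hB2
  have hp0 : 0 < p := by linarith
  have hq0 : 0 < q := by linarith
  exact hB2.trans (mul_le_mul' le_rfl
    (ENNReal.rpow_le_rpow (lintegral_farPart_le hp0 g) (by positivity)))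

theorem ThickeningBound.exists_near_majorant {E : Set ℝ} {p q b e₁ e₂ : ℝ}
    (hT : ThickeningBound E b) (hp : 1 ≤ p) (hpq : p ≤ q) (h₁ : 0 < q / 2 - q / p + b)
    (h₂ : 0 < q - 2 * q / p + b) (he₁ : e₁ = 1 ∨ e₁ = -1) (he₂ : e₂ = 1 ∨ e₂ = -1) :
    ∃ C : ℝ≥0∞, C ≠ ⊤ ∧ ∀ g : ℝ → ℝ≥0∞, Measurable g → ∃ B : ℝ → ℝ≥0∞, Measurable B ∧
      (∀ r, ∀ t ∈ E, (∑' m, ENNReal.ofReal (dyad m ^ (1 / 2 : ℝ)) *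
        halfPot (dyadPart g m) (2 * dyad m) (e₁ * r + e₂ * t)) ^ q ≤ B r) ∧
      ∫⁻ r, B r ≤ C * (∫⁻ s in Ioi 0, ENNReal.ofReal s * g s ^ p) ^ (q / p) := by
  have hp0 : 0 < p := by linarith
  have hq0 : 0 < q := by linarith
  -- Net power of `dyad m`: `q / 2` from the kernel, `e` from the fractional integral, and `-q / p`
  -- from removing the weight. Half of it pays for summing over `m` inside the `q`-th power.
  set x := q - 2 * q / p + b with hx
  set e := q / 2 - q / p + b with he
  obtain ⟨K, hK, hV⟩ := hT
  obtain ⟨C, hC, H⟩ := exists_majorant_of_power hp hpq h₁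
  obtain ⟨C', hC', hsum⟩ := exists_tsum_rpow_le hq0 (half_pos h₂)
  have hgeo := tsum_two_rpow_ne_top (half_pos h₂)
  refine ⟨C' * C * K * ENNReal.ofReal (2 ^ e * 2 ^ (q / p)) *
    ∑' m : ℕ, ENNReal.ofReal ((2 : ℝ) ^ (-(m * (x / 2)))), by finiteness, fun g hg => ?_⟩
  have hB := fun m : ℕ => H E e₁ e₂ (2 * dyad m) (by have := dyad_pos m; positivity) univ
    MeasurableSet.univ K (dyadPart g m) (measurable_dyadPart hg m)
    fun δ u hδ hδ' => (volume_near_le _ _ he₁ he₂ _ _).trans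
      (hV δ hδ (by linarith [dyad_le_one m]))
  obtain ⟨D, hD, hD1, hD2⟩ := exists_tsum_majorant
    (fun m => ENNReal.ofReal ((2 : ℝ) ^ (m * (x / 2)) * dyad m ^ (q / 2)))
    (fun m => MeasurableSet.univ) hB
  refine ⟨fun r => C' * D r, hD.const_mul _, fun r t ht => ?_, ?_⟩
  · refine (hsum _).trans (mul_le_mul' le_rfl ?_)
    refine le_trans (ENNReal.tsum_le_tsum fun m => le_of_eq ?_) (hD1 r t ht)
    have := dyad_pos m
    rw [indicator_of_mem (mem_univ r), ENNReal.mul_rpow_of_nonneg _ _ hq0.le,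
      ENNReal.ofReal_rpow_of_pos (by positivity), ← Real.rpow_mul this.le,
      ENNReal.ofReal_mul (by positivity), mul_assoc, (by ring : 1 / 2 * q = q / 2)]
  · rw [lintegral_const_mul _ hD, mul_assoc, mul_assoc, mul_assoc, mul_assoc]
    gcongr
    refine hD2.trans ?_
    set S := ∫⁻ s in Ioi 0, ENNReal.ofReal s * g s ^ p
    rw [← ENNReal.tsum_mul_right, ← ENNReal.tsum_mul_left, ← ENNReal.tsum_mul_left,
      ← ENNReal.tsum_mul_left]
    refine ENNReal.tsum_le_tsum fun m => ?_
    have hm := dyad_pos m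
    calc ENNReal.ofReal ((2 : ℝ) ^ (m * (x / 2)) * dyad m ^ (q / 2)) *
          (C * K * ENNReal.ofReal ((2 * dyad m) ^ e) * (∫⁻ s, dyadPart g m s ^ p) ^ (q / p))
        ≤ ENNReal.ofReal ((2 : ℝ) ^ (m * (x / 2)) * dyad m ^ (q / 2)) *
          (C * K * ENNReal.ofReal ((2 * dyad m) ^ e) *
            (ENNReal.ofReal (2 / dyad m) * S) ^ (q / p)) := by
          gcongr; exact lintegral_dyadPart_le hp0 hg m
      _ = C * K * ENNReal.ofReal ((2 : ℝ) ^ (m * (x / 2)) * dyad m ^ (q / 2) *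
            (2 * dyad m) ^ e * (2 / dyad m) ^ (q / p)) * S ^ (q / p) := by
          rw [ENNReal.mul_rpow_of_nonneg _ _ (by positivity),
            ENNReal.ofReal_rpow_of_pos (by positivity),
            ENNReal.ofReal_mul (p := (2 : ℝ) ^ (m * (x / 2)) * dyad m ^ (q / 2) * (2 * dyad m) ^ e)
              (by positivity),
            ENNReal.ofReal_mul (p := (2 : ℝ) ^ (m * (x / 2)) * dyad m ^ (q / 2)) (by positivity)]
          ring
      _ = C * K * ENNReal.ofReal (2 ^ e * 2 ^ (q / p) * 2 ^ (-(m * (x / 2)))) * S ^ (q / p) := by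
          congr 3
          rw [Real.mul_rpow zero_le_two hm.le, Real.div_rpow zero_le_two hm.le, div_eq_mul_inv (2 ^ (q / p)),
            ← Real.rpow_neg hm.le]
          calc _ = 2 ^ e * 2 ^ (q / p) * (2 ^ (m * (x / 2)) *
                (dyad m ^ (q / 2) * dyad m ^ e * dyad m ^ (-(q / p)))) := by ring
            _ = 2 ^ e * 2 ^ (q / p) * (2 ^ (m * (x / 2)) * dyad m ^ x) := by
                rw [← Real.rpow_add hm, ← Real.rpow_add hm]
                congr 3; rw [hx, he]; ring
            _ = _ := by
                rw [dyad, ← Real.rpow_mul zero_le_two, ← Real.rpow_add two_pos (m * (x / 2))]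
                congr 2; ring
      _ = _ := by
          rw [ENNReal.ofReal_mul (p := 2 ^ e * 2 ^ (q / p)) (by positivity)]; ring

theorem exists_mem_smallRadius {r : ℝ} (h0 : 0 < r) (h1 : r ≤ 1 / 4) :
    ∃ m, r ∈ Ioc (smallRadius m / 2) (smallRadius m) := by
  obtain ⟨m, hm⟩ := exists_mem_dyad (s := 4 * r) (by linarith) (by linarith)
  have e : smallRadius m = dyad m / 4 := by
    rw [smallRadius, dyad, Real.rpow_sub two_pos]; norm_num
  exact ⟨m, by rw [e]; constructor <;> linarith [hm.1, hm.2]⟩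

/-- The one-dimensional form of the maximal inequality. -/
theorem exists_radial_majorant {E : Set ℝ} {p q b : ℝ} (hE : E ⊆ Icc 1 2) (hp : 1 ≤ p)
    (hpq : p ≤ q) (hT : ThickeningBound E b) (h₁ : 0 < q / 2 - q / p + b)
    (h₂ : 0 < q - 2 * q / p + b) (hS : SmallRadiusBound E p q) :
    ∃ C : ℝ≥0∞, C ≠ ⊤ ∧ ∀ g : ℝ → ℝ≥0∞, Measurable g → ∃ D : ℝ → ℝ≥0∞, Measurable D ∧
      (∀ r, 0 < r → ∀ t ∈ E, ENNReal.ofReal r * radMean t g r ^ q ≤ D r) ∧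
      ∫⁻ r, D r ≤ C * (∫⁻ s in Ioi 0, ENNReal.ofReal s * g s ^ p) ^ (q / p) := by
  have hp0 : 0 < p := by linarith
  have hq0 : 0 < q := by linarith
  have hpos : (1 : ℝ) = 1 ∨ (1 : ℝ) = -1 := Or.inl rfl
  have hneg : (-1 : ℝ) = 1 ∨ (-1 : ℝ) = -1 := Or.inr rfl
  obtain ⟨C₁, hC₁, F₁⟩ := hT.exists_far_majorant hp hpq h₁ hpos hpos
  obtain ⟨C₂, hC₂, F₂⟩ := hT.exists_far_majorant hp hpq h₁ hpos hneg
  obtain ⟨C₃, hC₃, F₃⟩ := hT.exists_far_majorant hp hpq h₁ hneg hpos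
  obtain ⟨C₄, hC₄, F₄⟩ := hT.exists_near_majorant hp hpq h₁ h₂ hpos hneg
  obtain ⟨C₅, hC₅, F₅⟩ := hT.exists_near_majorant hp hpq h₁ h₂ hneg hpos
  obtain ⟨C₆, hC₆, F₆⟩ := hS
  set c := ENNReal.ofReal (2 ^ q) with hc
  set a₁ := (6 : ℝ≥0∞) ^ q with ha₁
  set a₂ := ENNReal.ofReal (4 ^ q) with ha₂
  refine ⟨a₁ * (c * (c * (C₁ + c * (C₂ + C₃)) + c * (C₄ + C₅))) + a₂ * (c * (C₆ + C₆)),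
    by finiteness, fun g hg => ?_⟩
  obtain ⟨B₁, m₁, P₁, I₁⟩ := F₁ g hg
  obtain ⟨B₂, m₂, P₂, I₂⟩ := F₂ g hg
  obtain ⟨B₃, m₃, P₃, I₃⟩ := F₃ g hg
  obtain ⟨B₄, m₄, P₄, I₄⟩ := F₄ g hg
  obtain ⟨B₅, m₅, P₅, I₅⟩ := F₅ g hg
  obtain ⟨B₆, m₆, P₆, I₆⟩ := F₆ (farPart p g) (measurable_farPart hg) 1 hpos
  obtain ⟨B₇, m₇, P₇, I₇⟩ := F₆ (farPart p g) (measurable_farPart hg) (-1) hneg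
  refine ⟨fun r => a₁ * (c * (c * (B₁ r + c * (B₂ r + B₃ r)) + c * (B₄ r + B₅ r))) +
    a₂ * (c * (B₆ r + B₇ r)), by fun_prop, fun r hr t ht => ?_, ?_⟩
  · rcases lt_or_ge (1 / 4) r with hr4 | hr4
    · refine le_trans ?_ le_self_add
      have h := ofReal_mul_radMean_le hp hpq hr4 (hE ht) hg
      -- The density `r` of polar coordinates is moved inside the `q`-th power.
      have e : ENNReal.ofReal r * radMean t g r ^ q =
          (ENNReal.ofReal (r ^ (1 / q)) * radMean t g r) ^ q := by
        rw [ENNReal.mul_rpow_of_nonneg _ _ hq0.le, ENNReal.ofReal_rpow_of_pos (by positivity),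
          ← Real.rpow_mul hr.le, one_div_mul_cancel hq0.ne', Real.rpow_one]
      rw [e]
      refine (ENNReal.rpow_le_rpow h hq0.le).trans ?_
      rw [ENNReal.mul_rpow_of_nonneg _ _ hq0.le]
      refine mul_le_mul' le_rfl ((add_rpow_le' hq0 _ _).trans (mul_le_mul' le_rfl (add_le_add ?_ ?_)))
      · refine (add_rpow_le' hq0 _ _).trans (mul_le_mul' le_rfl (add_le_add ?_ ?_))
        · have := P₁ r t ht
          rwa [one_mul, one_mul] at this
        · refine (ENNReal.rpow_le_rpow (halfPot_abs_le _ _ _ _) hq0.le).trans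
            ((add_rpow_le' hq0 _ _).trans (mul_le_mul' le_rfl (add_le_add (P₂ r t ht) (P₃ r t ht))))
      · have hle : ∑' m, ENNReal.ofReal (dyad m ^ (1 / 2 : ℝ)) *
            halfPot (dyadPart g m) (2 * dyad m) |r - t| ≤
            (∑' m, ENNReal.ofReal (dyad m ^ (1 / 2 : ℝ)) *
              halfPot (dyadPart g m) (2 * dyad m) (1 * r + -1 * t)) +
            ∑' m, ENNReal.ofReal (dyad m ^ (1 / 2 : ℝ)) *
              halfPot (dyadPart g m) (2 * dyad m) (-1 * r + 1 * t) := by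
          rw [← ENNReal.tsum_add]
          refine ENNReal.tsum_le_tsum fun m => ?_
          rw [← mul_add]
          gcongr
          exact halfPot_abs_le _ _ _ _
        exact (ENNReal.rpow_le_rpow hle hq0.le).trans
            ((add_rpow_le' hq0 _ _).trans (mul_le_mul' le_rfl (add_le_add (P₄ r t ht) (P₅ r t ht))))
    · refine le_trans ?_ le_add_self
      obtain ⟨m, hm⟩ := exists_mem_smallRadius hr hr4
      have hρ := smallRadius_pos m
      set ρ := smallRadius m with hρdef
      have h := radMean_le_of_small hp (smallRadius_le m) hm hρ (hE ht) hg
      calc ENNReal.ofReal r * radMean t g r ^ q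
          ≤ ENNReal.ofReal ρ * (ENNReal.ofReal (4 * ρ ^ (-(1 / 2) : ℝ)) *
            (halfPot (farPart p g) (2 * ρ) (1 * r + 1 * t) +
              halfPot (farPart p g) (2 * ρ) (-1 * r + 1 * t))) ^ q := by
            gcongr; exact hm.2
        -- The exponent `1 - q / 2` combines the density of polar coordinates with the `q`-th power
        -- of the kernel factor `ρ ^ (-1 / 2)`.
        _ = a₂ * (ENNReal.ofReal (ρ ^ (1 - q / 2)) *
            (halfPot (farPart p g) (2 * ρ) (1 * r + 1 * t) +
              halfPot (farPart p g) (2 * ρ) (-1 * r + 1 * t)) ^ q) := by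
            rw [ENNReal.mul_rpow_of_nonneg _ _ hq0.le, ENNReal.ofReal_rpow_of_pos (by positivity),
              ← mul_assoc, ← mul_assoc, ha₂, ← ENNReal.ofReal_mul hρ.le,
              ← ENNReal.ofReal_mul (by positivity), Real.mul_rpow (by norm_num) (by positivity),
              ← Real.rpow_mul hρ.le, Real.rpow_sub hρ, Real.rpow_one,
              (by ring : -(1 / 2) * q = -(q / 2)), Real.rpow_neg hρ.le]
            congr 2; field_simp
        _ ≤ _ := by
            refine mul_le_mul' le_rfl ?_
            refine (mul_le_mul' le_rfl (add_rpow_le' hq0 _ _)).trans ?_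
            rw [mul_left_comm, mul_add]
            exact mul_le_mul' le_rfl (add_le_add (P₆ m r hm t ht) (P₇ m r hm t ht))
  · have hfar := ENNReal.rpow_le_rpow (lintegral_farPart_le hp0 g) (by positivity : 0 ≤ q / p)
    replace I₆ := I₆.trans (mul_le_mul' le_rfl hfar)
    replace I₇ := I₇.trans (mul_le_mul' le_rfl hfar)
    generalize (∫⁻ s in Ioi 0, ENNReal.ofReal s * g s ^ p) ^ (q / p) = S at *
    calc _ = a₁ * (c * (c * ((∫⁻ r, B₁ r) + c * ((∫⁻ r, B₂ r) + ∫⁻ r, B₃ r)) +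
          c * ((∫⁻ r, B₄ r) + ∫⁻ r, B₅ r))) + a₂ * (c * ((∫⁻ r, B₆ r) + ∫⁻ r, B₇ r)) := by
          rw [lintegral_add_left (by fun_prop), lintegral_const_mul _ (by fun_prop),
            lintegral_const_mul _ (by fun_prop), lintegral_add_left (by fun_prop),
            lintegral_const_mul _ (by fun_prop), lintegral_add_left (by fun_prop),
            lintegral_const_mul _ (by fun_prop), lintegral_add_left (by fun_prop),
            lintegral_const_mul _ (by fun_prop), lintegral_add_left (by fun_prop),
            lintegral_const_mul _ (by fun_prop), lintegral_const_mul _ (by fun_prop),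
            lintegral_add_left (by fun_prop)]
      _ ≤ a₁ * (c * (c * (C₁ * S + c * (C₂ * S + C₃ * S)) + c * (C₄ * S + C₅ * S))) +
          a₂ * (c * (C₆ * S + C₆ * S)) := by gcongr
      _ = _ := by ring

/-! ## Circular means in polar coordinates -/

theorem exists_polar (x : Plane) : ∃ φ : ℝ, x 0 = ‖x‖ * Real.cos φ ∧ x 1 = ‖x‖ * Real.sin φ := by
  have hn : ‖(⟨x 0, x 1⟩ : ℂ)‖ = ‖x‖ := by
    rw [EuclideanSpace.norm_eq, Complex.norm_def, Complex.normSq_mk, Fin.sum_univ_two]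
    simp [sq]
  refine ⟨Complex.arg ⟨x 0, x 1⟩, ?_, ?_⟩
  · rw [← hn, Complex.norm_mul_cos_arg]
  · rw [← hn, Complex.norm_mul_sin_arg]

theorem continuous_circlePoint : Continuous circlePoint := by
  unfold circlePoint
  refine (PiLp.continuous_toLp 2 _).comp (continuous_pi fun i => ?_)
  fin_cases i
  · exact Real.continuous_cos
  · exact Real.continuous_sin

theorem norm_circlePoint (φ : ℝ) : ‖circlePoint φ‖ = 1 := by
  rw [EuclideanSpace.norm_eq, Fin.sum_univ_two]
  simp [circlePoint]

theorem norm_sub_smul_circlePoint {x : Plane} {φ₀ : ℝ} (h0 : x 0 = ‖x‖ * Real.cos φ₀)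
    (h1 : x 1 = ‖x‖ * Real.sin φ₀) (t φ : ℝ) :
    ‖x - t • circlePoint φ‖ = √(‖x‖ ^ 2 + t ^ 2 - 2 * ‖x‖ * t * Real.cos (φ - φ₀)) := by
  rw [EuclideanSpace.norm_eq (x - t • circlePoint φ), Fin.sum_univ_two]
  congr 1
  simp only [circlePoint, PiLp.sub_apply, PiLp.smul_apply, smul_eq_mul, Real.norm_eq_abs, sq_abs]
  simp only [Matrix.cons_val_zero, Matrix.cons_val_one, h0, h1, Real.cos_sub]
  generalize ‖x‖ = r
  linear_combination r ^ 2 * Real.sin_sq_add_cos_sq φ₀ + t ^ 2 * Real.sin_sq_add_cos_sq φ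

/-- The third side of a triangle with sides `r`, `t` enclosing the angle `φ`. -/
def thirdSide (r t φ : ℝ) : ℝ := √(r ^ 2 + t ^ 2 - 2 * r * t * Real.cos φ)

theorem thirdSide_arg_pos {r t φ : ℝ} (hr : 0 < r) (ht : 0 < t) (hφ : φ ∈ Ioo 0 Real.pi) :
    0 < r ^ 2 + t ^ 2 - 2 * r * t * Real.cos φ := by
  have hc : Real.cos φ < 1 := by
    have := Real.cos_lt_cos_of_nonneg_of_le_pi le_rfl hφ.2.le hφ.1
    simpa using this
  have : 0 < r * t := by positivity
  nlinarith [sq_nonneg (r - t)]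

theorem image_thirdSide {r t : ℝ} (hr : 0 < r) (ht : 0 < t) :
    thirdSide r t '' Ioo 0 Real.pi = Ioo |r - t| (r + t) := by
  have hrt : 0 < r * t := by positivity
  ext s
  constructor
  · rintro ⟨φ, hφ, rfl⟩
    have hc1 : Real.cos φ < 1 := by
      simpa using Real.cos_lt_cos_of_nonneg_of_le_pi le_rfl hφ.2.le hφ.1
    have hc2 : -1 < Real.cos φ := by
      simpa using Real.cos_lt_cos_of_nonneg_of_le_pi hφ.1.le le_rfl hφ.2
    constructor
    · rw [thirdSide, Real.lt_sqrt (abs_nonneg _), sq_abs]; nlinarith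
    · rw [thirdSide, Real.sqrt_lt' (by linarith)]; nlinarith
  · rintro ⟨h1, h2⟩
    have hs0 : 0 < s := (abs_nonneg _).trans_lt h1
    have hd : (r - t) ^ 2 < s ^ 2 := by rw [sq_lt_sq, abs_of_pos hs0]; exact h1
    have hw : s ^ 2 < (r + t) ^ 2 := by gcongr
    set c := (r ^ 2 + t ^ 2 - s ^ 2) / (2 * r * t) with hc
    have hc1 : c < 1 := by rw [hc, div_lt_one (by positivity)]; nlinarith
    have hc2 : -1 < c := by rw [hc, lt_div_iff₀ (by positivity)]; nlinarith
    refine ⟨Real.arccos c, ⟨Real.arccos_pos.2 hc1, ?_⟩, ?_⟩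
    · refine lt_of_le_of_ne (Real.arccos_le_pi c) fun h => ?_
      rw [Real.arccos_eq_pi] at h
      linarith
    · rw [thirdSide, Real.cos_arccos hc2.le hc1.le, hc]
      rw [(by field_simp; ring : r ^ 2 + t ^ 2 - 2 * r * t * ((r ^ 2 + t ^ 2 - s ^ 2) / (2 * r * t))
        = s ^ 2), Real.sqrt_sq hs0.le]

/-- Change of variables by the law of cosines: `s ds = r t sin φ dφ`, and the square root in
`radKernel` equals `2 r t sin φ`. -/
theorem lintegral_thirdSide {r t : ℝ} (hr : 0 < r) (ht : 0 < t) (g : ℝ → ℝ≥0∞) :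
    ∫⁻ φ in Ioo 0 Real.pi, g (thirdSide r t φ) = 2 * radMean t g r := by
  have hrt : 0 < r * t := by positivity
  have hderiv : ∀ φ ∈ Ioo 0 Real.pi, HasDerivWithinAt (thirdSide r t)
      (r * t * Real.sin φ / thirdSide r t φ) (Ioo 0 Real.pi) φ := by
    intro φ hφ
    have h := (((Real.hasDerivAt_cos φ).const_mul (2 * r * t)).const_sub (r ^ 2 + t ^ 2)).sqrt
      (thirdSide_arg_pos hr ht hφ).ne'
    refine (h.congr_deriv ?_).hasDerivWithinAt
    rw [thirdSide, div_eq_div_iff (by have := Real.sqrt_pos.2 (thirdSide_arg_pos hr ht hφ); positivity)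
      (Real.sqrt_pos.2 (thirdSide_arg_pos hr ht hφ)).ne']
    ring
  have hinj : InjOn (thirdSide r t) (Ioo 0 Real.pi) := by
    intro φ hφ ψ hψ h
    rw [thirdSide, thirdSide, Real.sqrt_inj (thirdSide_arg_pos hr ht hφ).le
      (thirdSide_arg_pos hr ht hψ).le] at h
    refine Real.injOn_cos (Ioo_subset_Icc_self hφ) (Ioo_subset_Icc_self hψ) ?_
    have : (2 * r * t) * Real.cos φ = (2 * r * t) * Real.cos ψ := by linarith
    exact mul_left_cancel₀ (by positivity) this
  have h := lintegral_image_eq_lintegral_abs_deriv_mul measurableSet_Ioo hderiv hinj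
    fun s => g s * ENNReal.ofReal (radKernel r t s)
  rw [image_thirdSide hr ht] at h
  rw [radMean, h, ← lintegral_const_mul' _ _ (by finiteness)]
  refine setLIntegral_congr_fun measurableSet_Ioo fun φ hφ => ?_
  have hP := thirdSide_arg_pos hr ht hφ
  have hS : 0 < thirdSide r t φ := Real.sqrt_pos.2 hP
  have hsin := Real.sin_pos_of_mem_Ioo hφ
  have hsq : thirdSide r t φ ^ 2 = r ^ 2 + t ^ 2 - 2 * r * t * Real.cos φ := Real.sq_sqrt hP.le
  have hk : radKernel r t (thirdSide r t φ) = thirdSide r t φ / (2 * r * t * Real.sin φ) := by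
    rw [radKernel, hsq]
    congr 1
    rw [Real.sqrt_eq_iff_mul_self_eq_of_pos (by positivity)]
    linear_combination (4 * r ^ 2 * t ^ 2) * Real.sin_sq_add_cos_sq φ
  have e : (2 : ℝ≥0∞) * ENNReal.ofReal |r * t * Real.sin φ / thirdSide r t φ| *
      ENNReal.ofReal (radKernel r t (thirdSide r t φ)) = 1 := by
    rw [(by simp : (2 : ℝ≥0∞) = ENNReal.ofReal 2), ← ENNReal.ofReal_mul (by norm_num),
      ← ENNReal.ofReal_mul (by positivity), abs_of_pos (by positivity), hk,
      ← ENNReal.ofReal_one]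
    congr 1
    field_simp
  calc g (thirdSide r t φ) = (2 * ENNReal.ofReal |r * t * Real.sin φ / thirdSide r t φ| *
      ENNReal.ofReal (radKernel r t (thirdSide r t φ))) * g (thirdSide r t φ) := by rw [e, one_mul]
    _ = _ := by ring

/-- A rotation puts `x` on the axis; reflection then folds the circle onto a half circle. This
doubles the factor 2 of `lintegral_thirdSide`. -/
theorem lintegral_circle {x : Plane} (hx : x ≠ 0) {t : ℝ} (ht : 0 < t) (g : ℝ → ℝ≥0∞) :
    ∫⁻ φ in Ioc 0 (2 * Real.pi), g ‖x - t • circlePoint φ‖ = 4 * radMean t g ‖x‖ := by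
  obtain ⟨φ₀, h0, h1⟩ := exists_polar x
  set F : ℝ → ℝ≥0∞ := fun φ => g (thirdSide ‖x‖ t φ) with hF
  have hFe : ∀ φ, F (-φ) = F φ := fun φ => by simp [hF, thirdSide]
  have hFp : ∀ φ (k : ℤ), F (φ + k * (2 * Real.pi)) = F φ := fun φ k => by
    simp [hF, thirdSide, Real.cos_add_int_mul_two_pi]
  have hpi := Real.two_pi_pos
  have hpi0 := Real.pi_pos
  have hnegpres : MeasurePreserving (fun φ : ℝ => -φ) volume volume := Measure.measurePreserving_neg _
  calc ∫⁻ φ in Ioc 0 (2 * Real.pi), g ‖x - t • circlePoint φ‖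
      = ∫⁻ φ in Ioc 0 (0 + 2 * Real.pi), F (φ - φ₀) := by
        simp only [norm_sub_smul_circlePoint h0 h1, zero_add, hF, thirdSide]
    _ = ∫⁻ φ in Ioc (φ₀ - Real.pi) (φ₀ - Real.pi + 2 * Real.pi), F (φ - φ₀) := by
        refine (isAddFundamentalDomain_Ioc hpi 0).setLIntegral_eq
          (isAddFundamentalDomain_Ioc hpi _) _ ?_
        rintro ⟨_, k, rfl⟩ φ
        show F ((k • (2 * Real.pi)) + φ - φ₀) = F (φ - φ₀)
        rw [zsmul_eq_mul, ← hFp (φ - φ₀) k]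
        congr 1; ring
    _ = ∫⁻ φ in Ioc (-Real.pi) Real.pi, F φ := by
        have h := (measurePreserving_sub_right volume φ₀).setLIntegral_comp_preimage_emb
          (MeasurableEquiv.subRight φ₀).measurableEmbedding F (Ioc (-Real.pi) Real.pi)
        rw [← h]
        congr 2
        ext φ
        simp only [mem_Ioc, mem_preimage]
        constructor <;> rintro ⟨a, b⟩ <;> constructor <;> linarith
    _ = (∫⁻ φ in Ioc (-Real.pi) 0, F φ) + ∫⁻ φ in Ioc 0 Real.pi, F φ := by
        rw [← Ioc_union_Ioc_eq_Ioc (by linarith : -Real.pi ≤ 0) hpi0.le,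
          lintegral_union measurableSet_Ioc (Ioc_disjoint_Ioc_of_le le_rfl)]
    _ = (∫⁻ φ in Ioo 0 Real.pi, F φ) + ∫⁻ φ in Ioo 0 Real.pi, F φ := by
        rw [← restrict_Ioo_eq_restrict_Ioc (μ := volume) (a := 0),
          ← restrict_Ioo_eq_restrict_Ioc (μ := volume) (a := -Real.pi)]
        congr 1
        have h := hnegpres.setLIntegral_comp_preimage_emb
          (MeasurableEquiv.neg ℝ).measurableEmbedding F (Ioo (-Real.pi) 0)
        rw [← h]
        simp only [hFe]
        congr 2
        ext φ
        simp only [mem_Ioo, mem_preimage]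
        constructor <;> rintro ⟨a, b⟩ <;> constructor <;> linarith
    _ = 4 * radMean t g ‖x‖ := by
        rw [hF, lintegral_thirdSide (norm_pos_iff.2 hx) ht]
        ring

/-- The total mass of the measure that goes with polar coordinates. -/
def sphereMass : ℝ≥0∞ := (volume : Measure Plane).toSphere univ

theorem sphereMass_ne_top : sphereMass ≠ ⊤ := measure_ne_top _ _

theorem sphereMass_ne_zero : sphereMass ≠ 0 := by
  rw [sphereMass, Measure.toSphere_apply_univ]
  refine mul_ne_zero (by simp) (Metric.isOpen_ball.measure_pos _ ⟨0, by simp⟩).ne'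

theorem lintegral_fun_norm {g : ℝ → ℝ≥0∞} (hg : Measurable g) :
    ∫⁻ x : Plane, g ‖x‖ = sphereMass * ∫⁻ r in Ioi 0, ENNReal.ofReal r * g r := by
  have hmp := (volume : Measure Plane).measurePreserving_homeomorphUnitSphereProd
  have h := hmp.lintegral_comp_emb (Homeomorph.measurableEmbedding _)
    (fun z : Metric.sphere (0 : Plane) 1 × Ioi (0 : ℝ) => g z.2)
  simp only [homeomorphUnitSphereProd_apply_snd_coe] at h
  have hdim : Module.finrank ℝ Plane - 1 = 1 := by simp
  rw [← restrict_compl_singleton (μ := (volume : Measure Plane)) 0,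
    ← lintegral_subtype_comap (by measurability : MeasurableSet ({0}ᶜ : Set Plane)), h, hdim,
    lintegral_prod _ (by fun_prop)]
  simp only [lintegral_const]
  rw [mul_comm, sphereMass, Measure.volumeIoiPow,
    lintegral_withDensity_eq_lintegral_mul _ (by fun_prop) (by fun_prop),
    ← lintegral_subtype_comap measurableSet_Ioi]
  simp

/-! ## Profiles of radial functions -/

theorem IsRadial.eq_norm_smul {f : Plane → ℂ} (hf : IsRadial f) (x : Plane) :
    f x = f (‖x‖ • circlePoint 0) := by
  refine hf _ _ ?_
  rw [norm_smul, norm_circlePoint, norm_norm, mul_one]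

/-- A ray is a null set, so a.e. measurability of `f` says nothing about one given ray. In polar
coordinates almost every ray carries an a.e. measurable restriction, and by radiality all rays carry
the same one. -/
theorem IsRadial.exists_profile {f : Plane → ℂ} (hf : IsRadial f)
    (hm : AEStronglyMeasurable f volume) :
    ∃ g : ℝ → ℂ, Measurable g ∧ ∀ᵐ s ∂volume.restrict (Ioi (0 : ℝ)),
      f (s • circlePoint 0) = g s := by
  have hmp := (volume : Measure Plane).measurePreserving_homeomorphUnitSphereProd
  have hmp' : MeasurePreserving (homeomorphUnitSphereProd Plane).toMeasurableEquiv
    (Measure.comap (↑) (volume : Measure Plane)) _ := hmp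
  have h1 : AEStronglyMeasurable (fun z : ({0}ᶜ : Set Plane) => f z)
      (Measure.comap (↑) (volume : Measure Plane)) := by
    refine AEStronglyMeasurable.comp_measurable (g := f) ?_ measurable_subtype_coe
    rw [map_comap_subtype_coe (by measurability)]
    exact hm.restrict
  have h2 := h1.comp_measurePreserving (hmp'.symm _)
  have h3 := h2.prodMk_left
  have : NeZero (volume : Measure Plane).toSphere := ⟨fun h => sphereMass_ne_zero (by
    rw [sphereMass, h]; rfl)⟩
  obtain ⟨ω, hω⟩ := h3.exists
  have h4 : AEStronglyMeasurable (fun s : Ioi (0 : ℝ) => f ((s : ℝ) • circlePoint 0))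
      (Measure.volumeIoiPow (Module.finrank ℝ Plane - 1)) := by
    refine hω.congr (Eventually.of_forall fun s => hf _ _ ?_)
    change ‖(((homeomorphUnitSphereProd Plane).symm (ω, s) : ({0}ᶜ : Set Plane)) : Plane)‖ = _
    rw [homeomorphUnitSphereProd_symm_apply_coe, norm_smul, norm_smul, norm_circlePoint]
    simp
  obtain ⟨g, hg, hg'⟩ := (MeasurableEmbedding.subtype_coe
    (measurableSet_Ioi (a := (0 : ℝ)))).exists_measurable_extend
    (h4.stronglyMeasurable_mk.measurable) (fun _ => ⟨0⟩)
  refine ⟨g, hg, ?_⟩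
  rw [ae_restrict_iff_subtype measurableSet_Ioi]
  have h5 := (ae_withDensity_iff (f := fun r : Ioi (0 : ℝ) =>
    ENNReal.ofReal (r.1 ^ (Module.finrank ℝ Plane - 1))) (by fun_prop)).1 h4.ae_eq_mk
  filter_upwards [h5] with s hs
  have hs0 : (0 : ℝ) < s := s.2
  rw [hs (by simp; positivity)]
  exact (congrFun hg' s).symm

theorem ae_norm_of_ae {P : ℝ → Prop} (h : ∀ᵐ s ∂volume.restrict (Ioi (0 : ℝ)), P s) :
    ∀ᵐ x : Plane, P ‖x‖ := by
  obtain ⟨N, hN, hNm, hN0⟩ := exists_measurable_superset_of_null h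
  have : ∫⁻ x : Plane, N.indicator (fun _ => (1 : ℝ≥0∞)) ‖x‖ = 0 := by
    rw [lintegral_fun_norm (measurable_const.indicator hNm)]
    refine mul_eq_zero.2 (Or.inr ?_)
    rw [lintegral_eq_zero_iff (by fun_prop (disch := exact hNm))]
    have : ∀ᵐ s ∂volume.restrict (Ioi (0 : ℝ)), s ∉ N := by
      rw [ae_iff]; simpa using hN0
    filter_upwards [this] with s hs
    simp [hs]
  have hm : Measurable fun x : Plane => N.indicator (fun _ => (1 : ℝ≥0∞)) ‖x‖ :=
    (measurable_const.indicator hNm).comp measurable_norm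
  rw [lintegral_eq_zero_iff hm] at this
  filter_upwards [this] with x hx
  by_contra hP
  have : ‖x‖ ∈ N := hN hP
  simp [this] at hx

/-- For `x ≠ 0` the distance to the origin has a density along each circle about `x`, so a null set
of radii is missed for every such `x` and every `t`, with no exceptional set. At `x = 0` this fails,
as the circle then has only one radius. -/
theorem ae_circle_of_ae {P : ℝ → Prop} (h : ∀ᵐ s ∂volume.restrict (Ioi (0 : ℝ)), P s)
    {x : Plane} (hx : x ≠ 0) {t : ℝ} (ht : 0 < t) :
    ∀ᵐ φ ∂volume.restrict (Ioc 0 (2 * Real.pi)), P ‖x - t • circlePoint φ‖ := by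
  obtain ⟨N, hN, hNm, hN0⟩ := exists_measurable_superset_of_null h
  have hae : ∀ᵐ s ∂volume.restrict (Ioi (0 : ℝ)), s ∉ N := by
    rw [ae_iff]; simpa using hN0
  have : ∫⁻ φ in Ioc 0 (2 * Real.pi),
      N.indicator (fun _ => (1 : ℝ≥0∞)) ‖x - t • circlePoint φ‖ = 0 := by
    rw [lintegral_circle hx ht]
    refine mul_eq_zero.2 (Or.inr ?_)
    rw [radMean, ← nonpos_iff_eq_zero]
    refine (lintegral_mono_set (t := Ioi 0)
      (fun s hs => mem_Ioi.2 ((abs_nonneg _).trans_lt hs.1))).trans_eq ?_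
    rw [lintegral_congr_ae (g := fun _ => 0), lintegral_zero]
    filter_upwards [hae] with s hs
    simp [hs]
  have hm : Measurable fun φ => N.indicator (fun _ => (1 : ℝ≥0∞)) ‖x - t • circlePoint φ‖ :=
    (measurable_const.indicator hNm).comp
      (continuous_const.sub (continuous_circlePoint.const_smul t)).norm.measurable
  rw [lintegral_eq_zero_iff hm] at this
  filter_upwards [this] with φ hφ
  by_contra hP
  have : ‖x - t • circlePoint φ‖ ∈ N := hN hP
  simp [this] at hφ

/-! ### From profiles to functions on the plane -/

/-- The one-dimensional maximal inequality, for the exponents `p` and `q`. -/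
def ProfileBound (E : Set ℝ) (p q : ℝ) : Prop :=
  ∃ C : ℝ≥0∞, C ≠ ⊤ ∧ ∀ g : ℝ → ℝ≥0∞, Measurable g → ∃ D : ℝ → ℝ≥0∞, Measurable D ∧
    (∀ r, 0 < r → ∀ t ∈ E, ENNReal.ofReal r * radMean t g r ^ q ≤ D r) ∧
    ∫⁻ r, D r ≤ C * (∫⁻ s in Ioi 0, ENNReal.ofReal s * g s ^ p) ^ (q / p)

theorem eLpNorm_ofReal {α ε : Type*} [MeasurableSpace α] [ENorm ε] {μ : Measure α} {f : α → ε}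
    {p : ℝ} (hp : 0 < p) :
    eLpNorm f (ENNReal.ofReal p) μ = (∫⁻ x, ‖f x‖ₑ ^ p ∂μ) ^ (1 / p) := by
  rw [eLpNorm_eq_lintegral_rpow_enorm_toReal (by simpa using hp) ENNReal.ofReal_ne_top,
    ENNReal.toReal_ofReal hp.le]

/-- The maximal inequality in the plane, for the means of absolute values. -/
theorem ProfileBound.exists_majorant {E : Set ℝ} {p q : ℝ} (h : ProfileBound E p q) (hp : 0 < p)
    (hq : 0 < q) (hE : ∀ t ∈ E, 0 < t) :
    ∃ C : ℝ≥0∞, C ≠ ⊤ ∧ ∀ f : Plane → ℂ, IsRadial f → AEStronglyMeasurable f volume →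
      ∃ M : Plane → ℝ≥0∞, Measurable M ∧
        (∀ x, x ≠ 0 → ∀ t ∈ E,
          ∫⁻ φ in Ioc 0 (2 * Real.pi), ‖f (x - t • circlePoint φ)‖ₑ ≤ M x) ∧
        eLpNorm M (ENNReal.ofReal q) volume ≤ C * eLpNorm f (ENNReal.ofReal p) volume := by
  obtain ⟨C, hC, H⟩ := h
  have hmass := sphereMass_ne_top
  have hmass0 := sphereMass_ne_zero
  refine ⟨(sphereMass * 4 ^ q * C) ^ (1 / q) * (sphereMass⁻¹) ^ (1 / p), ?_, fun f hf hm => ?_⟩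
  · exact ENNReal.mul_ne_top (ENNReal.rpow_ne_top_of_nonneg (by positivity) (by finiteness))
      (ENNReal.rpow_ne_top_of_nonneg (by positivity) (ENNReal.inv_ne_top.2 hmass0))
  obtain ⟨g, hg, hfg⟩ := hf.exists_profile hm
  have hge : Measurable fun s => ‖g s‖ₑ := hg.enorm
  obtain ⟨D, hD, hD1, hD2⟩ := H (fun s => ‖g s‖ₑ) hge
  -- Solving `r * radMean ^ q ≤ D r` for the mean; the 4 comes from `lintegral_circle`.
  set M' : ℝ → ℝ≥0∞ := fun r => 4 * (D r / ENNReal.ofReal r) ^ (1 / q) with hM'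
  have hM'm : Measurable M' := by fun_prop
  refine ⟨fun x => M' ‖x‖, hM'm.comp measurable_norm, fun x hx t ht => ?_, ?_⟩
  · have hx0 : 0 < ‖x‖ := norm_pos_iff.2 hx
    have e : ∫⁻ φ in Ioc 0 (2 * Real.pi), ‖f (x - t • circlePoint φ)‖ₑ =
        ∫⁻ φ in Ioc 0 (2 * Real.pi), ‖g ‖x - t • circlePoint φ‖‖ₑ := by
      refine lintegral_congr_ae ?_
      filter_upwards [ae_circle_of_ae hfg hx (hE t ht)] with φ hφ
      rw [hf.eq_norm_smul, hφ]
    rw [e, lintegral_circle hx (hE t ht) fun s => ‖g s‖ₑ]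
    refine mul_le_mul' le_rfl ?_
    rw [← ENNReal.rpow_le_rpow_iff hq, ← ENNReal.rpow_mul, one_div_mul_cancel hq.ne',
      ENNReal.rpow_one, ENNReal.le_div_iff_mul_le (by simp [hx]) (by simp), mul_comm]
    exact hD1 _ hx0 t ht
  · set S := ∫⁻ s in Ioi 0, ENNReal.ofReal s * ‖g s‖ₑ ^ p with hS
    have hfS : ∫⁻ x, ‖f x‖ₑ ^ p = sphereMass * S := by
      rw [hS, ← lintegral_fun_norm (g := fun s => ‖g s‖ₑ ^ p) (by fun_prop)]
      refine lintegral_congr_ae ?_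
      filter_upwards [ae_norm_of_ae hfg] with x hx
      rw [hf.eq_norm_smul, hx]
    have hS' : S = sphereMass⁻¹ * ∫⁻ x, ‖f x‖ₑ ^ p := by
      rw [hfS, ← mul_assoc, ENNReal.inv_mul_cancel hmass0 hmass, one_mul]
    have hMq : ∫⁻ x : Plane, ‖M' ‖x‖‖ₑ ^ q ≤ sphereMass * 4 ^ q * C * S ^ (q / p) := by
      simp only [enorm_eq_self]
      rw [lintegral_fun_norm (g := fun r => M' r ^ q) (by fun_prop), mul_assoc, mul_assoc]
      refine mul_le_mul' le_rfl ?_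
      calc ∫⁻ r in Ioi 0, ENNReal.ofReal r * M' r ^ q
          ≤ ∫⁻ r in Ioi 0, 4 ^ q * D r := by
            refine setLIntegral_mono' measurableSet_Ioi fun r hr => ?_
            have hr0 : ENNReal.ofReal r ≠ 0 := by simpa using hr
            rw [hM']
            simp only
            rw [ENNReal.mul_rpow_of_nonneg _ _ hq.le, ← ENNReal.rpow_mul,
              one_div_mul_cancel hq.ne', ENNReal.rpow_one, mul_left_comm,
              ENNReal.mul_div_cancel hr0 ENNReal.ofReal_ne_top]
        _ ≤ 4 ^ q * ∫⁻ r, D r := by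
            rw [lintegral_const_mul _ hD]
            exact mul_le_mul' le_rfl (setLIntegral_le_lintegral _ _)
        _ ≤ _ := mul_le_mul' le_rfl hD2
    rw [eLpNorm_ofReal hq, eLpNorm_ofReal hp]
    calc (∫⁻ x : Plane, ‖M' ‖x‖‖ₑ ^ q) ^ (1 / q)
        ≤ (sphereMass * 4 ^ q * C * S ^ (q / p)) ^ (1 / q) :=
          ENNReal.rpow_le_rpow hMq (by positivity)
      _ = (sphereMass * 4 ^ q * C) ^ (1 / q) * S ^ (1 / p) := by
          rw [ENNReal.mul_rpow_of_nonneg _ _ (by positivity), ← ENNReal.rpow_mul]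
          congr 2; field_simp
      _ = _ := by
          rw [hS', ENNReal.mul_rpow_of_nonneg sphereMass⁻¹ _ (by positivity)]
          simp only [mul_assoc]

/-! ## Measurability of the maximal function -/

theorem continuous_circleMean {f : Plane → ℂ} (hf : Continuous f) (t : ℝ) :
    Continuous (circleMean t f) := by
  have := continuous_circlePoint
  refine continuous_const.mul
    (intervalIntegral.continuous_parametric_intervalIntegral_of_continuous' ?_ _ _)
  exact hf.comp (continuous_fst.sub ((this.comp continuous_snd).const_smul t))

/-- A supremum of continuous functions, even an uncountable one, is lower semicontinuous. -/
theorem measurable_circularMaximal {f : Plane → ℂ} (hf : Continuous f) (E : Set ℝ) :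
    Measurable (circularMaximal E f) :=
  (lowerSemicontinuous_biSup fun t _ =>
    (continuous_circleMean hf t).enorm.lowerSemicontinuous).measurable

theorem enorm_circleMean_le (f : Plane → ℂ) (t : ℝ) (x : Plane) :
    ‖circleMean t f x‖ₑ ≤ ∫⁻ φ in Ioc 0 (2 * Real.pi), ‖f (x - t • circlePoint φ)‖ₑ := by
  have hpi := Real.pi_gt_three
  rw [circleMean, enorm_mul, intervalIntegral.integral_of_le (by positivity)]
  calc _ ≤ 1 * ‖∫ φ in Ioc 0 (2 * Real.pi), f (x - t • circlePoint φ)‖ₑ := by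
        refine mul_le_mul' ?_ le_rfl
        rw [← ofReal_norm, Complex.norm_real, Real.norm_of_nonneg (by positivity),
          ENNReal.ofReal_le_one]
        exact inv_le_one_of_one_le₀ (by linarith)
    _ ≤ _ := by rw [one_mul]; exact enorm_integral_le_lintegral_enorm _

theorem circularMaximal_le_add {E : Set ℝ} {f g : Plane → ℂ} {x : Plane}
    (hf : ∀ t ∈ E, IntervalIntegrable (fun φ : ℝ => f (x - t • circlePoint φ)) volume 0
      (2 * Real.pi))
    (hg : ∀ t ∈ E, IntervalIntegrable (fun φ : ℝ => g (x - t • circlePoint φ)) volume 0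
      (2 * Real.pi)) {b : ℝ≥0∞}
    (hb : ∀ t ∈ E, ∫⁻ φ in Ioc 0 (2 * Real.pi), ‖(f - g) (x - t • circlePoint φ)‖ₑ ≤ b) :
    circularMaximal E f x ≤ circularMaximal E g x + b := by
  refine iSup₂_le fun t ht => ?_
  have e : circleMean t f x = circleMean t g x + circleMean t (f - g) x := by
    simp only [circleMean, Pi.sub_apply]
    rw [intervalIntegral.integral_sub (hf t ht) (hg t ht)]
    ring
  rw [e]
  refine (enorm_add_le _ _).trans (add_le_add ?_ ((enorm_circleMean_le _ _ _).trans (hb t ht)))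
  exact le_iSup₂ (f := fun t (_ : t ∈ E) => ‖circleMean t g x‖ₑ) t ht

/-- Radial functions in `L^p` are approximated by continuous radial functions. -/
theorem IsRadial.exists_continuous {f : Plane → ℂ} (hf : IsRadial f) {p : ℝ≥0∞} (hp : p ≠ ⊤)
    (hfp : MemLp f p volume) {ε : ℝ≥0∞} (hε : ε ≠ 0) :
    ∃ h : Plane → ℂ, IsRadial h ∧ Continuous h ∧ eLpNorm (f - h) p volume ≤ ε := by
  obtain ⟨g, hg, hfg⟩ := hf.exists_profile hfp.1
  have hae : f =ᵐ[volume] g ∘ norm := by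
    filter_upwards [ae_norm_of_ae hfg] with x hx
    rw [hf.eq_norm_smul, hx, Function.comp]
  -- Approximation is carried out on the line, for the image of the volume under the norm, so that
  -- the approximants stay radial.
  set ν : Measure ℝ := (volume : Measure Plane).map norm with hν
  have : IsFiniteMeasureOnCompacts ν := by
    refine ⟨fun K hK => ?_⟩
    obtain ⟨R, hR⟩ := hK.isBounded.subset_closedBall 0
    rw [hν, Measure.map_apply measurable_norm hK.measurableSet]
    refine (measure_mono (t := Metric.closedBall (0 : Plane) R) fun x hx => ?_).trans_lt
      measure_closedBall_lt_top
    have := hR hx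
    rw [mem_closedBall_zero_iff, norm_norm] at this
    exact mem_closedBall_zero_iff.2 this
  have hgν : MemLp g p ν := by
    rw [hν, memLp_map_measure_iff hg.aestronglyMeasurable measurable_norm.aemeasurable]
    exact hfp.ae_eq hae
  obtain ⟨h, -, hle, hc, -⟩ := hgν.exists_hasCompactSupport_eLpNorm_sub_le hp hε
  refine ⟨h ∘ norm, fun x y hxy => by simp [hxy], hc.comp continuous_norm, ?_⟩
  rw [hν, eLpNorm_map_measure (hg.aestronglyMeasurable.sub hc.aestronglyMeasurable)
    measurable_norm.aemeasurable] at hle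
  refine le_of_eq_of_le (eLpNorm_congr_ae ?_) hle
  filter_upwards [hae] with x hx
  simp [hx]

theorem IsRadial.aestronglyMeasurable_circle {f : Plane → ℂ} (hf : IsRadial f)
    (hm : AEStronglyMeasurable f volume) {x : Plane} (hx : x ≠ 0) {t : ℝ} (ht : 0 < t) :
    AEStronglyMeasurable (fun φ : ℝ => f (x - t • circlePoint φ))
      (volume.restrict (Ioc 0 (2 * Real.pi))) := by
  obtain ⟨g, hg, hfg⟩ := hf.exists_profile hm
  have h : Measurable fun φ => g ‖x - t • circlePoint φ‖ :=
    hg.comp (continuous_const.sub (continuous_circlePoint.const_smul t)).norm.measurable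
  refine h.aestronglyMeasurable.congr ?_
  filter_upwards [ae_circle_of_ae hfg hx ht] with φ hφ
  rw [hf.eq_norm_smul, hφ]

theorem ae_ne_zero : ∀ᵐ x : Plane, x ≠ 0 := by simp [ae_iff]

/-- The majorant gives the norm bound and, being finite a.e., absolute convergence for all `t ∈ E`
simultaneously. It also controls the error in replacing `f` by a continuous radial function, so the
maximal function is an a.e. limit of measurable ones. -/
theorem ProfileBound.isRadiallyBounded {E : Set ℝ} {p q : ℝ} (h : ProfileBound E p q) (hp : 0 < p)
    (hq : 0 < q) (hE : ∀ t ∈ E, 0 < t) :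
    IsRadiallyBounded E (ENNReal.ofReal p) (ENNReal.ofReal q) := by
  obtain ⟨C, hC, H⟩ := h.exists_majorant hp hq hE
  have hpi := Real.two_pi_pos
  refine ⟨C.toNNReal, fun f hf hfp => ?_⟩
  obtain ⟨M, hM, hM1, hM2⟩ := H f hf hfp.1
  have hMfin : ∀ᵐ x, M x < ⊤ := by
    have h1 : eLpNorm M (ENNReal.ofReal q) volume < ⊤ :=
      hM2.trans_lt (ENNReal.mul_lt_top hC.lt_top hfp.2)
    rw [eLpNorm_ofReal hq] at h1
    simp only [enorm_eq_self] at h1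
    have h2 : ∫⁻ x, M x ^ q ≠ ⊤ := by
      intro h; rw [h, ENNReal.top_rpow_of_pos (by positivity)] at h1; exact lt_irrefl _ h1
    filter_upwards [ae_lt_top (hM.pow_const q) h2] with x hx
    by_contra hx'
    rw [not_lt, top_le_iff] at hx'
    rw [hx', ENNReal.top_rpow_of_pos hq] at hx
    exact lt_irrefl _ hx
  have hint : ∀ᵐ x : Plane, ∀ t ∈ E,
      IntervalIntegrable (fun φ : ℝ => f (x - t • circlePoint φ)) volume 0 (2 * Real.pi) := by
    filter_upwards [hMfin, ae_ne_zero] with x hx hx0 t ht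
    rw [intervalIntegrable_iff_integrableOn_Ioc_of_le hpi.le]
    exact ⟨hf.aestronglyMeasurable_circle hfp.1 hx0 (hE t ht), (hM1 x hx0 t ht).trans_lt hx⟩
  refine ⟨hint, ?_, ?_⟩
  -- The rate makes the `q`-th powers of the error majorants summable in `L¹`, which forces
  -- convergence a.e. without passing to a subsequence; `C + 1` avoids division by zero.
  · set ε : ℕ → ℝ≥0∞ := fun n => (2⁻¹ : ℝ≥0∞) ^ ((n : ℝ) / q) / (C + 1) with hε
    have hε0 : ∀ n, ε n ≠ 0 := fun n => by
      rw [hε]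
      refine (ENNReal.div_pos ?_ (by finiteness)).ne'
      exact (ENNReal.rpow_pos (by simp) (by simp)).ne'
    choose F hF1 hF2 hF3 using fun n => hf.exists_continuous ENNReal.ofReal_ne_top hfp (hε0 n)
    have hsubrad : ∀ n, IsRadial (f - F n) := fun n x y hxy => by
      simp [hf x y hxy, hF1 n x y hxy]
    choose B hB hB1 hB2 using fun n => H (f - F n) (hsubrad n)
      (hfp.1.sub (hF2 n).aestronglyMeasurable)
    have hBq : ∀ n, ∫⁻ x, B n x ^ q ≤ 2⁻¹ ^ n := by
      intro n
      have h1 : eLpNorm (B n) (ENNReal.ofReal q) volume ≤ (2⁻¹ : ℝ≥0∞) ^ ((n : ℝ) / q) := by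
        refine (hB2 n).trans ((mul_le_mul' le_rfl (hF3 n)).trans ?_)
        rw [hε]
        calc C * ((2⁻¹ : ℝ≥0∞) ^ ((n : ℝ) / q) / (C + 1))
            ≤ (C + 1) * ((2⁻¹ : ℝ≥0∞) ^ ((n : ℝ) / q) / (C + 1)) :=
              mul_le_mul' le_self_add le_rfl
          _ = _ := ENNReal.mul_div_cancel (by simp) (by finiteness)
      rw [eLpNorm_ofReal hq] at h1
      simp only [enorm_eq_self] at h1
      have h2 := ENNReal.rpow_le_rpow h1 hq.le
      rwa [← ENNReal.rpow_mul, one_div_mul_cancel hq.ne', ENNReal.rpow_one, ← ENNReal.rpow_mul,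
        div_mul_cancel₀ _ hq.ne', ENNReal.rpow_natCast] at h2
    have hsum : ∀ᵐ x, ∑' n, B n x ^ q ≠ ⊤ := by
      have hfin : ∫⁻ x, ∑' n, B n x ^ q ≠ ⊤ := by
        rw [lintegral_tsum fun n => ((hB n).pow_const q).aemeasurable]
        refine ne_top_of_le_ne_top (b := 2) (by simp) ((ENNReal.tsum_le_tsum hBq).trans ?_)
        rw [ENNReal.tsum_geometric]
        simp
      filter_upwards [ae_lt_top (Measurable.tsum fun n => (hB n).pow_const q) hfin] with x hx
      exact hx.ne
    refine aemeasurable_of_tendsto_metrizable_ae' (f := fun n => circularMaximal E (F n))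
      (fun n => (measurable_circularMaximal (hF2 n) E).aemeasurable) ?_
    filter_upwards [hsum, hint, ae_ne_zero] with x hx hxi hx0
    have hB0 : Tendsto (fun n => B n x) atTop (𝓝 0) := by
      have h1 := ENNReal.tendsto_atTop_zero_of_tsum_ne_top hx
      have h2 := h1.ennrpow_const (1 / q)
      rw [ENNReal.zero_rpow_of_pos (by positivity)] at h2
      refine h2.congr fun n => ?_
      rw [← ENNReal.rpow_mul, mul_one_div_cancel hq.ne', ENNReal.rpow_one]
    have hFi : ∀ n, ∀ t ∈ E, IntervalIntegrable (fun φ : ℝ => F n (x - t • circlePoint φ))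
        volume 0 (2 * Real.pi) := fun n t _ =>
      ((hF2 n).comp (continuous_const.sub (continuous_circlePoint.const_smul t))).intervalIntegrable
        _ _
    have hle1 : ∀ n, circularMaximal E f x ≤ circularMaximal E (F n) x + B n x := fun n =>
      circularMaximal_le_add hxi (hFi n) fun t ht => hB1 n x hx0 t ht
    have hle2 : ∀ n, circularMaximal E (F n) x ≤ circularMaximal E f x + B n x := fun n =>
      circularMaximal_le_add (hFi n) hxi fun t ht => by
        refine le_of_eq_of_le ?_ (hB1 n x hx0 t ht)
        refine lintegral_congr fun φ => ?_
        rw [Pi.sub_apply, Pi.sub_apply, ← enorm_neg, neg_sub]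
    refine tendsto_of_tendsto_of_tendsto_of_le_of_le
      (g := fun n => circularMaximal E f x - B n x) (h := fun n => circularMaximal E f x + B n x)
      ?_ ?_ (fun n => tsub_le_iff_right.2 (hle1 n)) hle2
    · simpa using ENNReal.Tendsto.sub (tendsto_const_nhds (x := circularMaximal E f x)) hB0
        (Or.inr ENNReal.zero_ne_top)
    · simpa using (tendsto_const_nhds (x := circularMaximal E f x)).add hB0
  · rw [ENNReal.coe_toNNReal hC]
    refine le_trans (eLpNorm_mono_enorm_ae ?_) hM2
    filter_upwards [ae_ne_zero] with x hx0
    simp only [enorm_eq_self]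
    exact iSup₂_le fun t ht => (enorm_circleMean_le _ _ _).trans (hM1 x hx0 t ht)

/-! ### The exponent infinity -/

theorem IsRadial.ae_profile_enorm_le {f : Plane → ℂ} (hf : IsRadial f)
    (hm : AEStronglyMeasurable f volume) {K : ℝ≥0∞} (h : ∀ᵐ x, ‖f x‖ₑ ≤ K) :
    ∀ᵐ s ∂volume.restrict (Ioi (0 : ℝ)), ‖f (s • circlePoint 0)‖ₑ ≤ K := by
  obtain ⟨g, hg, hfg⟩ := hf.exists_profile hm
  have hN : MeasurableSet {s | K < ‖g s‖ₑ} := measurableSet_lt measurable_const hg.enorm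
  have h1 : ∫⁻ x : Plane, {s | K < ‖g s‖ₑ}.indicator (fun _ => (1 : ℝ≥0∞)) ‖x‖ = 0 := by
    have hmN : Measurable fun x : Plane => {s | K < ‖g s‖ₑ}.indicator (fun _ => (1 : ℝ≥0∞)) ‖x‖ :=
      (measurable_const.indicator hN).comp measurable_norm
    rw [lintegral_eq_zero_iff hmN]
    filter_upwards [h, ae_norm_of_ae hfg] with x hx hx'
    rw [hf.eq_norm_smul, hx'] at hx
    simp [hx]
  rw [lintegral_fun_norm (measurable_const.indicator hN)] at h1
  have h2 := (mul_eq_zero.1 h1).resolve_left sphereMass_ne_zero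
  rw [lintegral_eq_zero_iff (by fun_prop (disch := exact hN))] at h2
  filter_upwards [h2, hfg, ae_restrict_mem measurableSet_Ioi] with s hs hs' hs0
  rw [hs']
  by_contra hlt
  have h0 : ¬ s ≤ 0 := not_le.2 hs0
  simp [not_le.1 hlt, h0] at hs

/-- Boundedness on `L^∞` follows from boundedness for some finite exponent. -/
theorem IsRadiallyBounded.top {E : Set ℝ} (hE : E ⊆ Icc 1 2) {p q : ℝ≥0∞}
    (h : IsRadiallyBounded E p q) : IsRadiallyBounded E ⊤ ⊤ := by
  obtain ⟨C, H⟩ := h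
  have hpi := Real.two_pi_pos
  refine ⟨(2 * Real.pi).toNNReal, fun f hf hfp => ?_⟩
  have hE0 : ∀ t ∈ E, 0 < t := fun t ht => one_pos.trans_le (hE ht).1
  have hK : ∀ᵐ x, ‖f x‖ₑ ≤ eLpNorm f ⊤ volume := by
    rw [eLpNorm_exponent_top]; exact enorm_ae_le_eLpNormEssSup f _
  have hKs := hf.ae_profile_enorm_le hfp.1 hK
  have hmean : ∀ x : Plane, x ≠ 0 → ∀ t ∈ E,
      ∫⁻ φ in Ioc 0 (2 * Real.pi), ‖f (x - t • circlePoint φ)‖ₑ ≤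
        ENNReal.ofReal (2 * Real.pi) * eLpNorm f ⊤ volume := by
    intro x hx t ht
    have h1 : ∀ᵐ φ ∂volume.restrict (Ioc 0 (2 * Real.pi)),
        ‖f (x - t • circlePoint φ)‖ₑ ≤ eLpNorm f ⊤ volume := by
      filter_upwards [ae_circle_of_ae hKs hx (hE0 t ht)] with φ hφ
      rwa [hf.eq_norm_smul]
    refine (lintegral_mono_ae h1).trans_eq ?_
    rw [lintegral_const, Measure.restrict_apply_univ, Real.volume_Ioc, sub_zero, mul_comm]
  refine ⟨?_, ?_, ?_⟩
  · filter_upwards [ae_ne_zero] with x hx t ht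
    rw [intervalIntegrable_iff_integrableOn_Ioc_of_le hpi.le]
    exact ⟨hf.aestronglyMeasurable_circle hfp.1 hx (hE0 t ht),
      (hmean x hx t ht).trans_lt (ENNReal.mul_lt_top ENNReal.ofReal_lt_top hfp.2)⟩
  -- Measurability is local: for `‖x‖ < n` and `t ≤ 2` the circle stays in the ball of radius `n +
  -- 2`, and the truncation of `f` to that ball lies in `L^p`.
  · have hcover : ⋃ n : ℕ, Metric.ball (0 : Plane) n = univ := by
      refine eq_univ_of_forall fun x => ?_
      obtain ⟨n, hn⟩ := exists_nat_gt ‖x‖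
      exact mem_iUnion.2 ⟨n, mem_ball_zero_iff.2 hn⟩
    rw [← Measure.restrict_univ (μ := (volume : Measure Plane)), ← hcover, aemeasurable_iUnion_iff]
    intro n
    set B := Metric.ball (0 : Plane) (n + 2) with hB
    have hrad : IsRadial (B.indicator f) := by
      intro x y hxy
      have : x ∈ B ↔ y ∈ B := by rw [hB, mem_ball_zero_iff, mem_ball_zero_iff, hxy]
      by_cases hx : x ∈ B
      · rw [indicator_of_mem hx, indicator_of_mem (this.1 hx), hf x y hxy]
      · rw [indicator_of_notMem hx, indicator_of_notMem (mt this.2 hx)]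
    have hmem : MemLp (B.indicator f) p volume := by
      rw [memLp_indicator_iff_restrict Metric.isOpen_ball.measurableSet]
      have : IsFiniteMeasure (volume.restrict B) :=
        ⟨by rw [Measure.restrict_apply_univ]; exact measure_ball_lt_top⟩
      exact (hfp.restrict B).mono_exponent le_top
    refine ((H _ hrad hmem).2.1.mono_measure Measure.restrict_le_self).congr ?_
    filter_upwards [ae_restrict_mem Metric.isOpen_ball.measurableSet] with x hx
    refine iSup_congr fun t => iSup_congr fun ht => ?_
    have : ∀ φ, B.indicator f (x - t • circlePoint φ) = f (x - t • circlePoint φ) := fun φ => by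
      refine indicator_of_mem (mem_ball_zero_iff.2 ((norm_sub_le _ _).trans_lt ?_)) _
      rw [norm_smul, norm_circlePoint, mul_one, Real.norm_of_nonneg (hE0 t ht).le]
      exact add_lt_add_of_lt_of_le (mem_ball_zero_iff.1 hx) (hE ht).2
    simp only [circleMean, this]
  · rw [eLpNorm_exponent_top (f := circularMaximal E f)]
    refine essSup_le_of_ae_le _ ?_
    filter_upwards [ae_ne_zero] with x hx
    simp only [enorm_eq_self]
    exact iSup₂_le fun t ht => (enorm_circleMean_le _ _ _).trans (hmean x hx t ht)

/-! ### Covering numbers and volumes of neighbourhoods -/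

theorem exists_cover {F : Set ℝ} {x L δ : ℝ} (hF : F ⊆ Icc x (x + L)) (hδ : 0 < δ) :
    {n : ℕ | ∃ c : Fin n → ℝ, F ⊆ ⋃ i, Icc (c i) (c i + δ)}.Nonempty := by
  refine ⟨⌊L / δ⌋₊ + 1, fun i => x + (i : ℕ) * δ, fun y hy => ?_⟩
  have h0 : 0 ≤ (y - x) / δ := div_nonneg (by linarith [(hF hy).1]) hδ.le
  have hle : (y - x) / δ ≤ L / δ := by gcongr; linarith [(hF hy).2]
  refine mem_iUnion.2 ⟨⟨⌊(y - x) / δ⌋₊, Nat.lt_succ_of_le (Nat.floor_le_floor hle)⟩, ?_⟩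
  have ha := Nat.floor_le h0
  have hb := (Nat.lt_floor_add_one ((y - x) / δ)).le
  rw [le_div_iff₀ hδ] at ha
  rw [div_le_iff₀ hδ] at hb
  simp only [mem_Icc]
  constructor <;> linarith

theorem coverNum_mono {F G : Set ℝ} {x L δ : ℝ} (hFG : F ⊆ G) (hG : G ⊆ Icc x (x + L))
    (hδ : 0 < δ) : coverNum F δ ≤ coverNum G δ := by
  -- The infimum is attained because a finite cover exists; otherwise `sInf ∅ = 0` would make
  -- `coverNum` meaningless.
  obtain ⟨c, hc⟩ := Nat.sInf_mem (exists_cover hG hδ)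
  exact Nat.sInf_le ⟨c, hFG.trans hc⟩

theorem volume_thickening_le {F : Set ℝ} {x L δ : ℝ} (hF : F ⊆ Icc x (x + L)) (hδ : 0 < δ) :
    volume (Metric.thickening δ F) ≤ ENNReal.ofReal (coverNum F δ * (3 * δ)) := by
  obtain ⟨c, hc⟩ : ∃ c : Fin (coverNum F δ) → ℝ, F ⊆ ⋃ i, Icc (c i) (c i + δ) :=
    Nat.sInf_mem (exists_cover hF hδ)
  have hlen : ∀ i, c i + 2 * δ - (c i - δ) = 3 * δ := fun i => by ring
  have hsub : Metric.thickening δ F ⊆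
      ⋃ i : Fin (coverNum F δ), Icc (c i - δ) (c i + 2 * δ) := by
    intro y hy
    obtain ⟨z, hz, hyz⟩ := Metric.mem_thickening_iff.1 hy
    obtain ⟨i, hi⟩ := mem_iUnion.1 (hc hz)
    rw [Real.dist_eq, abs_lt] at hyz
    exact mem_iUnion.2 ⟨i, by linarith [hi.1], by linarith [hi.2]⟩
  refine (measure_mono hsub).trans ((measure_iUnion_fintype_le _ _).trans ?_)
  simp only [Real.volume_Icc, hlen]
  rw [Finset.sum_const, Finset.card_univ, Fintype.card_fin, nsmul_eq_mul,
    ENNReal.ofReal_mul (Nat.cast_nonneg _), ENNReal.ofReal_natCast]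

/-- Points of `E` that matter for the interval lie within `δ` of it, so the interval is enlarged by
`δ` on either side. -/
theorem volume_thickening_inter_le (E : Set ℝ) {x ρ δ : ℝ} (hδ : 0 < δ) :
    volume (Metric.thickening δ E ∩ Icc x (x + ρ)) ≤
      ENNReal.ofReal (coverNum (E ∩ Icc (x - δ) (x - δ + (ρ + 2 * δ))) δ * (3 * δ)) := by
  refine (measure_mono ?_).trans (volume_thickening_le inter_subset_right hδ)
  rintro y ⟨hy, hyx⟩
  obtain ⟨z, hz, hyz⟩ := Metric.mem_thickening_iff.1 hy
  refine Metric.mem_thickening_iff.2 ⟨z, ⟨hz, ?_⟩, hyz⟩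
  rw [Real.dist_eq, abs_lt] at hyz
  exact ⟨by linarith [hyx.1], by linarith [hyx.2]⟩

/-! ## Covering bounds from the dimensions -/

theorem one_mem_minkowski {E : Set ℝ} (hE : E ⊆ Icc 1 2) :
    (1 : ℝ) ∈ {a : ℝ | 0 < a ∧ ∃ c : ℝ, 0 < c ∧ ∀ δ ∈ Ioo (0 : ℝ) 1,
      (coverNum E δ : ℝ) ≤ c * δ ^ (-a)} := by
  refine ⟨one_pos, 2, two_pos, fun δ hδ => ?_⟩
  have h := coverNum_inter_Icc_le E 1 hδ.1 hδ.2.le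
  rwa [div_one, one_add_one_eq_two, inter_eq_left.2 hE] at h

theorem minkowskiDim_nonneg (E : Set ℝ) : 0 ≤ minkowskiDim E :=
  Real.sInf_nonneg fun _ h => h.1.le

theorem minkowskiDim_le_one {E : Set ℝ} (hE : E ⊆ Icc 1 2) : minkowskiDim E ≤ 1 :=
  csInf_le ⟨0, fun _ h => h.1.le⟩ (one_mem_minkowski hE)

theorem exists_coverNum_le_of_minkowskiDim_lt {E : Set ℝ} (hE : E ⊆ Icc 1 2) {b : ℝ}
    (hb : minkowskiDim E < b) :
    ∃ c : ℝ, 0 < c ∧ ∀ δ ∈ Ioo (0 : ℝ) 1, (coverNum E δ : ℝ) ≤ c * δ ^ (-b) := by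
  obtain ⟨a, ⟨-, c, hc, H⟩, hab⟩ := exists_lt_of_csInf_lt ⟨1, one_mem_minkowski hE⟩ hb
  refine ⟨c, hc, fun δ hδ => (H δ hδ).trans ?_⟩
  exact mul_le_mul_of_nonneg_left
    (Real.rpow_le_rpow_of_exponent_ge hδ.1 hδ.2.le (by linarith)) hc.le

theorem one_mem_spectrum (E : Set ℝ) {θ : ℝ} (hθ : θ ≤ 1) :
    (1 : ℝ) ∈ {a : ℝ | 0 < a ∧ ∃ c : ℝ, 0 < c ∧ ∀ x L δ : ℝ, δ ∈ Ioo (0 : ℝ) 1 → δ ^ θ ≤ L →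
      (coverNum (E ∩ Icc x (x + L)) δ : ℝ) ≤ c * (δ / L) ^ (-a)} := by
  refine ⟨one_pos, 2, two_pos, fun x L δ hδ hL => ?_⟩
  refine coverNum_inter_Icc_le E x hδ.1 (le_trans ?_ hL)
  simpa using Real.rpow_le_rpow_of_exponent_ge hδ.1 hδ.2.le hθ

theorem quasiAssouadDim_nonneg (E : Set ℝ) : 0 ≤ quasiAssouadDim E :=
  ge_of_tendsto' (tendsto_upperAssouadSpectrum E) fun _ => Real.sInf_nonneg fun _ h => h.1.le

theorem quasiAssouadDim_le_one (E : Set ℝ) : quasiAssouadDim E ≤ 1 := by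
  refine le_of_tendsto (tendsto_upperAssouadSpectrum E) ?_
  filter_upwards [self_mem_nhdsWithin] with θ hθ
  exact csInf_le ⟨0, fun _ h => h.1.le⟩ (one_mem_spectrum E (le_of_lt hθ))

theorem one_mem_assouad (E : Set ℝ) :
    (1 : ℝ) ∈ {a : ℝ | 0 < a ∧ ∃ c : ℝ, 0 < c ∧ ∀ x L δ : ℝ, 0 < δ → δ < L →
      (coverNum (E ∩ Icc x (x + L)) δ : ℝ) ≤ c * (δ / L) ^ (-a)} :=
  ⟨one_pos, 2, two_pos, fun x _ _ hδ hL => coverNum_inter_Icc_le E x hδ hL.le⟩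

theorem quasiAssouadDim_le_assouadDim (E : Set ℝ) : quasiAssouadDim E ≤ assouadDim E := by
  refine le_of_tendsto (tendsto_upperAssouadSpectrum E) ?_
  filter_upwards [self_mem_nhdsWithin] with θ hθ
  refine csInf_le_csInf ⟨0, fun _ h => h.1.le⟩ ⟨1, one_mem_assouad E⟩ ?_
  rintro a ⟨ha, c, hc, H⟩
  refine ⟨ha, c, hc, fun x L δ hδ hL => H x L δ hδ.1 (lt_of_lt_of_le ?_ hL)⟩
  simpa using Real.rpow_lt_rpow_of_exponent_gt hδ.1 hδ.2 hθ

theorem exists_coverNum_le_of_assouadDim_lt {E : Set ℝ} {b : ℝ} (hb : assouadDim E < b) :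
    ∃ c : ℝ, 0 < c ∧ ∀ x L δ : ℝ, 0 < δ → δ < L →
      (coverNum (E ∩ Icc x (x + L)) δ : ℝ) ≤ c * (δ / L) ^ (-b) := by
  obtain ⟨a, ⟨-, c, hc, H⟩, hab⟩ := exists_lt_of_csInf_lt ⟨1, one_mem_assouad E⟩ hb
  refine ⟨c, hc, fun x L δ hδ hL => (H x L δ hδ hL).trans ?_⟩
  have hL0 := hδ.trans hL
  exact mul_le_mul_of_nonneg_left (Real.rpow_le_rpow_of_exponent_ge (by positivity)
    ((div_le_one hL0).2 hL.le) (by linarith)) hc.le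

/-- As the dimension is a limit for `θ ↗ 1`, the bound holds for some `θ'` above the given `θ`; it
then covers all longer intervals as well. -/
theorem exists_coverNum_le_of_quasiAssouadDim_lt {E : Set ℝ} {b θ : ℝ}
    (hb : quasiAssouadDim E < b) (hθ : θ < 1) :
    ∃ c : ℝ, 0 < c ∧ ∀ x L δ : ℝ, δ ∈ Ioo (0 : ℝ) 1 → δ ^ θ ≤ L →
      (coverNum (E ∩ Icc x (x + L)) δ : ℝ) ≤ c * (δ / L) ^ (-b) := by
  obtain ⟨θ', hlt, hθθ', hθ'⟩ := ((tendsto_upperAssouadSpectrum E).eventually_lt_const hb |>.and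
    (Ioo_mem_nhdsLT hθ)).exists
  obtain ⟨a, ⟨-, c, hc, H⟩, hab⟩ :=
    exists_lt_of_csInf_lt ⟨1, one_mem_spectrum E hθ'.le⟩ hlt
  refine ⟨c, hc, fun x L δ hδ hL => ?_⟩
  have h1 : δ ^ θ' ≤ L :=
    (Real.rpow_le_rpow_of_exponent_ge hδ.1 hδ.2.le hθθ'.le).trans hL
  have h2 : δ ≤ L := by
    refine le_trans ?_ h1
    simpa using Real.rpow_le_rpow_of_exponent_ge hδ.1 hδ.2.le hθ'.le
  have hδ0 := hδ.1
  have hL0 := hδ0.trans_le h2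
  refine (H x L δ hδ h1).trans ?_
  exact mul_le_mul_of_nonneg_left (Real.rpow_le_rpow_of_exponent_ge (by positivity)
    ((div_le_one hL0).2 h2) (by linarith)) hc.le

/-! ## Volumes of neighbourhoods -/

theorem mul_three_mul_rpow {c δ b : ℝ} (hδ : 0 < δ) (s : ℝ) :
    c * (s * δ ^ (-b)) * (3 * δ) = 3 * c * (s * δ ^ (1 - b)) := by
  rw [sub_eq_add_neg, Real.rpow_add hδ, Real.rpow_one]; ring

theorem thickeningBound_of_minkowskiDim_lt {E : Set ℝ} (hE : E ⊆ Icc 1 2) {b : ℝ}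
    (hb : minkowskiDim E < b) : ThickeningBound E (1 - b) := by
  obtain ⟨c, hc, H⟩ := exists_coverNum_le_of_minkowskiDim_lt hE hb
  have hE' : E ⊆ Icc 1 (1 + 1) := by rwa [one_add_one_eq_two]
  refine ⟨ENNReal.ofReal (3 * c + 9 * 4 ^ |1 - b|), ENNReal.ofReal_ne_top, fun δ hδ hδ4 => ?_⟩
  have h4 : (0 : ℝ) < 4 ^ |1 - b| := by positivity
  have hδb : 0 < δ ^ (1 - b) := by positivity
  rw [← ENNReal.ofReal_mul (by positivity)]
  rcases lt_or_ge δ 1 with h1 | h1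
  · refine (volume_thickening_le hE' hδ).trans (ENNReal.ofReal_le_ofReal ?_)
    calc (coverNum E δ : ℝ) * (3 * δ) ≤ c * (1 * δ ^ (-b)) * (3 * δ) := by
          rw [one_mul]; gcongr; exact H δ ⟨hδ, h1⟩
      _ = 3 * c * δ ^ (1 - b) := by rw [mul_three_mul_rpow hδ, one_mul]
      _ ≤ _ := by gcongr; linarith
  -- Covering numbers are controlled for `δ < 1` only. For `1 ≤ δ ≤ 4` the neighbourhood has length
  -- at most 9, and `4 ^ |1 - b|` absorbs the power of `δ`.
  · have hsub : Metric.thickening δ E ⊆ Icc (-3) 6 := by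
      intro y hy
      obtain ⟨z, hz, hyz⟩ := Metric.mem_thickening_iff.1 hy
      rw [Real.dist_eq, abs_lt] at hyz
      exact ⟨by linarith [(hE hz).1], by linarith [(hE hz).2]⟩
    refine (measure_mono hsub).trans ?_
    rw [Real.volume_Icc]
    refine ENNReal.ofReal_le_ofReal ?_
    have h2 : (4 : ℝ) ^ (-|1 - b|) ≤ δ ^ (1 - b) :=
      (Real.rpow_le_rpow_of_nonpos hδ hδ4 (by simp)).trans
        (Real.rpow_le_rpow_of_exponent_le h1 (neg_abs_le _))
    rw [Real.rpow_neg (by norm_num)] at h2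
    have h3 : 1 ≤ 4 ^ |1 - b| * δ ^ (1 - b) := by
      calc (1 : ℝ) = 4 ^ |1 - b| * (4 ^ |1 - b|)⁻¹ := (mul_inv_cancel₀ h4.ne').symm
        _ ≤ _ := by gcongr
    nlinarith [mul_pos hc hδb]

theorem nbhdBound_of_assouadDim_lt {E : Set ℝ} {a : ℝ} (ha0 : 0 ≤ a) (ha : assouadDim E < a) :
    NbhdBound E a (1 - a) := by
  obtain ⟨c, hc, H⟩ := exists_coverNum_le_of_assouadDim_lt ha
  refine ⟨ENNReal.ofReal (3 * (c * 5 ^ a)), ENNReal.ofReal_ne_top, fun ρ δ x hρ hρ4 hδ hδρ => ?_⟩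
  rw [← ENNReal.ofReal_mul (by positivity)]
  refine (volume_thickening_inter_le E hδ).trans (ENNReal.ofReal_le_ofReal ?_)
  rw [← mul_three_mul_rpow hδ]
  gcongr
  refine (H _ _ δ hδ (by linarith)).trans ?_
  have h1 : (δ / (ρ + 2 * δ)) ^ (-a) ≤ (5 * ρ / δ) ^ a := by
    rw [Real.rpow_neg (by positivity), ← Real.inv_rpow (by positivity), inv_div]
    gcongr
    linarith
  calc c * (δ / (ρ + 2 * δ)) ^ (-a) ≤ c * (5 * ρ / δ) ^ a := by gcongr
    _ = _ := by
      rw [Real.div_rpow (by positivity) hδ.le, Real.mul_rpow (by norm_num) hρ.le,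
        Real.rpow_neg hδ.le]
      ring

/-- Intervals longer than `δ ^ (1 - ε)` are governed by the upper Assouad spectrum. Shorter ones
need only about `δ ^ (-ε)` intervals by the trivial count, so an arbitrarily small loss removes the
length restriction. -/
theorem exists_coverNum_le_quasiAssouadDim (E : Set ℝ) {ε : ℝ} (hε : 0 < ε) :
    ∃ C : ℝ, 0 < C ∧ ∀ ρ δ x : ℝ, 0 < ρ → ρ ≤ 1 / 4 → 0 < δ → δ ≤ 2 * ρ →
      (coverNum (E ∩ Icc x (x + (ρ + 2 * δ))) δ : ℝ) ≤
        C * (ρ ^ quasiAssouadDim E * δ ^ (-(quasiAssouadDim E + ε))) := by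
  have hγ := quasiAssouadDim_nonneg E
  set γ := quasiAssouadDim E with hγdef
  obtain ⟨c, hc, H⟩ := exists_coverNum_le_of_quasiAssouadDim_lt (E := E) (b := γ + ε)
    (θ := 1 - ε) (by linarith) (by linarith)
  refine ⟨c * 5 ^ (γ + ε) + 2 * 2 ^ γ, by positivity, fun ρ δ x hρ hρ4 hδ hδρ => ?_⟩
  have hprod : 0 < ρ ^ γ * δ ^ (-(γ + ε)) := by positivity
  rw [add_mul]
  rcases le_or_gt (δ ^ (1 - ε)) (ρ + 2 * δ) with hL | hL
  · refine le_trans ?_ (le_add_of_nonneg_right (by positivity))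
    refine (H x _ δ ⟨hδ, by linarith⟩ hL).trans ?_
    have h1 : (δ / (ρ + 2 * δ)) ^ (-(γ + ε)) ≤ (5 * ρ / δ) ^ (γ + ε) := by
      rw [Real.rpow_neg (by positivity), ← Real.inv_rpow (by positivity), inv_div]
      gcongr
      linarith
    calc c * (δ / (ρ + 2 * δ)) ^ (-(γ + ε)) ≤ c * (5 * ρ / δ) ^ (γ + ε) := by gcongr
      _ = c * 5 ^ (γ + ε) * (ρ ^ (γ + ε) * δ ^ (-(γ + ε))) := by
        rw [Real.div_rpow (by positivity) hδ.le, Real.mul_rpow (by norm_num) hρ.le,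
          Real.rpow_neg hδ.le]
        ring
      _ ≤ _ := by
        gcongr c * 5 ^ (γ + ε) * (?_ * _)
        exact Real.rpow_le_rpow_of_exponent_ge hρ (by linarith) (by linarith)
  · refine le_trans ?_ (le_add_of_nonneg_left (by positivity))
    refine (coverNum_inter_Icc_le E x hδ (by linarith)).trans ?_
    rw [Real.rpow_neg_one, inv_div, mul_assoc]
    gcongr
    calc (ρ + 2 * δ) / δ ≤ δ ^ (1 - ε) / δ := by gcongr
      _ = 1 * δ ^ (-ε) := by
        rw [one_mul, sub_eq_add_neg, Real.rpow_add hδ, Real.rpow_one]; field_simp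
      _ ≤ (2 * ρ / δ) ^ γ * δ ^ (-ε) := by
        gcongr
        exact Real.one_le_rpow ((one_le_div hδ).2 hδρ) hγ
      _ = _ := by
        rw [Real.div_rpow (by positivity) hδ.le, Real.mul_rpow (by norm_num) hρ.le, neg_add,
          Real.rpow_add hδ, Real.rpow_neg hδ.le γ]
        ring

theorem le_rpow_mul_rpow {n A B l : ℝ} (hn : 0 ≤ n) (hA : n ≤ A) (hB : n ≤ B) (h0 : 0 ≤ l)
    (h1 : l ≤ 1) : n ≤ A ^ l * B ^ (1 - l) := by
  have hB0 := hn.trans hB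
  have hA0 := hn.trans hA
  rcases hn.eq_or_lt with rfl | hn
  · positivity
  calc n = n ^ l * n ^ (1 - l) := by rw [← Real.rpow_add hn]; simp
    _ ≤ _ := by
      gcongr

/-- Interpolation between the covering bounds at scale one and at small scales. -/
theorem nbhdBound_interpolated {E : Set ℝ} (hE : E ⊆ Icc 1 2) {ε l : ℝ} (hε : 0 < ε)
    (h0 : 0 ≤ l) (h1 : l ≤ 1) :
    NbhdBound E ((1 - l) * quasiAssouadDim E)
      (1 - (l * minkowskiDim E + (1 - l) * quasiAssouadDim E + ε)) := by
  set β := minkowskiDim E with hβ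
  set γ := quasiAssouadDim E with hγ
  have hE' : E ⊆ Icc 1 (1 + 1) := by rwa [one_add_one_eq_two]
  obtain ⟨c, hc, H⟩ := exists_coverNum_le_of_minkowskiDim_lt hE (b := β + ε) (by linarith)
  obtain ⟨C, hC, H'⟩ := exists_coverNum_le_quasiAssouadDim E hε
  refine ⟨ENNReal.ofReal (3 * (c ^ l * C ^ (1 - l))), ENNReal.ofReal_ne_top,
    fun ρ δ x hρ hρ4 hδ hδρ => ?_⟩
  rw [← ENNReal.ofReal_mul (by positivity)]
  refine (volume_thickening_inter_le E hδ).trans (ENNReal.ofReal_le_ofReal ?_)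
  rw [← mul_three_mul_rpow hδ]
  gcongr
  have hA := (Nat.cast_le (α := ℝ)).2 (coverNum_mono (inter_subset_left
    (t := Icc (x - δ) (x - δ + (ρ + 2 * δ)))) hE' hδ)
  refine (le_rpow_mul_rpow (Nat.cast_nonneg _) (hA.trans (H δ ⟨hδ, by linarith⟩))
    (H' ρ δ _ hρ hρ4 hδ hδρ) h0 h1).trans_eq ?_
  rw [Real.mul_rpow hc.le (by positivity), Real.mul_rpow hC.le (by positivity),
    Real.mul_rpow (by positivity) (by positivity), ← Real.rpow_mul hδ.le, ← Real.rpow_mul hρ.le,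
    ← Real.rpow_mul hδ.le, mul_comm (1 - l) γ]
  have : -(l * β + γ * (1 - l) + ε) = -(β + ε) * l + -(γ + ε) * (1 - l) := by ring
  rw [this, Real.rpow_add hδ]
  ring

/-! ### From volume bounds to exponents, with `x = 1 / p` and `y = 1 / q` -/

theorem mem_radialTypeSet_of_smallRadiusBound {E : Set ℝ} (hE : E ⊆ Icc 1 2) {x y : ℝ}
    (hy : 0 < y) (hyx : y ≤ x) (h : 2 * x < 1 + (1 - minkowskiDim E) * y)
    (hS : SmallRadiusBound E (1 / x) (1 / y)) : (x, y) ∈ radialTypeSet E := by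
  have hβ0 := minkowskiDim_nonneg E
  have hβ1 := minkowskiDim_le_one hE
  set β := minkowskiDim E with hβ
  have hx : 0 < x := hy.trans_le hyx
  have hx1 : x ≤ 1 := by nlinarith [mul_le_mul_of_nonneg_left hyx (sub_nonneg.2 hβ1)]
  set d := 1 + (1 - β) * y - 2 * x with hd
  have hd0 : 0 < d := by linarith
  -- The slack `d` of the strict inequality pays for exceeding the Minkowski dimension by `ε`.
  set ε := d / (4 * y) with hε
  have hε0 : 0 < ε := by positivity
  have hεy : ε * y = d / 4 := by rw [hε]; field_simp
  have hprofile : ProfileBound E (1 / x) (1 / y) := by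
    refine exists_radial_majorant hE ((one_le_div hx).2 hx1) (one_div_le_one_div_of_le hy hyx)
      (thickeningBound_of_minkowskiDim_lt hE (b := β + ε) (by linarith)) ?_ ?_ hS
    · have e : 1 / y / 2 - 1 / y / (1 / x) + (1 - (β + ε)) =
          (1 / 2 - x + (1 - β) * y - ε * y) / y := by field_simp; ring
      rw [e]
      refine div_pos ?_ hy
      rw [hεy]
      nlinarith [mul_nonneg (sub_nonneg.2 hβ1) hy.le]
    · have e : 1 / y - 2 * (1 / y) / (1 / x) + (1 - (β + ε)) =
          (1 - 2 * x + (1 - β) * y - ε * y) / y := by field_simp; ring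
      rw [e]
      refine div_pos ?_ hy
      rw [hεy]
      linarith
  refine ⟨⟨hx.le, hx1⟩, ⟨hy.le, hyx.trans hx1⟩, ?_⟩
  have := hprofile.isRadiallyBounded (by positivity) (by positivity)
    fun t ht => one_pos.trans_le (hE ht).1
  simpa only [one_div, ENNReal.ofReal_inv_of_pos hx, ENNReal.ofReal_inv_of_pos hy] using this

/-- The interpolation weight is `l / y`. Written in terms of `l`, the two conditions for small radii
become linear in `(x, y, l)`, which yields the convexity used below. -/
theorem mem_radialTypeSet_of_lt {E : Set ℝ} (hE : E ⊆ Icc 1 2) {x y l : ℝ} (hy : 0 < y)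
    (hyx : y ≤ x) (hl0 : 0 ≤ l) (hly : l ≤ y) (h₁ : 2 * x < 1 + (1 - minkowskiDim E) * y)
    (h₂ : minkowskiDim E * l < 2 * y - x)
    (h₃ : x < 1 / 2 + (1 - quasiAssouadDim E) * y + (quasiAssouadDim E - minkowskiDim E) * l) :
    (x, y) ∈ radialTypeSet E := by
  have hβ0 := minkowskiDim_nonneg E
  have hβ1 := minkowskiDim_le_one hE
  refine mem_radialTypeSet_of_smallRadiusBound hE hy hyx h₁ ?_
  have hx : 0 < x := hy.trans_le hyx
  have hx1 : x ≤ 1 := by nlinarith [mul_le_mul_of_nonneg_left hyx (sub_nonneg.2 hβ1)]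
  set β := minkowskiDim E with hβ
  set γ := quasiAssouadDim E with hγ
  set d := min (2 * y - x - β * l) (1 / 2 + (1 - γ) * y + (γ - β) * l - x) with hd
  have hd0 : 0 < d := lt_min (by linarith) (by linarith)
  have hd1 : d ≤ 2 * y - x - β * l := min_le_left _ _
  have hd2 : d ≤ 1 / 2 + (1 - γ) * y + (γ - β) * l - x := min_le_right _ _
  set ε := d / (2 * y) with hε
  have hε0 : 0 < ε := by positivity
  have hεy : ε * y = d / 2 := by rw [hε]; field_simp
  refine (nbhdBound_interpolated hE hε0 (l := l / y) (by positivity)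
    ((div_le_one hy).2 hly)).smallRadiusBound ((one_le_div hx).2 hx1)
    (one_div_le_one_div_of_le hy hyx) ?_ ?_
  · have e : 1 / y / 2 - 1 / y / (1 / x) + (1 - (l / y * β + (1 - l / y) * γ + ε)) =
        (1 / 2 - x + (1 - γ) * y + (γ - β) * l - ε * y) / y := by field_simp; ring
    rw [← hβ, ← hγ, e]
    refine div_pos ?_ hy
    rw [hεy]
    linarith
  · have e : 1 - 1 / y / (1 / x) + (1 - (l / y * β + (1 - l / y) * γ + ε)) + (1 - l / y) * γ =
        (2 * y - x - β * l - ε * y) / y := by field_simp; ring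
    rw [← hβ, ← hγ, e]
    refine div_pos ?_ hy
    rw [hεy]
    linarith

/-! ## The region of exponents -/

/-- The exponents that satisfy the non-strict versions of the conditions of
`mem_radialTypeSet_of_lt`. -/
def exponentRegion (β γ : ℝ) : Set (ℝ × ℝ) :=
  {u | 0 ≤ u.2 ∧ u.2 ≤ u.1 ∧ 2 * u.1 ≤ 1 + (1 - β) * u.2 ∧ ∃ l, 0 ≤ l ∧ l ≤ u.2 ∧
    β * l ≤ 2 * u.2 - u.1 ∧ u.1 ≤ 1 / 2 + (1 - γ) * u.2 + (γ - β) * l}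

/-- The region is the projection along `l` of a polyhedron. -/
theorem convex_exponentRegion (β γ : ℝ) : Convex ℝ (exponentRegion β γ) := by
  rintro ⟨x, y⟩ ⟨h1, h2, h3, l, h4, h5, h6, h7⟩ ⟨x', y'⟩ ⟨h1', h2', h3', l', h4', h5', h6', h7'⟩
    a b ha hb hab
  simp only at h1 h2 h3 h4 h5 h6 h7 h1' h2' h3' h4' h5' h6' h7'
  obtain rfl : b = 1 - a := by linarith
  simp only [exponentRegion, Prod.smul_mk, Prod.mk_add_mk, smul_eq_mul, mem_ofPred_eq]
  refine ⟨by positivity, ?_, ?_, a * l + (1 - a) * l', by positivity, ?_, ?_, ?_⟩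
  · linarith [mul_le_mul_of_nonneg_left h2 ha, mul_le_mul_of_nonneg_left h2' hb]
  · linarith [mul_le_mul_of_nonneg_left h3 ha, mul_le_mul_of_nonneg_left h3' hb]
  · linarith [mul_le_mul_of_nonneg_left h5 ha, mul_le_mul_of_nonneg_left h5' hb]
  · linarith [mul_le_mul_of_nonneg_left h6 ha, mul_le_mul_of_nonneg_left h6' hb]
  · linarith [mul_le_mul_of_nonneg_left h7 ha, mul_le_mul_of_nonneg_left h7' hb]

/-- A non-strict condition at a point slightly to the right is strict at the point itself, with the
same `l`; a point slightly below gives `y > 0`. -/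
theorem interior_exponentRegion_subset {E : Set ℝ} (hE : E ⊆ Icc 1 2) :
    interior (exponentRegion (minkowskiDim E) (quasiAssouadDim E)) ⊆ radialTypeSet E := by
  rintro ⟨x, y⟩ hu
  obtain ⟨η, hη, hball⟩ := Metric.isOpen_iff.1 isOpen_interior _ hu
  have hright : (x + η / 2, y) ∈ Metric.ball (x, y) η := by
    rw [Metric.mem_ball, Prod.dist_eq]
    simp [abs_of_pos hη, hη]
  have hdown : (x, y - η / 2) ∈ Metric.ball (x, y) η := by
    rw [Metric.mem_ball, Prod.dist_eq]
    simp [abs_of_pos hη, hη]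
  obtain ⟨-, -, h3, l, h4, h5, h6, h7⟩ := interior_subset (hball hright)
  have hy := (interior_subset (hball hdown)).1
  have hyx := (interior_subset hu).2.1
  simp only at h3 h4 h5 h6 h7 hy hyx
  exact mem_radialTypeSet_of_lt hE (by linarith) hyx h4 h5 (by linarith) (by linarith)
    (by linarith)

theorem zero_mem_exponentRegion (β γ : ℝ) : (0 : ℝ × ℝ) ∈ exponentRegion β γ :=
  ⟨by simp, by simp, by simp, 0, by simp⟩

theorem Q1_mem_exponentRegion {β : ℝ} (γ : ℝ) (h0 : 0 ≤ β) (h1 : β ≤ 1) :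
    Q1 β ∈ exponentRegion β γ := by
  have hx : 0 < 1 / (1 + β) := by positivity
  have e : 1 / (1 + β) * (1 + β) = 1 := by field_simp
  simp only [exponentRegion, Q1, mem_ofPred_eq]
  set x := 1 / (1 + β)
  refine ⟨hx.le, le_rfl, by linarith, x, hx.le, le_rfl, by nlinarith, by nlinarith⟩

/-- The witness `l = 0` uses only the quasi-Assouad bound; at `Q₁` the opposite extreme `l = y` uses
only the Minkowski bound. -/
theorem Q2_mem_exponentRegion {β γ δ : ℝ} (h0 : -1 ≤ δ) (h1 : β ≤ δ) (h2 : 2 * γ ≤ 1 + δ) :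
    Q2 δ ∈ exponentRegion β γ := by
  have h3 : 0 < 3 + δ := by linarith
  have hy : 0 < 1 / (3 + δ) := by positivity
  have e : 1 / (3 + δ) * (3 + δ) = 1 := by field_simp
  have e' : 2 / (3 + δ) = 2 * (1 / (3 + δ)) := by ring
  simp only [exponentRegion, Q2, mem_ofPred_eq, e']
  set y := 1 / (3 + δ)
  exact ⟨hy.le, by linarith, by nlinarith, 0, le_rfl, hy.le, by linarith, by nlinarith⟩

theorem theta_spec {β γ : ℝ} (h1 : β ≤ 1) (h2 : β + 1 ≤ 2 * γ) (h3 : γ ≤ 1) :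
    0 ≤ theta β γ ∧ theta β γ ≤ 1 ∧ 2 * (γ - β) * theta β γ = 1 - β := by
  unfold theta
  split_ifs with h
  · have h4 : 0 < γ - β := by linarith
    refine ⟨div_nonneg (by linarith) (by linarith), (div_le_one (by linarith)).2 (by linarith), ?_⟩
    field_simp
  · have hβ : β = 1 := le_antisymm h1 (not_lt.1 h)
    refine ⟨zero_le_one, le_rfl, by linarith⟩

/-- With `l = (1 - θ) * y` the two conditions involving `l` are equalities for every `θ`; the value
`theta β γ` makes the condition from large radii an equality too. -/
theorem Q3_mem_exponentRegion {β γ : ℝ} (h0 : 0 ≤ β) (h1 : β ≤ 1) (h2 : β + 1 ≤ 2 * γ)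
    (h3 : γ ≤ 1) : Q3 β γ ∈ exponentRegion β γ := by
  obtain ⟨ht0, ht1, ht⟩ := theta_spec h1 h2 h3
  simp only [exponentRegion, Q3, mem_ofPred_eq]
  set θ := theta β γ
  have hγ : 0 ≤ γ := by linarith
  have hD : 0 < 2 * (1 + γ * θ) := by positivity
  have hy : 0 < 1 / (2 * (1 + γ * θ)) := by positivity
  have e : 1 / (2 * (1 + γ * θ)) * (2 * (1 + γ * θ)) = 1 := by field_simp
  have e' : (2 - β * (1 - θ)) / (2 * (1 + γ * θ)) =
    (2 - β * (1 - θ)) * (1 / (2 * (1 + γ * θ))) := by ring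
  rw [e']
  set y := 1 / (2 * (1 + γ * θ))
  have hβθ : β * (1 - θ) ≤ 1 := by nlinarith
  refine ⟨hy.le, by nlinarith, ?_, (1 - θ) * y, mul_nonneg (by linarith) hy.le, by nlinarith, ?_, ?_⟩
  · have : 2 * (γ - β) * θ * y = (1 - β) * y := by rw [ht]
    linarith
  · linarith
  · linarith

/-! ### The two edges through the origin -/

theorem diag_mem_radialTypeSet {E : Set ℝ} (hE : E ⊆ Icc 1 2) {x : ℝ} (hx : 0 < x)
    (h : x < 1 / (1 + minkowskiDim E)) : (x, x) ∈ radialTypeSet E := by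
  have hβ0 := minkowskiDim_nonneg E
  have hβ1 := minkowskiDim_le_one hE
  have hγ1 := quasiAssouadDim_le_one E
  have hγ0 := quasiAssouadDim_nonneg E
  set β := minkowskiDim E
  set γ := quasiAssouadDim E
  rw [lt_div_iff₀ (by positivity)] at h
  have hd : 0 < 1 / 2 - β * x := by nlinarith
  -- The natural choice `l = x` would violate `β * l < x` when `β = 1`, so `l` is lowered by `η`,
  -- little enough to keep the last condition strict.
  set η := min x ((1 / 2 - β * x) / 2) with hη
  have hη0 : 0 < η := lt_min hx (by linarith)
  have hη1 : η ≤ x := min_le_left _ _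
  have hη2 : η ≤ (1 / 2 - β * x) / 2 := min_le_right _ _
  refine mem_radialTypeSet_of_lt hE hx le_rfl (l := x - η) (by linarith) (by linarith)
    (by linarith) ?_ ?_
  · have : β * (x - η) ≤ 1 * (x - η) := by gcongr
    linarith
  · have : (γ - β) * η ≤ 1 * η := by gcongr; linarith
    linarith

/-- The point `(1 / 4, 1 / 4)` is always admissible, since `β ≤ 1`, and supplies the measurability
needed at the origin. -/
theorem zero_mem_radialTypeSet {E : Set ℝ} (hE : E ⊆ Icc 1 2) : (0 : ℝ × ℝ) ∈ radialTypeSet E := by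
  have hβ0 := minkowskiDim_nonneg E
  have hβ1 := minkowskiDim_le_one hE
  have h : (1 / 4 : ℝ) < 1 / (1 + minkowskiDim E) := by
    rw [div_lt_div_iff₀ (by norm_num) (by positivity)]; linarith
  have := (diag_mem_radialTypeSet hE (by norm_num) h).2.2.top hE
  exact ⟨by simp, by simp, by simpa using this⟩

theorem segment_Q1_subset {E : Set ℝ} (hE : E ⊆ Icc 1 2) :
    segment ℝ 0 (Q1 (minkowskiDim E)) \ {Q1 (minkowskiDim E)} ⊆ radialTypeSet E := by
  have hβ0 := minkowskiDim_nonneg E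
  have hQ : 0 < 1 / (1 + minkowskiDim E) := one_div_pos.2 (by linarith)
  rintro u ⟨⟨a, b, ha, hb, hab, rfl⟩, hne⟩
  rw [smul_zero, zero_add] at hne ⊢
  rcases hb.eq_or_lt with rfl | hb
  · rw [zero_smul]; exact zero_mem_radialTypeSet hE
  have hb1 : b < 1 := by
    refine lt_of_le_of_ne (by linarith) fun h => hne ?_
    rw [h, one_smul]; rfl
  refine diag_mem_radialTypeSet hE (mul_pos hb hQ) ?_
  exact mul_lt_of_lt_one_left hQ hb1

/-- On this edge `q = 2 * p`. Strictly before `Q2 δ`, the bound on the Minkowski dimension gives the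
condition for large radii, and the bound on the Assouad dimension gives `1 + assouadDim E < p`,
leaving room for an exponent `c - 1` in between. -/
theorem openSegment_Q2_subset {E : Set ℝ} (hE : E ⊆ Icc 1 2) {δ : ℝ} (h₁ : minkowskiDim E ≤ δ)
    (h₂ : 2 * assouadDim E - 1 ≤ δ) : openSegment ℝ 0 (Q2 δ) ⊆ radialTypeSet E := by
  have hβ0 := minkowskiDim_nonneg E
  have hγs : 0 ≤ assouadDim E := Real.sInf_nonneg fun _ h => h.1.le
  rintro u ⟨a, b, ha, hb, hab, rfl⟩
  have h3 : 0 < 3 + δ := by linarith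
  set y := b * (1 / (3 + δ)) with hy
  have hy0 : 0 < y := by positivity
  have hy1 : y * (3 + δ) < 1 := by
    have : y * (3 + δ) = b := by rw [hy]; field_simp
    linarith
  have e : a • (0 : ℝ × ℝ) + b • Q2 δ = (2 * y, y) := by
    simp only [Q2, smul_zero, zero_add, Prod.smul_mk, smul_eq_mul, hy, Prod.mk.injEq, and_true]
    ring
  rw [e]
  refine mem_radialTypeSet_of_smallRadiusBound hE hy0 (by linarith) (by nlinarith) ?_
  have hp : 1 + assouadDim E < 1 / (2 * y) := by
    rw [lt_div_iff₀ (by positivity)]; nlinarith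
  obtain ⟨c, hc1, hc2⟩ := exists_between hp
  have := (nbhdBound_of_assouadDim_lt (E := E) (a := c - 1) (by linarith)
    (by linarith)).smallRadiusBound_endpoint (by linarith) (p := 1 / (2 * y)) (by linarith)
  have e2 : 2 * (1 / (2 * y)) = 1 / y := by field_simp
  rwa [e2] at this

end CircularMaximal

end

/-! ### Conclusion: vertices, convexity and edges -/

theorem theorem1p3 (E : Set ℝ) (hE : E ⊆ Set.Icc 1 2) (β γ γs : ℝ)
    (hβ : CircularMaximal.minkowskiDim E = β)
    (hγ : CircularMaximal.quasiAssouadDim E = γ)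
    (hγs : CircularMaximal.assouadDim E = γs) :
    (2 * γ < β + 1 →
      interior (CircularMaximal.triangle β) ∪
          (segment ℝ 0 (CircularMaximal.Q1 β) \ {CircularMaximal.Q1 β}) ∪
          openSegment ℝ 0 (CircularMaximal.Q2 (max β (2 * γs - 1))) ⊆
        CircularMaximal.radialTypeSet E) ∧
    (β + 1 ≤ 2 * γ →
      interior (CircularMaximal.quadrilateral β γ) ∪
          (segment ℝ 0 (CircularMaximal.Q1 β) \ {CircularMaximal.Q1 β}) ∪
          openSegment ℝ 0 (CircularMaximal.Q2 (2 * γs - 1)) ⊆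
        CircularMaximal.radialTypeSet E) := by
  subst hβ hγ hγs
  have hβ0 := CircularMaximal.minkowskiDim_nonneg E
  have hβ1 := CircularMaximal.minkowskiDim_le_one hE
  have hγ1 := CircularMaximal.quasiAssouadDim_le_one E
  have hγs := CircularMaximal.quasiAssouadDim_le_assouadDim E
  refine ⟨fun h => Set.union_subset (Set.union_subset ?_ (CircularMaximal.segment_Q1_subset hE)) ?_,
    fun h => Set.union_subset (Set.union_subset ?_ (CircularMaximal.segment_Q1_subset hE)) ?_⟩
  · refine (interior_mono (convexHull_min ?_ (CircularMaximal.convex_exponentRegion _ _))).trans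
      (CircularMaximal.interior_exponentRegion_subset hE)
    rintro u (rfl | rfl | rfl)
    · exact CircularMaximal.zero_mem_exponentRegion _ _
    · exact CircularMaximal.Q1_mem_exponentRegion _ hβ0 hβ1
    -- Here `2 * γ < β + 1` ensures that the quasi-Assouad condition does not cut off the vertex
    -- `Q₂(β)`.
    · exact CircularMaximal.Q2_mem_exponentRegion (by linarith) le_rfl (by linarith)
  · exact CircularMaximal.openSegment_Q2_subset hE (le_max_left _ _) (le_max_right _ _)
  · refine (interior_mono (convexHull_min ?_ (CircularMaximal.convex_exponentRegion _ _))).trans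
      (CircularMaximal.interior_exponentRegion_subset hE)
    rintro u (rfl | rfl | rfl | rfl)
    · exact CircularMaximal.zero_mem_exponentRegion _ _
    · exact CircularMaximal.Q1_mem_exponentRegion _ hβ0 hβ1
    · exact CircularMaximal.Q3_mem_exponentRegion hβ0 hβ1 h hγ1
    · exact CircularMaximal.Q2_mem_exponentRegion (by linarith) (by linarith) (by linarith)
  -- In this case `β ≤ 2 * γ - 1 ≤ 2 * γs - 1`, so no maximum is needed.
  · exact CircularMaximal.openSegment_Q2_subset hE (by linarith) le_rfl
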